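/- Let $R$ be a commutative unital ring and write $\operatorname{Mat}(R^n)$ for the algebra of $n\times n$ matrices. A spin system on $\mathbb Z$ is a function $q:\mathbb Z\to\{1,2,3,\dots\}$. For $Z\subseteq\mathbb Z$ put $\mathcal A(Z,q)=\varinjlim_{\Gamma\subseteq Z\text{ finite}}\bigotimes_{x\in\Gamma}\operatorname{Mat}(R^{q_x})$, where the tensor products are over $R$ and the transition maps are $a\mapsto a\otimes 1$; it is a subalgebra of $\mathcal A(\mathbb Z,q)$. An $R$-algebra automorphism $\alpha$ of $\mathcal A(\mathbb Z,q)$ has spread at most $l$ if $\alpha(\mathcal A(\{x\},q))\subseteq\mathcal A([x-l,x+l],q)$ for all $x\in\mathbb Z$. Let $\mathcal Q(\mathbb Z,q)$ be the group of automorphisms of finite spread (QCA). If $q_x\mid r_x$ for all $x$, stabilization $\alpha\mapsto\alpha\otimes\mathrm{id}$ (through the sitewise Kronecker isomorphism $\mathcal A(\mathbb Z,q)\otimes\mathcal A(\mathbb Z,r/q)\cong\mathcal A(\mathbb Z,r)$) is a homomorphism $\mathcal Q(\mathbb Z,q)\to\mathcal Q(\mathbb Z,r)$; the total QCA group is $\mathcal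 Q(\mathbb Z)=\varinjlim_q\mathcal Q(\mathbb Z,q)$, with elements written $[q,\alpha]$. A single-layer circuit on $q$ is an automorphism $\bigotimes_j\alpha_j$ of $\mathcal A(\mathbb Z,q)$, where $\mathbb Z=\coprod_jX_j$ is a partition into blocks of uniformly bounded diameter and $\alpha_j\in\operatorname{Aut}_R\mathcal A(X_j,q)$. Let $\mathcal C(\mathbb Z,q)\subseteq\mathcal Q(\mathbb Z,q)$ be the subgroup generated by the single-layer circuits and $\mathcal C(\mathbb Z)=\varinjlim_q\mathcal C(\mathbb Z,q)\subseteq\mathcal Q(\mathbb Z)$. An $R$-algebra $A$ is Azumaya if $A\otimes_RB\cong\operatorname{Mat}(R^n)$ for some $R$-algebra $B$ and some $n\ge 1$. Let $K_0(\mathrm{Az}(R))$ be the Grothendieck group, written multiplicatively, of the commutative monoid of isomorphism classes of Azumaya $R$-algebras under $\otimes_R$. **Theorem.** There is a group homomorphism $b:\mathcal Q(\mathbb Z)\to K_0(\mathrm{Az}(R))$ with the following properties. 1. (The map is explicit: informally, $b([q,\alpha])=\alpha(\mathcal A(\mathbb Z\cap(-\infty,\gamma],q))/\mathcal A(\mathbb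 Z\cap(-\infty,\gamma],q)$.) Let $[q,\alpha]\in\mathcal Q(\mathbb Z)$, let $l\ge 0$ be an integer such that $\alpha$ has spread at most $l$, let $\gamma\in\mathbb Z$, and put $$B=\alpha\bigl(\mathcal A(\mathbb Z\cap(-\infty,\gamma],q)\bigr)\cap\mathcal A(\mathbb Z\cap(\gamma-l,\gamma+l],q).$$ Then $\alpha(\mathcal A(\mathbb Z\cap(-\infty,\gamma],q))=\mathcal A(\mathbb Z\cap(-\infty,\gamma-l],q)\otimes B$ (an internal tensor product in $\mathcal A(\mathbb Z,q)$), both $B$ and $\mathcal A(\mathbb Z\cap(\gamma-l,\gamma],q)$ are Azumaya $R$-algebras, and $$b([q,\alpha])=\frac{B}{\mathcal A(\mathbb Z\cap(\gamma-l,\gamma],q)}\in K_0(\mathrm{Az}(R)).$$ 2. $b$ is surjective. 3. $\ker b=\mathcal C(\mathbb Z)$. Moreover, every element of $\mathcal C(\mathbb Z)$ is a composition of at most two single-layer circuits: it is equal to $[q,\alpha\circ\beta]$ for some spin system $q$ and single-layer circuits $\alpha,\beta$ on $q$ (either of which may be the identity). -/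

import Mathlib

open scoped TensorProduct

namespace QCA

noncomputable section

/-! ### Maps out of finite tensor products of noncommutative algebras -/

section PiLift

variable {ι : Type*} [dι : DecidableEq ι] {R : Type*} [CommRing R]
  {A : ι → Type*} [∀ i, Ring (A i)] [∀ i, Algebra R (A i)] {C : Type*} [Ring C] [Algebra R C]

/-- A family of algebra maps with pairwise commuting ranges defines an algebra map on the
tensor product. -/
def piLift [Fintype ι] (φ : ∀ i, A i →ₐ[R] C)
    (hφ : Pairwise fun i j => ∀ a b, Commute (φ i a) (φ j b)) : (⨂[R] i, A i) →ₐ[R] C :=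
  let m : (∀ i, A i) →* C := MonoidHom.noncommPiCoprod (fun i => (φ i : A i →* C)) hφ
  have key : ∀ (a : ∀ i, A i) (i : ι) (b : A i),
      m (Function.update a i b) = φ i b * m (Function.update a i 1) := by
    intro a i b
    have : Function.update a i b = Pi.mulSingle i b * Function.update a i 1 := by
      funext x
      by_cases h : x = i
      · subst h; simp
      · simp [h]
    rw [this, map_mul]
    congr 1
    exact MonoidHom.noncommPiCoprod_mulSingle (ϕ := fun i => (φ i : A i →* C)) (hcomm := hφ) i b
  PiTensorProduct.liftAlgHom
    { toFun := m
      map_update_add' := fun {dec} a i b c => by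
        have e : dec = dι := Subsingleton.elim _ _
        subst e
        rw [key, key a i b, key a i c, map_add, add_mul]
      map_update_smul' := fun {dec} a i r b => by
        have e : dec = dι := Subsingleton.elim _ _
        subst e
        rw [key, key a i b, map_smul, smul_mul_assoc] }
    (map_one m) (map_mul m)

theorem piLift_single [Fintype ι] (φ : ∀ i, A i →ₐ[R] C)
    (hφ : Pairwise fun i j => ∀ a b, Commute (φ i a) (φ j b)) (i : ι) (a : A i) :
    piLift φ hφ (PiTensorProduct.singleAlgHom (R := R) (A := A) i a) = φ i a := by
  rw [PiTensorProduct.singleAlgHom_apply]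
  refine (PiTensorProduct.lift.tprod _).trans ?_
  exact MonoidHom.noncommPiCoprod_mulSingle (ϕ := fun i => (φ i : A i →* C)) (hcomm := hφ) i a

theorem commute_single {i j : ι} (h : i ≠ j) (a : A i) (b : A j) :
    Commute (PiTensorProduct.singleAlgHom (R := R) (A := A) i a)
      (PiTensorProduct.singleAlgHom (R := R) (A := A) j b) := by
  simp only [PiTensorProduct.singleAlgHom_apply]
  exact Commute.tprod (Pi.mulSingle_commute h a b)

theorem piTensor_mem [Fintype ι] {S : Subalgebra R (⨂[R] i, A i)}
    (h : ∀ i a, PiTensorProduct.singleAlgHom (R := R) (A := A) i a ∈ S) (t : ⨂[R] i, A i) :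
    t ∈ S := by
  let φ : ∀ i, A i →ₐ[R] S := fun i => (PiTensorProduct.singleAlgHom i).codRestrict S (h i)
  have hφ : Pairwise fun i j => ∀ a b, Commute (φ i a) (φ j b) :=
    fun i j hij a b => Subtype.ext (commute_single hij a b)
  have : S.val.comp (piLift φ hφ) = AlgHom.id R _ :=
    PiTensorProduct.algHom_ext fun i => AlgHom.ext fun a =>
      congrArg Subtype.val (piLift_single φ hφ i a)
  have := DFunLike.congr_fun this t
  rw [AlgHom.id_apply] at this
  rw [← this]
  exact (piLift φ hφ t).2

end PiLift

section TensorAut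

variable {R A B C : Type*} [CommRing R] [Ring A] [Algebra R A] [Ring B] [Algebra R B]
  [Ring C] [Algebra R C]

/-- The automorphism `Φ ∘ (α ⊗ id) ∘ Φ⁻¹` of `C`, for an isomorphism `Φ : A ⊗ B ≃ C`. -/
def tensorAut (Φ : A ⊗[R] B ≃ₐ[R] C) : (A ≃ₐ[R] A) →* (C ≃ₐ[R] C) where
  toFun α := Φ.symm.trans ((Algebra.TensorProduct.congr α AlgEquiv.refl).trans Φ)
  map_one' := by
    ext t
    change Φ (Algebra.TensorProduct.congr AlgEquiv.refl AlgEquiv.refl (Φ.symm t)) = t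
    rw [Algebra.TensorProduct.congr_refl]
    exact Φ.apply_symm_apply t
  map_mul' α β := by
    ext t
    change Φ (Algebra.TensorProduct.congr (β.trans α) (AlgEquiv.refl.trans AlgEquiv.refl)
      (Φ.symm t)) = Φ (Algebra.TensorProduct.congr α AlgEquiv.refl
        (Φ.symm (Φ (Algebra.TensorProduct.congr β AlgEquiv.refl (Φ.symm t)))))
    rw [Φ.symm_apply_apply, Algebra.TensorProduct.congr_trans]
    rfl

theorem tensorAut_tmul (Φ : A ⊗[R] B ≃ₐ[R] C) (α : A ≃ₐ[R] A) (a : A) (b : B) :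
    tensorAut Φ α (Φ (a ⊗ₜ b)) = Φ (α a ⊗ₜ b) := by
  change Φ (Algebra.TensorProduct.congr α AlgEquiv.refl (Φ.symm (Φ (a ⊗ₜ b)))) = _
  rw [Φ.symm_apply_apply]
  rfl

end TensorAut

/-! ### Restricted tensor products of algebras -/

section RestrictedTensorProduct

universe u v w

variable {X : Type v} [DecidableEq X] (R : Type u) [CommRing R]
  (A : X → Type w) [∀ x, Ring (A x)] [∀ x, Algebra R (A x)]

/-- The finite tensor product `⨂_{x ∈ Γ} A x` over `R`, for a finite set `Γ` of sites. -/
abbrev FinTensor (Γ : Finset X) : Type _ := ⨂[R] x : Γ, A x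

variable {A}

/-- Extension of a family indexed by `Γ` by the unit outside `Γ`. -/
def extendOne {Γ Γ' : Finset X} (a : ∀ x : Γ, A x) (x : Γ') : A x :=
  if h : (x : X) ∈ Γ then a ⟨x, h⟩ else 1

theorem extendOne_update {Γ Γ' : Finset X} (h : Γ ≤ Γ') [d : DecidableEq Γ]
    (a : ∀ x : Γ, A x) (i : Γ) (b : A i) :
    (extendOne (Function.update a i b) : ∀ x : Γ', A x) =
      Function.update (extendOne a) ⟨i, h i.2⟩ b := by
  funext x
  by_cases hx : x = ⟨i, h i.2⟩
  · subst hx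
    simp [extendOne]
  · have hx' : (x : X) ≠ i := fun e => hx (Subtype.ext e)
    rw [Function.update_of_ne hx]
    unfold extendOne
    split_ifs with hm
    · rw [Function.update_of_ne]
      exact fun e => hx' (congrArg Subtype.val e)
    · rfl

theorem extendOne_one {Γ Γ' : Finset X} :
    (extendOne (1 : ∀ x : Γ, A x) : ∀ x : Γ', A x) = 1 := by
  funext x
  simp [extendOne]

variable (A)

/-- The inclusion `a ↦ a ⊗ 1` of the tensor product over `Γ` into the one over `Γ' ⊇ Γ`. -/
def FinTensor.incl {Γ Γ' : Finset X} (h : Γ ≤ Γ') : FinTensor R A Γ →ₐ[R] FinTensor R A Γ' :=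
  PiTensorProduct.liftAlgHom
    { toFun := fun a => PiTensorProduct.tprod R (extendOne a)
      map_update_add' := fun a i b c => by
        simp only [extendOne_update h, MultilinearMap.map_update_add]
      map_update_smul' := fun a i r b => by
        simp only [extendOne_update h, MultilinearMap.map_update_smul] }
    (by
      change PiTensorProduct.tprod R (extendOne 1) = 1
      rw [extendOne_one]; rfl)
    (fun a b => by
      change PiTensorProduct.tprod R _ = PiTensorProduct.tprod R _ * PiTensorProduct.tprod R _
      rw [PiTensorProduct.tprod_mul_tprod]
      congr 1
      funext x
      simp only [extendOne, Pi.mul_apply]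
      split_ifs <;> simp)

theorem FinTensor.incl_tprod {Γ Γ' : Finset X} (h : Γ ≤ Γ') (a : ∀ x : Γ, A x) :
    FinTensor.incl R A h (PiTensorProduct.tprod R a) = PiTensorProduct.tprod R (extendOne a) :=
  PiTensorProduct.lift.tprod _

theorem FinTensor.incl_single {Γ Γ' : Finset X} (h : Γ ≤ Γ') (i : Γ) (a : A i) :
    FinTensor.incl R A h (PiTensorProduct.singleAlgHom (R := R) (A := fun x : Γ => A x) i a) =
      PiTensorProduct.singleAlgHom (R := R) (A := fun x : Γ' => A x) ⟨i, h i.2⟩ a := by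
  simp only [PiTensorProduct.singleAlgHom_apply, FinTensor.incl_tprod, MonoidHom.mulSingle_apply,
    Pi.mulSingle]
  rw [extendOne_update h, extendOne_one]

instance : DirectedSystem (FinTensor R A) (fun _ _ h => FinTensor.incl R A h) where
  map_self Γ a := by
    have : FinTensor.incl R A (le_refl Γ) = AlgHom.id R _ :=
      PiTensorProduct.algHom_ext fun i => AlgHom.ext fun a => FinTensor.incl_single R A (le_refl Γ) i a
    exact DFunLike.congr_fun this a
  map_map Γ₁ Γ₂ Γ₃ h h' a := by
    have : (FinTensor.incl R A h').comp (FinTensor.incl R A h) =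
        FinTensor.incl R A (h.trans h') :=
      PiTensorProduct.algHom_ext fun i => AlgHom.ext fun a => by
        simp only [AlgHom.comp_apply, FinTensor.incl_single]
    exact DFunLike.congr_fun this a

/-- The (restricted) tensor product `⨂_{x ∈ X} A x = colim_Γ ⨂_{x ∈ Γ} A x`, the direct limit of
the finite tensor products over the finite subsets `Γ` of `X` along `a ↦ a ⊗ 1`. -/
def LocalTensor : Type _ := DirectLimit (FinTensor R A) (fun _ _ h => FinTensor.incl R A h)

namespace LocalTensor

instance : Ring (LocalTensor R A) :=
  inferInstanceAs (Ring (DirectLimit (FinTensor R A) (fun _ _ h => FinTensor.incl R A h)))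

instance : Algebra R (LocalTensor R A) :=
  inferInstanceAs (Algebra R (DirectLimit (FinTensor R A) (fun _ _ h => FinTensor.incl R A h)))

/-- The canonical map from a finite tensor product. -/
def of (Γ : Finset X) : FinTensor R A Γ →ₐ[R] LocalTensor R A :=
  DirectLimit.Algebra.of (FinTensor R A) (fun _ _ h => FinTensor.incl R A h) Γ

theorem of_incl {Γ Γ' : Finset X} (h : Γ ≤ Γ') (a : FinTensor R A Γ) :
    of R A Γ' (FinTensor.incl R A h a) = of R A Γ a :=
  DirectLimit.Algebra.of_f h a

theorem exists_of (a : LocalTensor R A) : ∃ Γ b, of R A Γ b = a := by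
  obtain ⟨Γ, b, h⟩ := DirectLimit.exists_eq_mk _ a
  exact ⟨Γ, b, h.symm⟩

/-- The inclusion of the algebra at a single site. -/
def site (x : X) : A x →ₐ[R] LocalTensor R A :=
  (of R A {x}).comp (PiTensorProduct.singleAlgHom (R := R) (A := fun y : ({x} : Finset X) => A y)
    ⟨x, Finset.mem_singleton_self x⟩)

theorem of_single (Γ : Finset X) (i : Γ) (a : A i) :
    of R A Γ (PiTensorProduct.singleAlgHom (R := R) (A := fun x : Γ => A x) i a) =
      site R A i a := by
  have h : ({(i : X)} : Finset X) ≤ Γ := Finset.singleton_subset_iff.2 i.2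
  rw [site, AlgHom.comp_apply, ← of_incl R A h, FinTensor.incl_single]

theorem site_commute {x y : X} (h : x ≠ y) (a : A x) (b : A y) :
    Commute (site R A x a) (site R A y b) := by
  have hx : x ∈ ({x, y} : Finset X) := by simp
  have hy : y ∈ ({x, y} : Finset X) := by simp
  rw [← of_single R A {x, y} ⟨x, hx⟩ a, ← of_single R A {x, y} ⟨y, hy⟩ b]
  exact (commute_single (A := fun z : ({x, y} : Finset X) => A z) (i := ⟨x, hx⟩) (j := ⟨y, hy⟩)
    (fun e => h (congrArg Subtype.val e)) a b).map _

variable {R A}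
variable {C : Type*} [Ring C] [Algebra R C]

theorem algHom_ext {f g : LocalTensor R A →ₐ[R] C}
    (h : ∀ x a, f (site R A x a) = g (site R A x a)) : f = g := by
  ext t
  obtain ⟨Γ, b, rfl⟩ := exists_of R A t
  have : f.comp (of R A Γ) = g.comp (of R A Γ) :=
    PiTensorProduct.algHom_ext fun i => AlgHom.ext fun a => by
      have := h i a
      rw [← of_single R A Γ i a] at this
      exact this
  exact DFunLike.congr_fun this b

/-- The universal property of the restricted tensor product. -/
def lift (φ : ∀ x, A x →ₐ[R] C) (hφ : ∀ x y, x ≠ y → ∀ a b, Commute (φ x a) (φ y b)) :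
    LocalTensor R A →ₐ[R] C :=
  DirectLimit.Algebra.lift (FinTensor R A) (fun _ _ h => FinTensor.incl R A h) C
    (fun Γ => piLift (fun x : Γ => φ x) (fun x y h => hφ x y (fun e => h (Subtype.ext e))))
    (fun Γ Γ' h a => by
      have : (piLift (fun x : Γ' => φ x)
            (fun x y h => hφ x y (fun e => h (Subtype.ext e)))).comp (FinTensor.incl R A h) =
          piLift (fun x : Γ => φ x) (fun x y h => hφ x y (fun e => h (Subtype.ext e))) :=
        PiTensorProduct.algHom_ext fun i => AlgHom.ext fun a =>
          (congrArg _ (FinTensor.incl_single R A h i a)).trans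
            ((piLift_single (fun x : Γ' => φ x) _ ⟨i, h i.2⟩ a).trans
              (piLift_single (fun x : Γ => φ x) _ i a).symm)
      exact DFunLike.congr_fun this a)

@[simp]
theorem lift_site (φ : ∀ x, A x →ₐ[R] C)
    (hφ : ∀ x y, x ≠ y → ∀ a b, Commute (φ x a) (φ y b)) (x : X) (a : A x) :
    lift φ hφ (site R A x a) = φ x a :=
  piLift_single (fun y : ({x} : Finset X) => φ y) _ ⟨x, Finset.mem_singleton_self x⟩ a

variable (R A) in
/-- The subalgebra of observables supported on `Z`: the union of the images of the finite tensor
products over the finite subsets of `Z`. -/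
def supported (Z : Set X) : Subalgebra R (LocalTensor R A) :=
  ⨆ (Γ : Finset X) (_ : (Γ : Set X) ⊆ Z), (of R A Γ).range

theorem of_mem {Γ : Finset X} {S : Subalgebra R (LocalTensor R A)}
    (h : ∀ x ∈ Γ, ∀ a, site R A x a ∈ S) (b : FinTensor R A Γ) : of R A Γ b ∈ S :=
  piTensor_mem (S := S.comap (of R A Γ)) (fun i a => by
    rw [Subalgebra.mem_comap, of_single]
    exact h i i.2 a) b

theorem site_mem_supported {Z : Set X} {x : X} (hx : x ∈ Z) (a : A x) :
    site R A x a ∈ supported R A Z := by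
  have h : ((({x} : Finset X)) : Set X) ⊆ Z := by simpa using hx
  exact (le_iSup₂_of_le (f := fun (Γ : Finset X) (_ : (Γ : Set X) ⊆ Z) => (of R A Γ).range)
    {x} h le_rfl) ⟨_, rfl⟩

theorem supported_le_iff {Z : Set X} {S : Subalgebra R (LocalTensor R A)} :
    supported R A Z ≤ S ↔ ∀ x ∈ Z, ∀ a, site R A x a ∈ S := by
  constructor
  · exact fun h x hx a => h (site_mem_supported hx a)
  · intro h
    refine iSup₂_le fun Γ hΓ => ?_
    rintro _ ⟨b, rfl⟩
    exact of_mem (fun x hx => h x (hΓ hx)) b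

theorem supported_mono {Z W : Set X} (h : Z ⊆ W) : supported R A Z ≤ supported R A W :=
  supported_le_iff.2 fun _ hx a => site_mem_supported (h hx) a

theorem mem_of_site_mem {S : Subalgebra R (LocalTensor R A)} (h : ∀ x a, site R A x a ∈ S)
    (t : LocalTensor R A) : t ∈ S := by
  obtain ⟨Γ, b, rfl⟩ := exists_of R A t
  exact of_mem (fun x _ => h x) b

theorem commute_of_site {D : Type*} [Ring D] [Algebra R D] {f : LocalTensor R A →ₐ[R] D} {d : D}
    (h : ∀ x a, Commute (f (site R A x a)) d) (t : LocalTensor R A) : Commute (f t) d := by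
  have := mem_of_site_mem (S := (Subalgebra.centralizer R {d}).comap f) (fun x a => by
    rw [Subalgebra.mem_comap, Subalgebra.mem_centralizer_iff]
    rintro _ rfl
    exact (h x a).eq.symm) t
  rw [Subalgebra.mem_comap, Subalgebra.mem_centralizer_iff] at this
  exact (this d rfl).symm

variable {B : X → Type w} [∀ x, Ring (B x)] [∀ x, Algebra R (B x)]

/-- Sitewise maps induce a map of restricted tensor products. -/
def map (e : ∀ x, A x →ₐ[R] B x) : LocalTensor R A →ₐ[R] LocalTensor R B :=
  lift (fun x => (site R B x).comp (e x)) fun _ _ h _ _ => site_commute R B h _ _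

@[simp]
theorem map_site (e : ∀ x, A x →ₐ[R] B x) (x : X) (a : A x) :
    map e (site R A x a) = site R B x (e x a) :=
  lift_site _ _ x a

/-- Sitewise isomorphisms induce an isomorphism of restricted tensor products. -/
def congr (e : ∀ x, A x ≃ₐ[R] B x) : LocalTensor R A ≃ₐ[R] LocalTensor R B :=
  AlgEquiv.ofAlgHom (map fun x => (e x : A x →ₐ[R] B x))
    (map fun x => ((e x).symm : B x →ₐ[R] A x))
    (algHom_ext fun x a => by
      rw [AlgHom.comp_apply, map_site, map_site]
      simp)
    (algHom_ext fun x a => by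
      rw [AlgHom.comp_apply, map_site, map_site]
      simp)

@[simp]
theorem congr_site (e : ∀ x, A x ≃ₐ[R] B x) (x : X) (a : A x) :
    congr e (site R A x a) = site R B x (e x a) :=
  map_site (fun x => (e x : A x →ₐ[R] B x)) x a

/-- The map `(⨂ A x) ⊗ (⨂ B x) → ⨂ (A x ⊗ B x)`, given sitewise by `a ⊗ b ↦ a ⊗ b`. -/
def tensorHom :
    LocalTensor R A ⊗[R] LocalTensor R B →ₐ[R] LocalTensor R (fun x => A x ⊗[R] B x) :=
  Algebra.TensorProduct.lift
      (map fun _ => Algebra.TensorProduct.includeLeft)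
      (map fun _ => Algebra.TensorProduct.includeRight)
      (fun s t => by
        refine commute_of_site (fun x a => (commute_of_site (fun y b => ?_) t).symm) s
        rw [map_site, map_site]
        by_cases h : x = y
        · subst h
          refine Commute.map ?_ _
          simp [Commute, SemiconjBy]
        · exact (site_commute R _ h _ _).symm)

theorem tensorHom_tmul (s : LocalTensor R A) (t : LocalTensor R B) :
    tensorHom (s ⊗ₜ[R] t) = map (B := fun x => A x ⊗[R] B x)
        (fun _ => Algebra.TensorProduct.includeLeft) s *
      map (B := fun x => A x ⊗[R] B x) (fun _ => Algebra.TensorProduct.includeRight) t :=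
  Algebra.TensorProduct.lift_tmul ..

/-- The inverse of `tensorHom`. -/
def tensorInv :
    LocalTensor R (fun x => A x ⊗[R] B x) →ₐ[R] LocalTensor R A ⊗[R] LocalTensor R B :=
  lift (fun x => Algebra.TensorProduct.map (site R A x) (site R B x))
      fun x y h a b => by
        induction a using TensorProduct.induction_on with
        | zero => simp
        | add a a' h h' => rw [map_add]; exact h.add_left h'
        | tmul a a' =>
          induction b using TensorProduct.induction_on with
          | zero => simp
          | add b b' h h' => rw [map_add]; exact h.add_right h'
          | tmul b b' =>
            simp only [Algebra.TensorProduct.map_tmul, Commute, SemiconjBy,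
              Algebra.TensorProduct.tmul_mul_tmul]
            rw [(site_commute R A h a b).eq, (site_commute R B h a' b').eq]

theorem tensorInv_site (x : X) (a : A x ⊗[R] B x) :
    tensorInv (site R (fun x => A x ⊗[R] B x) x a) =
      Algebra.TensorProduct.map (site R A x) (site R B x) a := by
  unfold tensorInv
  rw [lift_site]

/-- `(⨂ A x) ⊗ (⨂ B x) ≃ ⨂ (A x ⊗ B x)`, given sitewise by `a ⊗ b ↦ a ⊗ b`. -/
def tensorEquiv :
    LocalTensor R A ⊗[R] LocalTensor R B ≃ₐ[R] LocalTensor R (fun x => A x ⊗[R] B x) :=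
  AlgEquiv.ofAlgHom tensorHom tensorInv
    (algHom_ext fun x a => by
      rw [AlgHom.comp_apply, tensorInv_site]
      induction a using TensorProduct.induction_on with
      | zero => simp
      | add a a' h h' => simp only [map_add, h, h']
      | tmul a a' =>
        rw [Algebra.TensorProduct.map_tmul, tensorHom_tmul, map_site, map_site, ← map_mul]
        simp)
    (by
      refine Algebra.TensorProduct.ext (algHom_ext fun x a => ?_) (algHom_ext fun x a => ?_)
      · simp only [AlgHom.comp_apply, Algebra.TensorProduct.includeLeft_apply, tensorHom_tmul,
          map_one, mul_one, map_site, tensorInv_site, Algebra.TensorProduct.map_tmul,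
          AlgHom.id_apply]
      · simp only [AlgHom.comp_apply, AlgHom.coe_restrictScalars', tensorHom_tmul,
          Algebra.TensorProduct.includeRight_apply,
          map_one, one_mul, map_site, tensorInv_site,
          Algebra.TensorProduct.map_tmul, AlgHom.id_apply])

variable {D : X → Type w} [∀ x, Ring (D x)] [∀ x, Algebra R (D x)]

/-- `(⨂ A x) ⊗ (⨂ B x) ≃ ⨂ D x`, given sitewise by isomorphisms `A x ⊗ B x ≃ D x`. -/
def tensorCongr (e : ∀ x, A x ⊗[R] B x ≃ₐ[R] D x) :
    LocalTensor R A ⊗[R] LocalTensor R B ≃ₐ[R] LocalTensor R D :=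
  (tensorEquiv (A := A) (B := B)).trans (congr (A := fun x => A x ⊗[R] B x) e)

theorem tensorCongr_tmul (e : ∀ x, A x ⊗[R] B x ≃ₐ[R] D x) (s : LocalTensor R A)
    (t : LocalTensor R B) :
    tensorCongr e (s ⊗ₜ t) =
      map (fun x => (e x).toAlgHom.comp Algebra.TensorProduct.includeLeft) s *
      map (fun x => (e x).toAlgHom.comp Algebra.TensorProduct.includeRight) t := by
  have h1 : tensorCongr e (s ⊗ₜ t) =
      congr (A := fun x => A x ⊗[R] B x) e (tensorHom (s ⊗ₜ t)) := rfl
  have h2 : (congr (A := fun x => A x ⊗[R] B x) e).toAlgHom.comp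
      (map (B := fun x => A x ⊗[R] B x) fun _ => Algebra.TensorProduct.includeLeft) =
      map (fun x => (e x).toAlgHom.comp Algebra.TensorProduct.includeLeft) :=
    algHom_ext fun x a => by
      rw [AlgHom.comp_apply, map_site, map_site]
      exact congr_site (A := fun x => A x ⊗[R] B x) e x _
  have h3 : (congr (A := fun x => A x ⊗[R] B x) e).toAlgHom.comp
      (map (B := fun x => A x ⊗[R] B x) fun _ => Algebra.TensorProduct.includeRight) =
      map (fun x => (e x).toAlgHom.comp Algebra.TensorProduct.includeRight) :=
    algHom_ext fun x a => by
      rw [AlgHom.comp_apply, map_site, map_site]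
      exact congr_site (A := fun x => A x ⊗[R] B x) e x _
  rw [h1, tensorHom_tmul, map_mul, ← h2, ← h3]
  rfl

end LocalTensor

end RestrictedTensorProduct

/-! ### Kronecker products of matrices -/

section Kronecker

variable (R : Type*) [CommRing R]

/-- The algebra `Mat(R^n)` of `n × n` matrices. -/
abbrev Mat (n : ℕ) : Type _ := Matrix (Fin n) (Fin n) R

variable {m k n l p k' : ℕ}

/-- The Kronecker product `Mat(R^m) ⊗ Mat(R^k) ≃ Mat(R^n)` for `m * k = n`: the `m × m` block
matrix with blocks `a i j • b`. -/
def kron (h : m * k = n) : Mat R m ⊗[R] Mat R k ≃ₐ[R] Mat R n :=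
  (Matrix.kroneckerAlgEquiv (Fin m) (Fin k) R).trans
    (Matrix.reindexAlgEquiv R R (finProdFinEquiv.trans (finCongr h)))

variable {R}

theorem kron_tmul_apply (h : m * k = n) (a : Mat R m) (b : Mat R k) (i₁ j₁ : Fin m)
    (i₂ j₂ : Fin k) :
    kron R h (a ⊗ₜ b) (finCongr h (finProdFinEquiv (i₁, i₂)))
      (finCongr h (finProdFinEquiv (j₁, j₂))) = a i₁ j₁ * b i₂ j₂ := by
  simp [kron]

variable (R)

/-- `a ↦ a ⊗ 1`. -/
def kronL (h : m * k = n) : Mat R m →ₐ[R] Mat R n :=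
  (kron R h).toAlgHom.comp Algebra.TensorProduct.includeLeft

/-- `b ↦ 1 ⊗ b`. -/
def kronR (h : m * k = n) : Mat R k →ₐ[R] Mat R n :=
  (kron R h).toAlgHom.comp Algebra.TensorProduct.includeRight

variable {R}

theorem kron_tmul_eq (h : m * k = n) (a : Mat R m) (b : Mat R k) :
    kron R h (a ⊗ₜ b) = kronL R h a * kronR R h b := by
  simp only [kronL, kronR, AlgHom.comp_apply, Algebra.TensorProduct.includeLeft_apply,
    Algebra.TensorProduct.includeRight_apply, ← map_mul,
    Algebra.TensorProduct.tmul_mul_tmul, mul_one, one_mul]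
  rfl

theorem exists_index (h : m * k = n) (i : Fin n) :
    ∃ i₁ i₂, i = finCongr h (finProdFinEquiv (i₁, i₂)) := by
  obtain ⟨⟨i₁, i₂⟩, hi⟩ := (finProdFinEquiv.trans (finCongr h)).surjective i
  exact ⟨i₁, i₂, hi.symm⟩

theorem kronL_apply (h : m * k = n) (a : Mat R m) (i₁ j₁ : Fin m) (i₂ j₂ : Fin k) :
    kronL R h a (finCongr h (finProdFinEquiv (i₁, i₂)))
      (finCongr h (finProdFinEquiv (j₁, j₂))) = a i₁ j₁ * (1 : Mat R k) i₂ j₂ :=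
  kron_tmul_apply h a 1 i₁ j₁ i₂ j₂

theorem kronR_apply (h : m * k = n) (b : Mat R k) (i₁ j₁ : Fin m) (i₂ j₂ : Fin k) :
    kronR R h b (finCongr h (finProdFinEquiv (i₁, i₂)))
      (finCongr h (finProdFinEquiv (j₁, j₂))) = (1 : Mat R m) i₁ j₁ * b i₂ j₂ :=
  kron_tmul_apply h 1 b i₁ j₁ i₂ j₂

theorem index_assoc (h₁ : m * k = n) (h₂ : n * l = p) (h₃ : m * k' = p) (hk : k * l = k')
    (i₁ : Fin m) (i₂ : Fin k) (i₃ : Fin l) :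
    finCongr h₂ (finProdFinEquiv (finCongr h₁ (finProdFinEquiv (i₁, i₂)), i₃)) =
      finCongr h₃ (finProdFinEquiv (i₁, finCongr hk (finProdFinEquiv (i₂, i₃)))) := by
  subst hk h₁
  apply Fin.ext
  simp [finProdFinEquiv]
  ring

theorem kronL_kronL (h₁ : m * k = n) (h₂ : n * l = p) (h₃ : m * k' = p) (hk : k * l = k')
    (a : Mat R m) : kronL R h₂ (kronL R h₁ a) = kronL R h₃ a := by
  ext i j
  obtain ⟨i₁', i₃, rfl⟩ := exists_index h₂ i
  obtain ⟨i₁, i₂, rfl⟩ := exists_index h₁ i₁'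
  obtain ⟨j₁', j₃, rfl⟩ := exists_index h₂ j
  obtain ⟨j₁, j₂, rfl⟩ := exists_index h₁ j₁'
  rw [kronL_apply, kronL_apply, index_assoc h₁ h₂ h₃ hk, index_assoc h₁ h₂ h₃ hk, kronL_apply]
  simp only [Matrix.one_apply, EmbeddingLike.apply_eq_iff_eq, Prod.mk.injEq]
  split_ifs <;> simp_all

theorem kronR_kronL (h₁ : m * k = n) (h₂ : n * l = p) (h₃ : m * k' = p) (hk : k * l = k')
    (b : Mat R k) : kronR R h₃ (kronL R hk b) = kronL R h₂ (kronR R h₁ b) := by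
  ext i j
  obtain ⟨i₁', i₃, rfl⟩ := exists_index h₂ i
  obtain ⟨i₁, i₂, rfl⟩ := exists_index h₁ i₁'
  obtain ⟨j₁', j₃, rfl⟩ := exists_index h₂ j
  obtain ⟨j₁, j₂, rfl⟩ := exists_index h₁ j₁'
  rw [kronL_apply, kronR_apply, index_assoc h₁ h₂ h₃ hk, index_assoc h₁ h₂ h₃ hk, kronR_apply,
    kronL_apply, mul_assoc]

theorem kronR_kronR (h₁ : m * k = n) (h₂ : n * l = p) (h₃ : m * k' = p) (hk : k * l = k')
    (c : Mat R l) : kronR R h₃ (kronR R hk c) = kronR R h₂ c := by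
  ext i j
  obtain ⟨i₁', i₃, rfl⟩ := exists_index h₂ i
  obtain ⟨i₁, i₂, rfl⟩ := exists_index h₁ i₁'
  obtain ⟨j₁', j₃, rfl⟩ := exists_index h₂ j
  obtain ⟨j₁, j₂, rfl⟩ := exists_index h₁ j₁'
  rw [kronR_apply, index_assoc h₁ h₂ h₃ hk, index_assoc h₁ h₂ h₃ hk, kronR_apply,
    kronR_apply]
  simp only [Matrix.one_apply, EmbeddingLike.apply_eq_iff_eq, Prod.mk.injEq]
  split_ifs <;> simp_all

theorem kronL_self (h : m * k = m) (hm : 0 < m) (a : Mat R m) : kronL R h a = a := by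
  obtain rfl : k = 1 := Nat.eq_of_mul_eq_mul_left hm (by simpa using h)
  ext i j
  obtain ⟨i₁, i₂, rfl⟩ := exists_index h i
  obtain ⟨j₁, j₂, rfl⟩ := exists_index h j
  rw [kronL_apply, Subsingleton.elim i₂ 0, Subsingleton.elim j₂ 0, Matrix.one_apply_eq, mul_one]
  congr 1 <;> apply Fin.ext <;> simp [finProdFinEquiv]

theorem kronR_self (h : m * k = m) (hm : 0 < m) (b : Mat R k) :
    ∃ r : R, b = algebraMap R _ r := by
  obtain rfl : k = 1 := Nat.eq_of_mul_eq_mul_left hm (by simpa using h)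
  refine ⟨b 0 0, Matrix.ext fun i j => ?_⟩
  rw [Subsingleton.elim i 0, Subsingleton.elim j 0, Matrix.algebraMap_matrix_apply]
  simp

/-- If `t` lies in the algebra generated by `T` and a commuting matrix algebra, and commutes with
the latter, then `t` lies in `T`. -/
theorem mem_of_commute_matrix {C : Type*} [Ring C] [Algebra R C] (T : Subalgebra R C) (hn : 0 < n)
    (φ : Mat R n →ₐ[R] C) (hT : ∀ s ∈ T, ∀ b, Commute s (φ b)) {t : C} (ht : t ∈ T ⊔ φ.range)
    (hc : ∀ b, Commute t (φ b)) : t ∈ T := by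
  let f : T ⊗[R] Mat R n →ₐ[R] C :=
    Algebra.TensorProduct.lift T.val φ fun s b => hT s s.2 b
  have hff : ∀ s b, f (s ⊗ₜ b) = s * φ b := fun s b => Algebra.TensorProduct.lift_tmul ..
  have hf : T ⊔ φ.range ≤ f.range := by
    refine sup_le (fun s hs => ⟨⟨s, hs⟩ ⊗ₜ 1, ?_⟩) ?_
    · exact (hff _ _).trans (by simp)
    · rintro _ ⟨b, rfl⟩
      exact ⟨1 ⊗ₜ b, (hff _ _).trans (by simp)⟩
  let o : Fin n := ⟨0, hn⟩
  let E : C → C := fun u => ∑ i, φ (Matrix.single i o 1) * u * φ (Matrix.single o i 1)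
  have hE : E t = t := by
    have : ∀ i, φ (Matrix.single i o 1) * t * φ (Matrix.single o i 1) =
        t * φ (Matrix.single i i 1) := fun i => by
      rw [← (hc _).eq, mul_assoc, ← map_mul, Matrix.single_mul_single_same, mul_one]
    simp only [E, this]
    rw [← Finset.mul_sum, ← map_sum, Matrix.sum_single_one, map_one, mul_one]
  have key : ∀ z, E (f z) ∈ T := by
    intro z
    induction z using TensorProduct.induction_on with
    | zero => simp [E]
    | add z z' h h' =>
      have : E (f (z + z')) = E (f z) + E (f z') := by
        simp only [E, map_add, mul_add, add_mul, Finset.sum_add_distrib]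
      rw [this]
      exact T.add_mem h h'
    | tmul s b =>
      have h1 : ∀ i, φ (Matrix.single i o 1) * (s * φ b) * φ (Matrix.single o i 1) =
          s * φ (b o o • Matrix.single i i 1) := fun i => by
        rw [← mul_assoc, ← (hT s s.2 _).eq, mul_assoc, mul_assoc, ← map_mul, ← map_mul,
          ← mul_assoc, Matrix.single_mul_mul_single]
        simp
      have : E (f (s ⊗ₜ b)) = b o o • (s : C) := by
        simp only [E, hff, h1]
        rw [← Finset.mul_sum, ← map_sum, ← Finset.smul_sum, Matrix.sum_single_one, map_smul,
          map_one, mul_smul_comm, mul_one]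
      rw [this]
      exact T.smul_mem s.2 _
  obtain ⟨z, rfl⟩ := hf ht
  have := key z
  rwa [show E (f z) = f z from hE] at this

end Kronecker

/-! ### Quantum spin systems -/

section SpinSystem

/-- A quantum spin system on `X`: a locally finite function `q : X → {1, 2, 3, …}`, i.e. only
finitely many sites `x` of every bounded subset of `X` have `q x > 1`. -/
structure SpinSystem (X : Type*) [MetricSpace X] where
  /-- The function `q`. -/
  dim : X → ℕ
  dim_pos : ∀ x, 0 < dim x
  locallyFinite : ∀ B : Set X, Bornology.IsBounded B → ({x | 1 < dim x} ∩ B).Finite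

variable {X : Type*} [MetricSpace X]

namespace SpinSystem

/-- Spin systems are ordered by sitewise divisibility. -/
instance : Preorder (SpinSystem X) where
  le q r := ∀ x, q.dim x ∣ r.dim x
  le_refl _ _ := dvd_rfl
  le_trans _ _ _ h h' x := (h x).trans (h' x)

/-- The trivial spin system. -/
instance : Nonempty (SpinSystem X) :=
  ⟨⟨fun _ => 1, fun _ => one_pos, fun B _ => by simp⟩⟩

instance : IsDirectedOrder (SpinSystem X) where
  directed q r :=
    ⟨⟨fun x => Nat.lcm (q.dim x) (r.dim x), fun x => Nat.lcm_pos (q.dim_pos x) (r.dim_pos x),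
      fun B hB => by
        refine ((q.locallyFinite B hB).union (r.locallyFinite B hB)).subset ?_
        rintro x ⟨hx, hxB⟩
        by_contra hn
        have h1 := q.dim_pos x
        have h2 := r.dim_pos x
        have hq : q.dim x = 1 := by
          by_contra hc
          exact hn (Or.inl ⟨by change 1 < q.dim x; omega, hxB⟩)
        have hr : r.dim x = 1 := by
          by_contra hc
          exact hn (Or.inr ⟨by change 1 < r.dim x; omega, hxB⟩)
        simp [hq, hr] at hx⟩,
      fun x => Nat.dvd_lcm_left _ _, fun x => Nat.dvd_lcm_right _ _⟩

theorem mul_div {q r : SpinSystem X} (h : q ≤ r) (x : X) :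
    q.dim x * (r.dim x / q.dim x) = r.dim x := Nat.mul_div_cancel' (h x)

theorem div_mul_div {q r s : SpinSystem X} (h : q ≤ r) (h' : r ≤ s) (x : X) :
    (r.dim x / q.dim x) * (s.dim x / r.dim x) = s.dim x / q.dim x := by
  apply Nat.eq_of_mul_eq_mul_left (q.dim_pos x)
  rw [← mul_assoc, mul_div h, mul_div h', mul_div (h.trans h')]

end SpinSystem

variable (R : Type*) [CommRing R] [DecidableEq X]

/-- The algebra of local observables `A(X, q) = ⨂_{x ∈ X} Mat(R^{q x})`. -/
abbrev Obs (q : SpinSystem X) : Type _ := LocalTensor R fun x => Mat R (q.dim x)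

variable {R}

/-- The observable `a` at the site `x`. -/
abbrev Obs.site (q : SpinSystem X) (x : X) : Mat R (q.dim x) →ₐ[R] Obs R q :=
  LocalTensor.site R (fun x => Mat R (q.dim x)) x

variable (R)

/-- The subalgebra `A(Z, q)` of observables supported on `Z ⊆ X`. -/
abbrev Obs.on (q : SpinSystem X) (Z : Set X) : Subalgebra R (Obs R q) :=
  LocalTensor.supported R (fun x => Mat R (q.dim x)) Z

variable {R} {q : SpinSystem X}

theorem Obs.site_mem_on {Z : Set X} {x : X} (hx : x ∈ Z) (a : Mat R (q.dim x)) :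
    Obs.site q x a ∈ Obs.on R q Z :=
  LocalTensor.site_mem_supported (A := fun x => Mat R (q.dim x)) hx a

theorem Obs.on_le_iff {Z : Set X} {S : Subalgebra R (Obs R q)} :
    Obs.on R q Z ≤ S ↔ ∀ x ∈ Z, ∀ a, Obs.site q x a ∈ S :=
  LocalTensor.supported_le_iff (A := fun x => Mat R (q.dim x))

theorem Obs.on_mono {Z W : Set X} (h : Z ⊆ W) : Obs.on R q Z ≤ Obs.on R q W :=
  LocalTensor.supported_mono (A := fun x => Mat R (q.dim x)) h

theorem Obs.site_commute {x y : X} (h : x ≠ y) (a : Mat R (q.dim x)) (b : Mat R (q.dim y)) :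
    Commute (Obs.site q x a) (Obs.site q y b) :=
  LocalTensor.site_commute R (fun x => Mat R (q.dim x)) h a b

/-- An automorphism has spread at most `l` if it maps observables at any site `x` to observables
supported on the closed ball of radius `l` around `x`. -/
def HasSpread (α : Obs R q ≃ₐ[R] Obs R q) (l : ℝ) : Prop :=
  ∀ (x : X) (a : Mat R (q.dim x)), α (Obs.site q x a) ∈ Obs.on R q (Metric.closedBall x l)

/-- Finite spread. -/
def IsLocalityPreserving (α : Obs R q ≃ₐ[R] Obs R q) : Prop :=
  ∃ l : ℝ, 0 < l ∧ HasSpread α l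

/-- An observable commuting with all observables at `y` is supported away from `y`. -/
theorem Obs.erase {Z : Set X} {y : X} {t : Obs R q} (ht : t ∈ Obs.on R q Z)
    (hc : ∀ b, Commute t (Obs.site q y b)) : t ∈ Obs.on R q (Z \ {y}) := by
  refine mem_of_commute_matrix (Obs.on R q (Z \ {y})) (q.dim_pos y) (Obs.site q y) ?_ ?_ hc
  · intro s hs b
    have : Obs.on R q (Z \ {y}) ≤ Subalgebra.centralizer R {Obs.site q y b} :=
      Obs.on_le_iff.2 fun x hx a => by
        rw [Subalgebra.mem_centralizer_iff]
        rintro _ rfl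
        exact Obs.site_commute (fun e => hx.2 e.symm) _ _
    exact ((Subalgebra.mem_centralizer_iff R).1 (this hs) _ rfl).symm
  · refine Obs.on_le_iff.2 (fun x hx a => ?_) ht
    by_cases h : x = y
    · subst h
      exact (le_sup_right : (Obs.site q x).range ≤ _) ⟨a, rfl⟩
    · exact (le_sup_left : Obs.on R q (Z \ {y}) ≤ _) 
        (Obs.site_mem_on (Z := Z \ {y}) ⟨hx, h⟩ a)

/-- An observable commuting with all observables at the sites of `W` is supported on `Wᶜ`. -/
theorem Obs.mem_on_compl {W : Set X} {t : Obs R q}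
    (hc : ∀ y ∈ W, ∀ b, Commute t (Obs.site q y b)) : t ∈ Obs.on R q Wᶜ := by
  classical
  obtain ⟨Γ, b, rfl⟩ := LocalTensor.exists_of R _ t
  set t := LocalTensor.of R (fun x => Mat R (q.dim x)) Γ b
  have h0 : t ∈ Obs.on R q (Γ : Set X) :=
    LocalTensor.of_mem (fun x hx a => Obs.site_mem_on (Z := (Γ : Set X)) hx a) b
  have h1 : ∀ F : Finset X, (∀ y ∈ F, y ∈ W) → t ∈ Obs.on R q ((Γ : Set X) \ F) := by
    intro F
    induction F using Finset.induction_on with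
    | empty => intro _; simpa using h0
    | insert y F hy ih =>
      intro hF
      have := Obs.erase (ih fun z hz => hF z (Finset.mem_insert_of_mem hz))
        (hc y (hF y (Finset.mem_insert_self y F)))
      refine Obs.on_mono ?_ this
      intro z hz
      simp only [Set.mem_sdiff, Set.mem_singleton_iff, Finset.coe_insert, Set.mem_insert_iff,
        Finset.mem_coe] at hz ⊢
      tauto
  refine Obs.on_mono ?_ (h1 (Γ.filter (· ∈ W)) (by simp))
  intro z hz
  simp only [Set.mem_sdiff, Finset.mem_coe, Finset.mem_filter, Set.mem_compl_iff] at hz ⊢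
  tauto

theorem HasSpread.one : HasSpread (1 : Obs R q ≃ₐ[R] Obs R q) 1 := fun x a => by
  rw [AlgEquiv.one_apply]
  exact Obs.site_mem_on (Metric.mem_closedBall_self zero_le_one) a

theorem HasSpread.mono {α : Obs R q ≃ₐ[R] Obs R q} {l l' : ℝ} (h : HasSpread α l) (hl : l ≤ l') :
    HasSpread α l' :=
  fun x a => Obs.on_mono (Metric.closedBall_subset_closedBall hl) (h x a)

theorem HasSpread.mul {α β : Obs R q ≃ₐ[R] Obs R q} {l l' : ℝ} (hα : HasSpread α l)
    (hβ : HasSpread β l') : HasSpread (α * β) (l + l') := by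
  intro x a
  have : Obs.on R q (Metric.closedBall x l') ≤
      (Obs.on R q (Metric.closedBall x (l + l'))).comap (α : Obs R q →ₐ[R] Obs R q) :=
    Obs.on_le_iff.2 fun y hy b =>
      Obs.on_mono (Metric.closedBall_subset_closedBall' (by
        have := Metric.mem_closedBall.1 hy
        linarith)) (hα y b)
  exact this (hβ x a)

theorem HasSpread.inv {α : Obs R q ≃ₐ[R] Obs R q} {l : ℝ} (hα : HasSpread α l) :
    HasSpread α⁻¹ l := by
  intro x a
  rw [← compl_compl (Metric.closedBall x l)]
  refine Obs.mem_on_compl fun y hy b => ?_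
  have hxy : x ∉ Metric.closedBall y l := by
    simpa [dist_comm] using hy
  have h : Obs.on R q (Metric.closedBall y l) ≤ Subalgebra.centralizer R {Obs.site q x a} :=
    Obs.on_le_iff.2 fun z hz c => by
      rw [Subalgebra.mem_centralizer_iff]
      rintro _ rfl
      exact Obs.site_commute (fun e => hxy (by rw [e]; exact hz)) _ _
  have h' : Commute (Obs.site q x a) (α (Obs.site q y b)) :=
    (Subalgebra.mem_centralizer_iff R).1 (h (hα y b)) _ rfl
  have := h'.map (α⁻¹ : Obs R q ≃ₐ[R] Obs R q)
  simpa using this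

variable (R q) in
/-- The group `Q(X, q)` of quantum cellular automata on the spin system `q`: the locality-preserving
automorphisms of `A(X, q)`, under composition. -/
def QCAGroup : Subgroup (Obs R q ≃ₐ[R] Obs R q) where
  carrier := {α | IsLocalityPreserving α}
  one_mem' := ⟨1, one_pos, HasSpread.one⟩
  mul_mem' := by
    rintro α β ⟨l, hl, hα⟩ ⟨l', hl', hβ⟩
    exact ⟨l + l', add_pos hl hl', hα.mul hβ⟩
  inv_mem' := by
    rintro α ⟨l, hl, hα⟩
    exact ⟨l, hl, hα.inv⟩

/-! ### Stabilization -/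

section Stabilization

variable {r : SpinSystem X}

variable (R) in
/-- The observables of the complementary factor `r / q`. -/
abbrev Obs.Quot (q r : SpinSystem X) : Type _ :=
  LocalTensor R fun x => Mat R (r.dim x / q.dim x)

variable (R) in
/-- The sitewise Kronecker isomorphism `A(X, q) ⊗ A(X, r / q) ≃ A(X, r)` for `q ∣ r`. -/
def kronObs (h : q ≤ r) : Obs R q ⊗[R] Obs.Quot R q r ≃ₐ[R] Obs R r :=
  LocalTensor.tensorCongr (A := fun x => Mat R (q.dim x))
    (B := fun x => Mat R (r.dim x / q.dim x)) (D := fun x => Mat R (r.dim x))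
    fun x => kron R (SpinSystem.mul_div h x)

/-- `a ↦ a ⊗ 1`. -/
def embL (h : q ≤ r) : Obs R q →ₐ[R] Obs R r :=
  LocalTensor.map (A := fun x => Mat R (q.dim x)) (B := fun x => Mat R (r.dim x))
    fun x => kronL R (SpinSystem.mul_div h x)

/-- `b ↦ 1 ⊗ b`. -/
def embR (h : q ≤ r) : Obs.Quot R q r →ₐ[R] Obs R r :=
  LocalTensor.map (A := fun x => Mat R (r.dim x / q.dim x)) (B := fun x => Mat R (r.dim x))
    fun x => kronR R (SpinSystem.mul_div h x)

theorem embL_site (h : q ≤ r) (x : X) (a : Mat R (q.dim x)) :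
    embL h (Obs.site q x a) = Obs.site r x (kronL R (SpinSystem.mul_div h x) a) :=
  LocalTensor.map_site (A := fun x => Mat R (q.dim x)) (B := fun x => Mat R (r.dim x))
    (fun x => kronL R (SpinSystem.mul_div h x)) x a

theorem embR_site (h : q ≤ r) (x : X) (b : Mat R (r.dim x / q.dim x)) :
    embR h (LocalTensor.site R (fun x => Mat R (r.dim x / q.dim x)) x b) =
      Obs.site r x (kronR R (SpinSystem.mul_div h x) b) :=
  LocalTensor.map_site (A := fun x => Mat R (r.dim x / q.dim x)) (B := fun x => Mat R (r.dim x))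
    (fun x => kronR R (SpinSystem.mul_div h x)) x b

theorem kronObs_tmul (h : q ≤ r) (a : Obs R q) (b : Obs.Quot R q r) :
    kronObs R h (a ⊗ₜ b) = embL h a * embR h b :=
  LocalTensor.tensorCongr_tmul (A := fun x => Mat R (q.dim x))
    (B := fun x => Mat R (r.dim x / q.dim x)) (D := fun x => Mat R (r.dim x))
    (fun x => kron R (SpinSystem.mul_div h x)) a b

variable (R) in
/-- Stabilization of an automorphism: `α ↦ α ⊗ id`, conjugated by the Kronecker isomorphism. -/
def stabAut (h : q ≤ r) : (Obs R q ≃ₐ[R] Obs R q) →* (Obs R r ≃ₐ[R] Obs R r) :=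
  tensorAut (kronObs R h)

theorem stabAut_mul (h : q ≤ r) (α : Obs R q ≃ₐ[R] Obs R q) (a : Obs R q)
    (b : Obs.Quot R q r) :
    stabAut R h α (embL h a * embR h b) = embL h (α a) * embR h b := by
  rw [← kronObs_tmul, ← kronObs_tmul]
  exact tensorAut_tmul (kronObs R h) α a b

theorem stabAut_left (h : q ≤ r) (α : Obs R q ≃ₐ[R] Obs R q) (a : Obs R q) :
    stabAut R h α (embL h a) = embL h (α a) := by
  have := stabAut_mul h α a 1
  rwa [map_one, mul_one, mul_one] at this

theorem stabAut_right (h : q ≤ r) (α : Obs R q ≃ₐ[R] Obs R q) (b : Obs.Quot R q r) :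
    stabAut R h α (embR h b) = embR h b := by
  have := stabAut_mul h α 1 b
  rwa [map_one, map_one, map_one, one_mul] at this

theorem stab_ext (h : q ≤ r) {α β : Obs R r ≃ₐ[R] Obs R r}
    (hL : ∀ x a, α (embL h (Obs.site q x a)) = β (embL h (Obs.site q x a)))
    (hR : ∀ x (b : Mat R (r.dim x / q.dim x)),
      α (Obs.site r x (kronR R (SpinSystem.mul_div h x) b)) =
        β (Obs.site r x (kronR R (SpinSystem.mul_div h x) b))) : α = β := by
  have h1 : ∀ x c, α (Obs.site r x c) = β (Obs.site r x c) := by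
    intro x c
    obtain ⟨u, rfl⟩ := (kron R (SpinSystem.mul_div h x)).surjective c
    induction u using TensorProduct.induction_on with
    | zero => simp only [map_zero]
    | add u v hu hv => simp only [map_add, hu, hv]
    | tmul a b =>
      rw [kron_tmul_eq, map_mul, map_mul, map_mul, hR, ← embL_site h x a, hL]
  have h2 : α.toAlgHom = β.toAlgHom :=
    LocalTensor.algHom_ext (A := fun x => Mat R (r.dim x)) h1
  exact AlgEquiv.ext fun t => DFunLike.congr_fun h2 t

theorem stabAut_refl (α : Obs R q ≃ₐ[R] Obs R q) : stabAut R (le_refl q) α = α := by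
  have hid : ∀ a : Obs R q, embL (le_refl q) a = a := by
    have : embL (le_refl q) = AlgHom.id R (Obs R q) :=
      LocalTensor.algHom_ext (A := fun x => Mat R (q.dim x)) fun x a => by
        refine (embL_site (le_refl q) x a).trans ?_
        rw [kronL_self _ (q.dim_pos x)]
        rfl
    exact fun a => DFunLike.congr_fun this a
  refine stab_ext (le_refl q) (fun x a => ?_) (fun x b => ?_)
  · rw [stabAut_left, hid, hid]
  · obtain ⟨c, rfl⟩ := kronR_self (SpinSystem.mul_div (le_refl q) x) (q.dim_pos x) b
    simp only [AlgHom.commutes, AlgEquiv.commutes]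

theorem stabAut_stabAut {s : SpinSystem X} (h : q ≤ r) (h' : r ≤ s)
    (α : Obs R q ≃ₐ[R] Obs R q) :
    stabAut R h' (stabAut R h α) = stabAut R (h.trans h') α := by
  have hLL : ∀ a : Obs R q, embL (h.trans h') a = embL h' (embL h a) := by
    have : embL (h.trans h') = (embL h').comp (embL (R := R) h) :=
      LocalTensor.algHom_ext (A := fun x => Mat R (q.dim x)) fun x a => by
        refine (embL_site (h.trans h') x a).trans ?_
        rw [AlgHom.comp_apply]
        refine Eq.trans ?_ (congrArg (embL h') (embL_site h x a)).symm
        rw [embL_site, kronL_kronL _ _ (SpinSystem.mul_div (h.trans h') x)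
          (SpinSystem.div_mul_div h h' x)]
    exact fun a => DFunLike.congr_fun this a
  refine stab_ext (h.trans h') (fun x a => ?_) (fun x b => ?_)
  · rw [stabAut_left, hLL, hLL, stabAut_left, stabAut_left]
  · obtain ⟨u, rfl⟩ := (kron R (SpinSystem.div_mul_div h h' x)).surjective b
    induction u using TensorProduct.induction_on with
    | zero => simp only [map_zero]
    | add u v hu hv => simp only [map_add, hu, hv]
    | tmul b c =>
      rw [← embR_site (h.trans h'), stabAut_right, embR_site]
      rw [kron_tmul_eq, map_mul, map_mul, map_mul,
        kronR_kronL (SpinSystem.mul_div h x) (SpinSystem.mul_div h' x),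
        kronR_kronR (SpinSystem.mul_div h x) (SpinSystem.mul_div h' x),
        ← embL_site, ← embR_site h, ← embR_site h', stabAut_left, stabAut_right, stabAut_right]

theorem HasSpread.stabAut (h : q ≤ r) {α : Obs R q ≃ₐ[R] Obs R q} {l : ℝ} (hl : 0 ≤ l)
    (hα : HasSpread α l) : HasSpread (stabAut R h α) l := by
  have hE : ∀ Z : Set X, Obs.on R q Z ≤ (Obs.on R r Z).comap (embL h) := fun Z =>
    Obs.on_le_iff.2 fun x hx a => by
      rw [Subalgebra.mem_comap, embL_site]
      exact Obs.site_mem_on hx _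
  intro x c
  obtain ⟨u, rfl⟩ := (kron R (SpinSystem.mul_div h x)).surjective c
  induction u using TensorProduct.induction_on with
  | zero => simp only [map_zero]; exact zero_mem _
  | add u v hu hv => simp only [map_add]; exact add_mem hu hv
  | tmul a b =>
    rw [kron_tmul_eq, map_mul, ← embL_site h, ← embR_site h, stabAut_mul, embR_site]
    exact mul_mem (hE _ (hα x a)) (Obs.site_mem_on (Metric.mem_closedBall_self hl) _)

variable (R) in
/-- Stabilization `Q(X, q) → Q(X, r)` for `q ∣ r`. -/
def stab (h : q ≤ r) : QCAGroup R q →* QCAGroup R r :=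
  ((stabAut R h).comp (QCAGroup R q).subtype).codRestrict (QCAGroup R r) fun α => by
    obtain ⟨l, hl, hα⟩ := α.2
    exact ⟨l, hl, hα.stabAut h hl.le⟩

end Stabilization

end SpinSystem

/-! ### The total QCA group and circuits -/

section Total

variable (R : Type*) [CommRing R] {X : Type*} [MetricSpace X] [DecidableEq X]

instance : DirectedSystem (fun q : SpinSystem X => QCAGroup R q) (fun _ _ h => stab R h) where
  map_self _ α := Subtype.ext (stabAut_refl α.1)
  map_map _ _ _ h h' α := Subtype.ext (stabAut_stabAut h h' α.1)

variable (X) in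
/-- The total QCA group `Q(X)`: the direct limit of the groups `Q(X, q)` along stabilization. -/
def TotalQCA : Type _ :=
  DirectLimit (fun q : SpinSystem X => QCAGroup R q) (fun _ _ h => stab R h)

instance : Group (TotalQCA R X) :=
  inferInstanceAs
    (Group (DirectLimit (fun q : SpinSystem X => QCAGroup R q) (fun _ _ h => stab R h)))

/-- The class `[q, α]` in `Q(X)` of a QCA `α` on `q`. -/
def TotalQCA.of (q : SpinSystem X) : QCAGroup R q →* TotalQCA R X where
  toFun α := (⟦⟨q, α⟩⟧ :
    DirectLimit (fun q : SpinSystem X => QCAGroup R q) (fun _ _ h => stab R h))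
  map_one' := (DirectLimit.one_def q).symm
  map_mul' α β := (DirectLimit.mul_def (G := fun q : SpinSystem X => QCAGroup R q)
    (f := fun _ _ h => stab R h) q α β).symm

variable {R}

/-- `α` is a single-layer circuit `⨂_j α_j` on the spin system `q`: there are a partition of `X`
into blocks of uniformly bounded diameter and, for each block `Y`, an `R`-algebra automorphism of
`A(Y, q)`, such that `α` restricts to the given automorphism of `A(Y, q)` for every block `Y`. -/
def IsSingleLayer {q : SpinSystem X} (α : Obs R q ≃ₐ[R] Obs R q) : Prop :=
  ∃ P : Set (Set X), Setoid.IsPartition P ∧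
    (∃ L : ℝ, ∀ Y ∈ P, ∀ x ∈ Y, ∀ y ∈ Y, dist x y ≤ L) ∧
    ∃ β : ∀ Y : P, Obs.on R q (Y : Set X) ≃ₐ[R] Obs.on R q (Y : Set X),
      ∀ (Y : P) (a : Obs.on R q (Y : Set X)), α a = β Y a

variable (R) in
/-- The circuit subgroup `C(X, q)` of `Q(X, q)`, generated by the single-layer circuits. -/
def circuitsOn (q : SpinSystem X) : Subgroup (QCAGroup R q) :=
  Subgroup.closure {α | IsSingleLayer (α : Obs R q ≃ₐ[R] Obs R q)}

variable (R X) in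
/-- The circuit subgroup `C(X)` of `Q(X)`: the direct limit (union) of the `C(X, q)`. -/
def circuits : Subgroup (TotalQCA R X) :=
  ⨆ q : SpinSystem X, (circuitsOn R q).map (TotalQCA.of R q)

end Total

/-! ### The Grothendieck group of Azumaya algebras -/

section Azumaya

universe u

variable (R : Type u) [CommRing R]

/-- `A` is an Azumaya algebra over `R`: `A ⊗ B ≃ Mat(R^n)` for some `R`-algebra `B` and some
`n ≥ 1`. -/
def IsAzumayaAlgebra (A : Type u) [Ring A] [Algebra R A] : Prop :=
  ∃ (B : Type u) (_ : Ring B) (_ : Algebra R B) (n : ℕ),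
    0 < n ∧ Nonempty (A ⊗[R] B ≃ₐ[R] Mat R n)

/-- Azumaya algebras over `R`. -/
structure AzumayaAlgebra where
  carrier : Type u
  [ring : Ring carrier]
  [algebra : Algebra R carrier]
  isAzumaya : IsAzumayaAlgebra R carrier

attribute [instance] AzumayaAlgebra.ring AzumayaAlgebra.algebra

/-- Isomorphism of Azumaya algebras. -/
instance AzumayaAlgebra.setoid : Setoid (AzumayaAlgebra R) where
  r A B := Nonempty (A.carrier ≃ₐ[R] B.carrier)
  iseqv := ⟨fun _ => ⟨AlgEquiv.refl⟩, fun ⟨e⟩ => ⟨e.symm⟩, fun ⟨e⟩ ⟨f⟩ => ⟨e.trans f⟩⟩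

/-- Isomorphism classes of Azumaya algebras. -/
def AzumayaClass : Type (u + 1) := Quotient (AzumayaAlgebra.setoid R)

variable {R}

theorem IsAzumayaAlgebra.base : IsAzumayaAlgebra R R :=
  ⟨Mat R 1, inferInstance, inferInstance, 1, one_pos, ⟨Algebra.TensorProduct.lid R (Mat R 1)⟩⟩

theorem IsAzumayaAlgebra.tensor {A B : Type u} [Ring A] [Algebra R A] [Ring B] [Algebra R B]
    (hA : IsAzumayaAlgebra R A) (hB : IsAzumayaAlgebra R B) : IsAzumayaAlgebra R (A ⊗[R] B) := by
  obtain ⟨A', _, _, n, hn, ⟨e⟩⟩ := hA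
  obtain ⟨B', _, _, m, hm, ⟨f⟩⟩ := hB
  exact ⟨A' ⊗[R] B', inferInstance, inferInstance, n * m, Nat.mul_pos hn hm,
    ⟨(Algebra.TensorProduct.tensorTensorTensorComm R R R R A B A' B').trans
      ((Algebra.TensorProduct.congr e f).trans (kron R rfl))⟩⟩

/-- Isomorphism classes of Azumaya algebras form a commutative monoid under tensor product. -/
instance : CommMonoid (AzumayaClass R) where
  mul := Quotient.map₂ (fun A B => ⟨A.carrier ⊗[R] B.carrier, A.isAzumaya.tensor B.isAzumaya⟩)
    fun _ _ ⟨e⟩ _ _ ⟨f⟩ => ⟨Algebra.TensorProduct.congr e f⟩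
  one := ⟦⟨R, IsAzumayaAlgebra.base⟩⟧
  mul_assoc := by
    rintro ⟨A⟩ ⟨B⟩ ⟨C⟩
    exact Quotient.sound ⟨Algebra.TensorProduct.assoc R R R A.carrier B.carrier C.carrier⟩
  one_mul := by
    rintro ⟨A⟩
    exact Quotient.sound ⟨Algebra.TensorProduct.lid R A.carrier⟩
  mul_one := by
    rintro ⟨A⟩
    exact Quotient.sound ⟨Algebra.TensorProduct.rid R R A.carrier⟩
  mul_comm := by
    rintro ⟨A⟩ ⟨B⟩
    exact Quotient.sound ⟨Algebra.TensorProduct.comm R A.carrier B.carrier⟩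

variable (R) in
/-- `K₀(Az(R))`, the Grothendieck group (written multiplicatively) of the commutative monoid of
isomorphism classes of Azumaya `R`-algebras under tensor product. -/
abbrev K0Az : Type (u + 1) := Algebra.GrothendieckGroup (AzumayaClass R)

/-- The class in `K₀(Az(R))` of an Azumaya algebra. -/
def K0Az.mk (A : Type u) [Ring A] [Algebra R A] (hA : IsAzumayaAlgebra R A) : K0Az R :=
  Algebra.GrothendieckGroup.of (⟦⟨A, hA⟩⟧ : Quotient (AzumayaAlgebra.setoid R))

end Azumaya

/-! ### The boundary algebra -/

section Boundary

variable {R : Type*} [CommRing R]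

/-- `N = M ⊗ B` inside an `R`-algebra `A`: the elements of `M` and `B` commute, the multiplication
map `M ⊗ B → A` is injective, and its image is `N`. -/
def IsInternalTensor {A : Type*} [Ring A] [Algebra R A] (M B N : Subalgebra R A) : Prop :=
  ∃ hc : ∀ (m : M) (b : B), Commute (m : A) (b : A),
    Function.Injective (Algebra.TensorProduct.lift M.val B.val hc) ∧
      (Algebra.TensorProduct.lift M.val B.val hc).range = N

/-- The algebra `B = α(A(≤ γ)) ∩ A((γ - l, γ + l])`, for which
`α(A(≤ γ)) = A(≤ γ - l) ⊗ B` if `α` has spread at most `l`. -/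
def boundaryAlgebra {q : SpinSystem ℤ} (α : Obs R q ≃ₐ[R] Obs R q) (l : ℕ) (γ : ℤ) :
    Subalgebra R (Obs R q) :=
  (Obs.on R q (Set.Iic γ)).map α.toAlgHom ⊓ Obs.on R q (Set.Ioc (γ - l) (γ + l))

end Boundary

end

end QCA

/-! Let `α` have spread at most `l` and put `D = (γ - l, γ + l]`. Then `α(A(≤ γ))` contains `A(≤ γ -
l)` and is contained in `A(≤ γ - l) ⊗ A(D)`. Over an arbitrary ring `R` no dimension count is
available. What replaces it is that finitely many local observables always lie in one matrix
algebra, whose matrix units extract tensor coefficients (`coeff_sum`). Hence the sandwiched algebra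
splits as `A(≤ γ - l) ⊗ B` (`IsLocallyMatrix.eq_sup_inf`). The same cut seen from the right gives
`B'`, and `B ⊗ B' = A(D)` is a matrix algebra, so `B` is Azumaya (`IsCut.isInternalTensor_bd`).

A half-infinite algebra `N = A(≤ a) ⊗ B` gets the renormalized class `weight a * [B]`, which depends
on `N` only (`HalfClass.unique`). The index of `α` is the ratio of the classes of `α(A(≤ γ))` and
`A(≤ γ)`. It is independent of `γ`, multiplicative because the image of `A(≤ a) ⊗ B` under another
automorphism is again a product (`index_mul`), and stable because stabilization adds the same factor
to numerator and denominator (`index_stab`).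

A single layer preserves `A(W)` for a set `W` that differs from a half-line by finitely many sites,
so its index is trivial (`index_eq_one`). Conversely, if the index is trivial, the boundary algebras
on both sides of every cut are stably isomorphic to algebras of half-intervals, and one
stabilization makes all of these honest isomorphisms (`exists_stab_equiv`). A layer `β` on blocks
centred at the cuts `2lk` then carries half-intervals to boundary algebras, and `α⁻¹β` preserves the
blocks between consecutive cuts. So `α` is a product of two layers (`exists_single_layers`).

For surjectivity, write `Mat(R^n) = A ⊗ A'` at every site and translate only the factor `A` by one
site; exactly one copy of `A` crosses the cut (`exists_boundaryHom_eq`). -/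

namespace QCA

noncomputable section

/-! ### Tensor factorizations with a locally matrix factor -/

section LocallyMatrix

variable {R : Type*} [CommRing R] {C : Type*} [Ring C] [Algebra R C]
  {D : Type*} [Ring D] [Algebra R D]

/-- Two subalgebras commute elementwise. -/
def Commuting (M K : Subalgebra R C) : Prop := ∀ m ∈ M, ∀ k ∈ K, Commute m k

namespace Commuting

variable {M K L : Subalgebra R C}

theorem symm (h : Commuting M K) : Commuting K M := fun k hk m hm => (h m hm k hk).symm

theorem mono {M' K' : Subalgebra R C} (h : Commuting M K) (hM : M' ≤ M) (hK : K' ≤ K) :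
    Commuting M' K' := fun m hm k hk => h m (hM hm) k (hK hk)

theorem iff_le_centralizer : Commuting M K ↔ K ≤ Subalgebra.centralizer R (M : Set C) :=
  ⟨fun h k hk => (Subalgebra.mem_centralizer_iff R).2 fun m hm => (h m hm k hk).eq,
    fun h m hm _ hk => (Subalgebra.mem_centralizer_iff R).1 (h hk) m hm⟩

theorem map (h : Commuting M K) (f : C →ₐ[R] D) : Commuting (M.map f) (K.map f) := by
  rintro _ ⟨m, hm, rfl⟩ _ ⟨k, hk, rfl⟩
  exact (h m hm k hk).map f

end Commuting

/-- The multiplication map `M ⊗ K → C` of two commuting subalgebras. -/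
def mulMap {M K : Subalgebra R C} (h : Commuting M K) : M ⊗[R] K →ₐ[R] C :=
  Algebra.TensorProduct.lift M.val K.val fun m k => h m m.2 k k.2

theorem mulMap_tmul {M K : Subalgebra R C} (h : Commuting M K) (m : M) (k : K) :
    mulMap h (m ⊗ₜ k) = m * k := Algebra.TensorProduct.lift_tmul ..

theorem range_mulMap {M K : Subalgebra R C} (h : Commuting M K) : (mulMap h).range = M ⊔ K := by
  refine le_antisymm ?_ (sup_le (fun m hm => ⟨⟨m, hm⟩ ⊗ₜ 1, ?_⟩) (fun k hk => ⟨1 ⊗ₜ ⟨k, hk⟩, ?_⟩))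
  · rintro _ ⟨z, rfl⟩
    change mulMap h z ∈ _
    induction z using TensorProduct.induction_on with
    | zero => rw [map_zero]; exact zero_mem _
    | add z z' hz hz' => rw [map_add]; exact add_mem hz hz'
    | tmul m k =>
      rw [mulMap_tmul]
      exact mul_mem ((le_sup_left : M ≤ M ⊔ K) m.2) ((le_sup_right : K ≤ M ⊔ K) k.2)
  · exact (mulMap_tmul h _ _).trans (by simp)
  · exact (mulMap_tmul h _ _).trans (by simp)

theorem isInternalTensor_of_injective {M K : Subalgebra R C} (h : Commuting M K)
    (hi : Function.Injective (mulMap h)) : IsInternalTensor M K (M ⊔ K) :=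
  ⟨fun m k => h m m.2 k k.2, hi, range_mulMap h⟩

namespace IsInternalTensor

variable {M K N : Subalgebra R C}

theorem commuting (h : IsInternalTensor M K N) : Commuting M K :=
  fun m hm k hk => h.1 ⟨m, hm⟩ ⟨k, hk⟩

theorem injective (h : IsInternalTensor M K N) : Function.Injective (mulMap h.commuting) := h.2.1

theorem sup_eq (h : IsInternalTensor M K N) : M ⊔ K = N :=
  (range_mulMap h.commuting).symm.trans h.2.2

/-- The isomorphism `M ⊗ K ≃ N` of an internal tensor product. -/
def equiv (h : IsInternalTensor M K N) : M ⊗[R] K ≃ₐ[R] N :=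
  (AlgEquiv.ofInjective (mulMap h.commuting) h.injective).trans
    (Subalgebra.equivOfEq _ _ ((range_mulMap h.commuting).trans h.sup_eq))

theorem equiv_tmul (h : IsInternalTensor M K N) (m : M) (k : K) :
    (h.equiv (m ⊗ₜ k) : C) = m * k := mulMap_tmul h.commuting m k

theorem symm (h : IsInternalTensor M K N) : IsInternalTensor K M N := by
  rw [← h.sup_eq, sup_comm]
  refine isInternalTensor_of_injective h.commuting.symm ?_
  have : mulMap h.commuting.symm =
      (mulMap h.commuting).comp (Algebra.TensorProduct.comm R K M).toAlgHom := by
    refine Algebra.TensorProduct.ext' fun k m => ?_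
    refine (mulMap_tmul _ _ _).trans (((h.commuting m m.2 k k.2).eq.symm).trans
      (mulMap_tmul h.commuting m k).symm)
  rw [this]
  exact h.injective.comp (Algebra.TensorProduct.comm R K M).injective

end IsInternalTensor

/-- Every finite subset of `M` is contained in the image of a matrix algebra in `M`. -/
def IsLocallyMatrix (M : Subalgebra R C) : Prop :=
  ∀ s : Finset C, (s : Set C) ⊆ M → ∃ n : ℕ, 0 < n ∧ ∃ φ : Mat R n →ₐ[R] C,
    φ.range ≤ M ∧ (s : Set C) ⊆ φ.range

theorem IsLocallyMatrix.map {M : Subalgebra R C} (hM : IsLocallyMatrix M) (f : C →ₐ[R] D) :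
    IsLocallyMatrix (M.map f) := by
  classical
  intro s hs
  have : ∀ d : s, ∃ c ∈ M, f c = d := fun d => hs d.2
  choose g hg hfg using this
  obtain ⟨n, hn, φ, h1, h2⟩ := hM (Finset.univ.image g) (by
    intro c hc
    simp only [Finset.coe_image, Set.mem_image] at hc
    obtain ⟨d, -, rfl⟩ := hc
    exact hg d)
  refine ⟨n, hn, f.comp φ, ?_, fun d hd => ?_⟩
  · rw [AlgHom.range_comp]
    exact Subalgebra.map_mono h1
  · obtain ⟨x, hx⟩ := h2 (by simp : g ⟨d, hd⟩ ∈ _)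
    exact ⟨x, (congrArg f hx).trans (hfg ⟨d, hd⟩)⟩

theorem isLocallyMatrix_range {n : ℕ} (hn : 0 < n) (φ : Mat R n →ₐ[R] C) :
    IsLocallyMatrix φ.range := fun _ hs => ⟨n, hn, φ, le_rfl, hs⟩

/-- The `(a, b)` coefficient of `t` with respect to matrix units in the image of `φ`. -/
def coeff {n : ℕ} (φ : Mat R n →ₐ[R] C) (a b : Fin n) (t : C) : C :=
  ∑ c, φ (Matrix.single c a 1) * t * φ (Matrix.single b c 1)

/-- With matrix units `e`, the product `e_ca e_ij k_ij e_bc` vanishes unless `(i, j) = (a, b)`,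
where it equals `e_cc k_ab`. Summing over `c` replaces `e_cc` by `1`. -/
theorem coeff_sum {n : ℕ} (φ : Mat R n →ₐ[R] C) (k : Fin n → Fin n → C)
    (hk : ∀ x i j, Commute (φ x) (k i j)) (a b : Fin n) :
    coeff φ a b (∑ i, ∑ j, φ (Matrix.single i j 1) * k i j) = k a b := by
  have h1 : ∀ c i j, φ (Matrix.single c a 1) * (φ (Matrix.single i j 1) * k i j) *
      φ (Matrix.single b c 1) =
      if a = i then (if j = b then φ (Matrix.single c c 1) * k i j else 0) else 0 := by
    intro c i j
    rw [← mul_assoc, mul_assoc, ← (hk _ i j).eq, ← mul_assoc, ← map_mul, ← map_mul]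
    by_cases h : a = i
    · subst h
      by_cases h' : j = b
      · subst h'
        simp
      · simp [h']
    · simp [h]
  simp only [coeff, Finset.mul_sum, Finset.sum_mul, h1]
  simp only [Finset.sum_ite_eq, Finset.sum_ite_irrel, Finset.sum_const_zero, Finset.mem_univ,
    if_true, Finset.sum_ite_eq']
  rw [← Finset.sum_mul, ← map_sum, Matrix.sum_single_one, map_one, one_mul]

/-- The finitely many left legs of a tensor lie in a single matrix algebra inside `M`. Expanding
them in its matrix units gives a normal form to which `coeff` applies. -/
theorem IsLocallyMatrix.exists_coeff {M K : Subalgebra R C} (hM : IsLocallyMatrix M)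
    (z : M ⊗[R] K) : ∃ n : ℕ, 0 < n ∧ ∃ (φ : Mat R n →ₐ[R] C) (hφ : ∀ x, φ x ∈ M)
      (k : Fin n → Fin n → K),
      z = ∑ i, ∑ j, (⟨φ (Matrix.single i j 1), hφ _⟩ : M) ⊗ₜ[R] k i j := by
  classical
  obtain ⟨S, rfl⟩ := TensorProduct.exists_finset z
  obtain ⟨n, hn, φ, h1, h2⟩ := hM (S.image fun p => (p.1 : C)) (by
    intro c hc
    simp only [Finset.coe_image, Set.mem_image] at hc
    obtain ⟨p, -, rfl⟩ := hc
    exact p.1.2)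
  have hφ : ∀ x, φ x ∈ M := fun x => h1 ⟨x, rfl⟩
  -- Preimages matter only for the pairs in `S`; all others get the dummy value `0`.
  have : ∀ p : M × K, ∃ x, p ∈ S → φ x = p.1 := by
    intro p
    by_cases hp : p ∈ S
    · obtain ⟨x, hx⟩ := h2 (by
        simp only [Finset.coe_image, Set.mem_image]
        exact ⟨p, hp, rfl⟩ : (p.1 : C) ∈ _)
      exact ⟨x, fun _ => hx⟩
    · exact ⟨0, fun h => absurd h hp⟩
  choose x hx using this
  refine ⟨n, hn, φ, hφ, fun i j => ∑ p ∈ S, x p i j • p.2, ?_⟩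
  simp only [TensorProduct.tmul_sum]
  have h3 : ∀ p ∈ S, p.1 ⊗ₜ[R] p.2 =
      ∑ i, ∑ j, (⟨φ (Matrix.single i j 1), hφ _⟩ : M) ⊗ₜ[R] (x p i j • p.2) := by
    intro p hp
    have : p.1 = ∑ i, ∑ j, x p i j • (⟨φ (Matrix.single i j 1), hφ _⟩ : M) := by
      apply Subtype.ext
      rw [← hx p hp]
      conv_lhs => rw [Matrix.matrix_eq_sum_single (x p)]
      simp only [map_sum, AddSubmonoidClass.coe_finsetSum]
      refine Finset.sum_congr rfl fun i _ => Finset.sum_congr rfl fun j _ => ?_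
      rw [Subalgebra.coe_smul, ← map_smul, Matrix.smul_single, smul_eq_mul, mul_one]
    conv_lhs => rw [this]
    simp only [TensorProduct.sum_tmul, TensorProduct.smul_tmul]
  rw [Finset.sum_congr rfl h3, Finset.sum_comm]
  exact Finset.sum_congr rfl fun i _ => Finset.sum_comm

/-- The coefficients of the normal form can be read off from the product in `C`, so a tensor with
product zero has only zero coefficients. No flatness of `K` is needed. -/
theorem IsLocallyMatrix.injective_mulMap {M K : Subalgebra R C} (hM : IsLocallyMatrix M)
    (h : Commuting M K) : Function.Injective (mulMap h) := by
  rw [injective_iff_map_eq_zero]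
  intro z hz
  obtain ⟨n, hn, φ, hφ, k, rfl⟩ := hM.exists_coeff z
  simp only [map_sum, mulMap_tmul] at hz
  have hk : ∀ i j, k i j = 0 := fun i j => Subtype.ext <| by
    rw [← coeff_sum φ (fun i j => (k i j : C)) (fun x i j => h _ (hφ x) _ (k i j).2) i j, hz]
    simp [coeff]
  simp [hk]

theorem IsLocallyMatrix.isInternalTensor {M K : Subalgebra R C} (hM : IsLocallyMatrix M)
    (h : Commuting M K) : IsInternalTensor M K (M ⊔ K) :=
  isInternalTensor_of_injective h (hM.injective_mulMap h)

/-- Between `M` and `M ⊗ K`, every subalgebra is generated by `M` and a subalgebra of `K`. -/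
theorem IsLocallyMatrix.eq_sup_inf {M K N : Subalgebra R C} (hM : IsLocallyMatrix M)
    (h : Commuting M K) (hMN : M ≤ N) (hN : N ≤ M ⊔ K) : N = M ⊔ (N ⊓ K) := by
  refine le_antisymm (fun t ht => ?_) (sup_le hMN inf_le_left)
  have := hN ht
  rw [← range_mulMap h] at this
  obtain ⟨z, rfl⟩ := this
  obtain ⟨n, hn, φ, hφ, k, rfl⟩ := hM.exists_coeff z
  change mulMap h _ ∈ _ at ht
  change mulMap h _ ∈ _
  simp only [map_sum, mulMap_tmul] at ht ⊢
  -- Coefficient extraction multiplies only by elements of `M ≤ N`, so it does not leave `N`.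
  have hk : ∀ i j, (k i j : C) ∈ N := fun i j => by
    rw [← coeff_sum φ (fun i j => (k i j : C)) (fun x i j => h _ (hφ x) _ (k i j).2) i j]
    exact sum_mem fun c _ => mul_mem (mul_mem (hMN (hφ _)) ht) (hMN (hφ _))
  exact sum_mem fun i _ => sum_mem fun j _ => mul_mem ((le_sup_left : M ≤ _) (hφ _))
    ((le_sup_right : N ⊓ K ≤ _) ⟨hk i j, (k i j).2⟩)

/-- In `M ⊗ K`, the centralizer of `M` is `K`. -/
theorem IsLocallyMatrix.mem_of_commute {M K : Subalgebra R C} (hM : IsLocallyMatrix M)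
    (h : Commuting M K) {t : C} (ht : t ∈ M ⊔ K) (hc : ∀ m ∈ M, Commute m t) : t ∈ K := by
  rw [← range_mulMap h] at ht
  obtain ⟨z, rfl⟩ := ht
  obtain ⟨n, hn, φ, hφ, k, rfl⟩ := hM.exists_coeff z
  change ∀ m ∈ M, Commute m (mulMap h _) at hc
  change mulMap h _ ∈ _
  simp only [map_sum, mulMap_tmul] at hc ⊢
  let o : Fin n := ⟨0, hn⟩
  have h1 := coeff_sum φ (fun i j => (k i j : C)) (fun x i j => h _ (hφ x) _ (k i j).2) o o
  set t := ∑ i, ∑ j, φ (Matrix.single i j 1) * (k i j : C)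
  -- As `t` commutes with the matrix units, its diagonal coefficient is `t` itself, while `h1`
  -- identifies the same coefficient with `k o o ∈ K`.
  have h2 : coeff φ o o t = t := by
    have : ∀ c, φ (Matrix.single c o 1) * t * φ (Matrix.single o c 1) =
        φ (Matrix.single c c 1) * t := fun c => by
      rw [mul_assoc, ← (hc _ (hφ _)).eq, ← mul_assoc, ← map_mul, Matrix.single_mul_single_same,
        mul_one]
    simp only [coeff, this]
    rw [← Finset.sum_mul, ← map_sum, Matrix.sum_single_one, map_one, one_mul]
  rw [← h2, h1]
  exact (k o o).2

/-- A tensor factor of an algebra is a module direct summand if the other factor has a linear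
functional taking the value `1` at `1`. -/
theorem IsInternalTensor.exists_retraction {M K N : Subalgebra R C} (h : IsInternalTensor M K N)
    {f : C →ₗ[R] R} (hf : f 1 = 1) :
    ∃ p : N →ₗ[R] K, ∀ (k : C) (hk : k ∈ K) (hN : k ∈ N), p ⟨k, hN⟩ = ⟨k, hk⟩ := by
  -- The retraction applies `f` to the `M`-leg of `M ⊗ K`; it fixes `1 ⊗ k` because `f 1 = 1`.
  refine ⟨((TensorProduct.lid R K).toLinearMap.comp
    (LinearMap.rTensor K (f.comp M.val.toLinearMap))).comp h.equiv.symm.toLinearMap,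
    fun k hk hN => ?_⟩
  have : h.equiv.symm ⟨k, hN⟩ = (1 : M) ⊗ₜ ⟨k, hk⟩ := by
    rw [AlgEquiv.symm_apply_eq]
    apply Subtype.ext
    rw [h.equiv_tmul]
    simp
  change TensorProduct.lid R K (LinearMap.rTensor K (f.comp M.val.toLinearMap)
    (h.equiv.symm ⟨k, hN⟩)) = _
  rw [this]
  simp [hf]

/-- If `M ⊗ P` is a locally matrix algebra which commutes with `K`, then `P` and `K` form an
internal tensor product. -/
theorem IsInternalTensor.of_factor {M P N K : Subalgebra R C} (h : IsInternalTensor M P N)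
    {f : C →ₗ[R] R} (hf : f 1 = 1) (hN : IsLocallyMatrix N) (hc : Commuting N K) :
    IsInternalTensor P K (P ⊔ K) := by
  have hPN : P ≤ N := h.sup_eq ▸ le_sup_right
  obtain ⟨p, hp⟩ := h.exists_retraction hf
  refine isInternalTensor_of_injective (hc.mono hPN le_rfl) ?_
  have h1 : ∀ z, mulMap (hc.mono hPN le_rfl) z =
      mulMap hc (LinearMap.rTensor K (Subalgebra.inclusion hPN).toLinearMap z) := by
    intro z
    induction z using TensorProduct.induction_on with
    | zero => simp only [map_zero]
    | add z z' hz hz' => simp only [map_add, hz, hz']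
    | tmul a b =>
      rw [LinearMap.rTensor_tmul, mulMap_tmul]
      exact (mulMap_tmul hc (Subalgebra.inclusion hPN a) b).symm
  -- The inclusion `P → N` is split as a module map, so it stays injective after tensoring with `K`.
  -- This matters because `P` itself need not be locally matrix.
  have h2 : ∀ z, LinearMap.rTensor K p
      (LinearMap.rTensor K (Subalgebra.inclusion hPN).toLinearMap z) = z := by
    intro z
    rw [← LinearMap.comp_apply, ← LinearMap.rTensor_comp]
    have : p.comp (Subalgebra.inclusion hPN).toLinearMap = LinearMap.id :=
      LinearMap.ext fun k => hp k k.2 (hPN k.2)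
    rw [this, LinearMap.rTensor_id, LinearMap.id_apply]
  intro z z' hzz
  rw [h1, h1] at hzz
  rw [← h2 z, hN.injective_mulMap hc hzz, h2]

end LocallyMatrix

/-! ### Matrix subalgebras and injectivity from unital functionals -/

section MatrixAlgebra

variable {R : Type*} [CommRing R] {C : Type*} [Ring C] [Algebra R C]
  {D : Type*} [Ring D] [Algebra R D]

theorem range_comp_equiv {A B : Type*} [Ring A] [Algebra R A] [Ring B] [Algebra R B]
    (f : B →ₐ[R] C) (e : A ≃ₐ[R] B) : (f.comp e.toAlgHom).range = f.range := by
  rw [AlgHom.range_comp, (AlgHom.range_eq_top e.toAlgHom).2 e.surjective, Algebra.map_top]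

/-- Coefficient extraction shows that each entry of an element of the kernel becomes zero as a
scalar of `C`, and `f` recovers a scalar of `R` from its image in `C`. -/
theorem injective_of_functional {n : ℕ} (φ : Mat R n →ₐ[R] C) {f : C →ₗ[R] R} (hf : f 1 = 1) :
    Function.Injective φ := by
  rw [injective_iff_map_eq_zero]
  intro x hx
  ext i j
  have h := coeff_sum φ (fun i j => algebraMap R C (x i j))
    (fun y i j => (Algebra.commutes _ _).symm) i j
  have h' : ∑ i, ∑ j, φ (Matrix.single i j 1) * algebraMap R C (x i j) = 0 := by
    rw [← hx]
    conv_rhs => rw [Matrix.matrix_eq_sum_single x]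
    simp only [map_sum]
    refine Finset.sum_congr rfl fun i _ => Finset.sum_congr rfl fun j _ => ?_
    rw [← Algebra.commutes, ← Algebra.smul_def, ← map_smul, Matrix.smul_single, smul_eq_mul,
      mul_one]
  rw [h'] at h
  have h0 : algebraMap R C (x i j) = 0 := by
    rw [← h]
    simp [coeff]
  have := congrArg f h0
  rwa [Algebra.algebraMap_eq_smul_one, map_smul, hf, map_zero, smul_eq_mul, mul_one] at this

/-- Applying `f` to the second leg is a left inverse. -/
theorem includeLeft_injective_of_functional {f : D →ₗ[R] R} (hf : f 1 = 1) :
    Function.Injective (Algebra.TensorProduct.includeLeft : C →ₐ[R] C ⊗[R] D) := by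
  refine Function.LeftInverse.injective (g := fun z => TensorProduct.rid R C (f.lTensor C z)) ?_
  intro c
  simp [hf]

/-- The subalgebra `S` is isomorphic to a nonempty matrix algebra. -/
def IsMatrixAlg (S : Subalgebra R C) : Prop := ∃ n : ℕ, 0 < n ∧ Nonempty (Mat R n ≃ₐ[R] S)

theorem IsMatrixAlg.range {n : ℕ} (hn : 0 < n) {φ : Mat R n →ₐ[R] C} (h : Function.Injective φ) :
    IsMatrixAlg φ.range := ⟨n, hn, ⟨AlgEquiv.ofInjective φ h⟩⟩

theorem IsMatrixAlg.isLocallyMatrix {S : Subalgebra R C} (h : IsMatrixAlg S) :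
    IsLocallyMatrix S := by
  obtain ⟨n, hn, ⟨e⟩⟩ := h
  have := isLocallyMatrix_range hn (S.val.comp e.toAlgHom)
  rwa [range_comp_equiv, Subalgebra.range_val] at this

theorem IsMatrixAlg.internal {M K N : Subalgebra R C} (h : IsInternalTensor M K N)
    (hM : IsMatrixAlg M) (hK : IsMatrixAlg K) : IsMatrixAlg N := by
  obtain ⟨n, hn, ⟨e⟩⟩ := hM
  obtain ⟨m, hm, ⟨e'⟩⟩ := hK
  exact ⟨n * m, Nat.mul_pos hn hm,
    ⟨((kron R rfl).symm.trans (Algebra.TensorProduct.congr e e')).trans h.equiv⟩⟩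

theorem isMatrixAlg_bot {f : C →ₗ[R] R} (hf : f 1 = 1) : IsMatrixAlg (⊥ : Subalgebra R C) := by
  have hb : Function.Bijective (Algebra.ofId R (Mat R 1)) := by
    refine ⟨fun a b h => ?_, fun x => ⟨x 0 0, ?_⟩⟩
    · have := congrFun (congrFun h 0) 0
      simpa [Algebra.ofId_apply, Matrix.algebraMap_matrix_apply] using this
    · ext i j
      rw [Subsingleton.elim i 0, Subsingleton.elim j 0]
      simp [Algebra.ofId_apply, Matrix.algebraMap_matrix_apply]
  let φ : Mat R 1 →ₐ[R] C := (Algebra.ofId R C).comp (AlgEquiv.ofBijective _ hb).symm.toAlgHom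
  have : φ.range = ⊥ := range_comp_equiv _ _
  rw [← this]
  exact .range one_pos (injective_of_functional φ hf)

end MatrixAlgebra

/-! ### Azumaya subalgebras and their classes in `K₀` -/

section Azumaya

universe u

variable {R : Type u} [CommRing R] {A B : Type u} [Ring A] [Algebra R A] [Ring B] [Algebra R B]
  {C : Type u} [Ring C] [Algebra R C]

theorem IsAzumayaAlgebra.congr (hA : IsAzumayaAlgebra R A) (e : A ≃ₐ[R] B) :
    IsAzumayaAlgebra R B := by
  obtain ⟨A', _, _, n, hn, ⟨f⟩⟩ := hA
  exact ⟨A', inferInstance, inferInstance, n, hn,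
    ⟨(Algebra.TensorProduct.congr e.symm AlgEquiv.refl).trans f⟩⟩

theorem IsAzumayaAlgebra.matrix {n : ℕ} (hn : 0 < n) : IsAzumayaAlgebra R (Mat R n) :=
  ⟨R, inferInstance, inferInstance, n, hn, ⟨Algebra.TensorProduct.rid R R (Mat R n)⟩⟩

theorem IsMatrixAlg.isAzumayaAlgebra {S : Subalgebra R C} (h : IsMatrixAlg S) :
    IsAzumayaAlgebra R S := by
  obtain ⟨n, hn, ⟨e⟩⟩ := h
  exact (IsAzumayaAlgebra.matrix hn).congr e

theorem IsInternalTensor.isAzumayaAlgebra {M K N : Subalgebra R C} (h : IsInternalTensor M K N)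
    (hM : IsAzumayaAlgebra R M) (hK : IsAzumayaAlgebra R K) : IsAzumayaAlgebra R N :=
  (hM.tensor hK).congr h.equiv

theorem IsInternalTensor.isAzumayaAlgebra_left {M K N : Subalgebra R C}
    (h : IsInternalTensor M K N) (hN : IsMatrixAlg N) : IsAzumayaAlgebra R M := by
  obtain ⟨n, hn, ⟨e⟩⟩ := hN
  exact ⟨K, inferInstance, inferInstance, n, hn, ⟨h.equiv.trans e.symm⟩⟩

theorem K0Az.mk_congr (hA : IsAzumayaAlgebra R A) (hB : IsAzumayaAlgebra R B) (e : A ≃ₐ[R] B) :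
    K0Az.mk A hA = K0Az.mk B hB :=
  congrArg Algebra.GrothendieckGroup.of (Quotient.sound ⟨e⟩)

theorem K0Az.mk_tensor (hA : IsAzumayaAlgebra R A) (hB : IsAzumayaAlgebra R B) :
    K0Az.mk (A ⊗[R] B) (hA.tensor hB) = K0Az.mk A hA * K0Az.mk B hB := by
  let a : AzumayaClass R := Quotient.mk (AzumayaAlgebra.setoid R) ⟨A, hA⟩
  let b : AzumayaClass R := Quotient.mk (AzumayaAlgebra.setoid R) ⟨B, hB⟩
  exact map_mul Algebra.GrothendieckGroup.of a b

theorem K0Az.mk_base : K0Az.mk R (IsAzumayaAlgebra.base (R := R)) = 1 :=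
  map_one (Algebra.GrothendieckGroup.of (M := AzumayaClass R))

theorem K0Az.exists_div (x : K0Az R) : ∃ A B : AzumayaAlgebra R,
    x = K0Az.mk A.carrier A.isAzumaya / K0Az.mk B.carrier B.isAzumaya := by
  obtain ⟨⟨⟨A⟩, ⟨⟨B⟩, h⟩⟩, hx⟩ := (Localization.monoidOf (⊤ : Submonoid (AzumayaClass R))).surj x
  exact ⟨A, B, eq_div_of_mul_eq' hx⟩

/-- Azumaya algebras with the same class become isomorphic after tensoring with a matrix
algebra. -/
theorem K0Az.exists_matrix_of_mk_eq {hA : IsAzumayaAlgebra R A} {hB : IsAzumayaAlgebra R B}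
    (h : K0Az.mk A hA = K0Az.mk B hB) :
    ∃ n : ℕ, 0 < n ∧ Nonempty (A ⊗[R] Mat R n ≃ₐ[R] B ⊗[R] Mat R n) := by
  obtain ⟨⟨D, _⟩, hD⟩ :=
    ((Localization.monoidOf (⊤ : Submonoid (AzumayaClass R))).eq_iff_exists).1 h
  obtain ⟨D, rfl⟩ := Quotient.exists_rep D
  obtain ⟨e⟩ : Nonempty (D.carrier ⊗[R] A ≃ₐ[R] D.carrier ⊗[R] B) := Quotient.exact hD
  -- Equality in the Grothendieck group only gives `D ⊗ A ≃ D ⊗ B` for some Azumaya `D`. A further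
  -- factor `D'` with `D ⊗ D' ≃ Mat(R^n)` turns `D` into a matrix algebra.
  obtain ⟨D', _, _, n, hn, ⟨f⟩⟩ := D.isAzumaya
  have g (X : Type u) [Ring X] [Algebra R X] :
      X ⊗[R] Mat R n ≃ₐ[R] (D.carrier ⊗[R] X) ⊗[R] D' :=
    ((Algebra.TensorProduct.congr AlgEquiv.refl f.symm).trans
      (Algebra.TensorProduct.assoc R R R X D.carrier D').symm).trans
        (Algebra.TensorProduct.congr (Algebra.TensorProduct.comm R X D.carrier) AlgEquiv.refl)
  exact ⟨n, hn, ⟨((g A).trans (Algebra.TensorProduct.congr e AlgEquiv.refl)).trans (g B).symm⟩⟩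

open Classical in
/-- The class of a subalgebra which is Azumaya (and `1` for other subalgebras). -/
def cls (S : Subalgebra R C) : K0Az R :=
  if h : IsAzumayaAlgebra R S then K0Az.mk S h else 1

theorem cls_eq {S : Subalgebra R C} (h : IsAzumayaAlgebra R S) : cls S = K0Az.mk S h := dif_pos h

theorem IsInternalTensor.cls {M K N : Subalgebra R C} (h : IsInternalTensor M K N)
    (hM : IsAzumayaAlgebra R M) (hK : IsAzumayaAlgebra R K) : cls N = cls M * cls K := by
  rw [cls_eq hM, cls_eq hK, cls_eq (h.isAzumayaAlgebra hM hK), ← K0Az.mk_tensor]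
  exact K0Az.mk_congr _ _ h.equiv.symm

theorem cls_map {D : Type u} [Ring D] [Algebra R D] {S : Subalgebra R C}
    (hS : IsAzumayaAlgebra R S) {f : C →ₐ[R] D}
    (hf : Function.Injective f) : cls (S.map f) = cls S := by
  have e := S.equivMapOfInjective f hf
  rw [cls_eq hS, cls_eq (hS.congr e)]
  exact K0Az.mk_congr _ _ e.symm

theorem IsAzumayaAlgebra.map {D : Type u} [Ring D] [Algebra R D] {S : Subalgebra R C}
    (hS : IsAzumayaAlgebra R S) {f : C →ₐ[R] D}
    (hf : Function.Injective f) : IsAzumayaAlgebra R (S.map f) :=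
  hS.congr (S.equivMapOfInjective f hf)

theorem cls_bot {f : C →ₗ[R] R} (hf : f 1 = 1) : cls (⊥ : Subalgebra R C) = 1 := by
  have hi : Function.Injective (algebraMap R C) := fun a b h => by
    have := congrArg f h
    simpa only [Algebra.algebraMap_eq_smul_one, map_smul, hf, smul_eq_mul, mul_one] using this
  rw [cls_eq (isMatrixAlg_bot hf).isAzumayaAlgebra, ← K0Az.mk_base]
  exact K0Az.mk_congr _ _ (Algebra.botEquivOfInjective hi)

/-- The first diagonal entry of `A ⊗ A' ≃ Mat(R^n)` takes the value `1` at `1`; restrict it to `A`.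
-/
theorem IsAzumayaAlgebra.exists_functional (hA : IsAzumayaAlgebra R A) :
    ∃ f : A →ₗ[R] R, f 1 = 1 := by
  obtain ⟨A', _, _, n, hn, ⟨e⟩⟩ := hA
  refine ⟨((Matrix.entryLinearMap R R (⟨0, hn⟩ : Fin n) ⟨0, hn⟩).comp e.toLinearMap).comp
    (Algebra.TensorProduct.includeLeft : A →ₐ[R] A ⊗[R] A').toLinearMap, ?_⟩
  change e (1 ⊗ₜ 1) _ _ = 1
  rw [← Algebra.TensorProduct.one_def, map_one, Matrix.one_apply_eq]

end Azumaya

/-! ### A unital functional on the local observables -/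

section Obs

variable {R : Type*} [CommRing R] {X : Type*} [MetricSpace X] [DecidableEq X] {q : SpinSystem X}

namespace Obs

variable (R q) in
/-- The linear functional which maps a product of local observables to the product of their
first diagonal entries. -/
def functional : Obs R q →ₗ[R] R :=
  DirectLimit.Module.lift R (Finset X) (FinTensor R fun x => Mat R (q.dim x))
    (fun _ _ h => FinTensor.incl R (fun x => Mat R (q.dim x)) h)
    (fun Γ => PiTensorProduct.lift ((MultilinearMap.mkPiAlgebra R Γ R).compLinearMap
      fun x => Matrix.entryLinearMap R R (⟨0, q.dim_pos x⟩ : Fin (q.dim x)) ⟨0, q.dim_pos x⟩))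
    (fun Γ Γ' h t => by
      revert t
      refine LinearMap.congr_fun (f := (PiTensorProduct.lift _).comp
        (FinTensor.incl R (fun x => Mat R (q.dim x)) h).toLinearMap) ?_
      refine PiTensorProduct.ext (MultilinearMap.ext fun a => ?_)
      simp only [LinearMap.compMultilinearMap_apply, LinearMap.comp_apply,
        AlgHom.toLinearMap_apply, FinTensor.incl_tprod, PiTensorProduct.lift.tprod,
        MultilinearMap.compLinearMap_apply, MultilinearMap.mkPiAlgebra_apply]
      symm
      -- Compatibility with `a ↦ a ⊗ 1`: each added site carries the identity matrix, whose first
      -- diagonal entry contributes a factor `1`.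
      refine Fintype.prod_of_injective (fun x : Γ => (⟨x, h x.2⟩ : Γ'))
        (fun x y e => Subtype.ext (congrArg (fun z : Γ' => (z : X)) e)) _ _ ?_ ?_
      · intro x hx
        have : (x : X) ∉ Γ := fun hm => hx ⟨⟨x, hm⟩, rfl⟩
        simp [extendOne, this]
      · intro x
        simp [extendOne])

theorem functional_one : functional R q 1 = 1 := by
  rw [← map_one (LocalTensor.of R (fun x => Mat R (q.dim x)) ∅)]
  change PiTensorProduct.lift _ (PiTensorProduct.tprod R _) = 1
  rw [PiTensorProduct.lift.tprod]
  simp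

end Obs

end Obs

/-! ### Algebras of observables supported on sets of sites -/

section Obs

variable {R : Type*} [CommRing R] {X : Type*} [MetricSpace X] [DecidableEq X] {q : SpinSystem X}

namespace Obs

theorem on_union (Z W : Set X) : Obs.on R q (Z ∪ W) = Obs.on R q Z ⊔ Obs.on R q W := by
  refine le_antisymm (Obs.on_le_iff.2 fun x hx a => ?_)
    (sup_le (Obs.on_mono Set.subset_union_left) (Obs.on_mono Set.subset_union_right))
  rcases hx with hx | hx
  · exact (le_sup_left : Obs.on R q Z ≤ _) (Obs.site_mem_on hx a)
  · exact (le_sup_right : Obs.on R q W ≤ _) (Obs.site_mem_on hx a)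

theorem on_empty : Obs.on R q ∅ = ⊥ := le_bot_iff.1 (Obs.on_le_iff.2 fun _ hx => hx.elim)

theorem on_univ : Obs.on R q Set.univ = ⊤ :=
  top_le_iff.1 fun t _ => LocalTensor.mem_of_site_mem
    (fun x a => Obs.site_mem_on (Set.mem_univ x) a) t

theorem on_singleton (x : X) : Obs.on R q {x} = (Obs.site q x).range := by
  refine le_antisymm (Obs.on_le_iff.2 ?_) ?_
  · rintro _ rfl a
    exact ⟨a, rfl⟩
  · rintro _ ⟨a, rfl⟩
    exact Obs.site_mem_on (Set.mem_singleton x) a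

theorem commuting_on {Z W : Set X} (h : Disjoint Z W) :
    Commuting (Obs.on R q Z) (Obs.on R q W) := by
  rw [Commuting.iff_le_centralizer, Subalgebra.le_centralizer_iff]
  refine Obs.on_le_iff.2 fun x hx a => (Subalgebra.mem_centralizer_iff R).2 ?_
  suffices Obs.on R q W ≤ Subalgebra.centralizer R {Obs.site q x a} from
    fun t ht => ((Subalgebra.mem_centralizer_iff R).1 (this ht) _ rfl).symm
  refine Obs.on_le_iff.2 fun y hy b => (Subalgebra.mem_centralizer_iff R).2 ?_
  rintro _ rfl
  exact Obs.site_commute (fun e => Set.disjoint_left.1 h hx (by rwa [e])) a b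

theorem le_on_compl {Z : Set X} {S : Subalgebra R (Obs R q)}
    (h : Commuting (Obs.on R q Z) S) : S ≤ Obs.on R q Zᶜ := fun t ht =>
  Obs.mem_on_compl fun _ hy b => (h _ (Obs.site_mem_on hy b) t ht).symm

/-- Support is detected by commutation: an element of both algebras commutes with every site outside
`Z` and with every site outside `W`. -/
theorem on_inter (Z W : Set X) : Obs.on R q Z ⊓ Obs.on R q W = Obs.on R q (Z ∩ W) := by
  refine le_antisymm (fun t ht => ?_)
    (le_inf (Obs.on_mono Set.inter_subset_left) (Obs.on_mono Set.inter_subset_right))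
  have : t ∈ Obs.on R q (Zᶜ ∪ Wᶜ)ᶜ := by
    refine Obs.mem_on_compl fun y hy b => ?_
    rcases hy with hy | hy
    · exact commuting_on (Set.disjoint_singleton_right.2 hy) _ ht.1 _
        (Obs.site_mem_on (Set.mem_singleton y) b)
    · exact commuting_on (Set.disjoint_singleton_right.2 hy) _ ht.2 _
        (Obs.site_mem_on (Set.mem_singleton y) b)
  simpa [Set.compl_union] using this

theorem site_injective (x : X) : Function.Injective (Obs.site (R := R) q x) :=
  injective_of_functional _ functional_one

theorem isMatrixAlg_on {Z : Set X} (hZ : Z.Finite) : IsMatrixAlg (Obs.on R q Z) := by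
  induction Z, hZ using Set.Finite.induction_on with
  | empty =>
    rw [on_empty]
    exact isMatrixAlg_bot functional_one
  | @insert x Z hx hZ ih =>
    have h1 : IsMatrixAlg (Obs.on R q {x}) := by
      rw [on_singleton]
      exact .range (q.dim_pos x) (site_injective x)
    rw [Set.insert_eq, on_union]
    exact .internal (h1.isLocallyMatrix.isInternalTensor
      (commuting_on (Set.disjoint_singleton_left.2 hx))) h1 ih

theorem exists_finset_mem_on (t : Obs R q) : ∃ Γ : Finset X, t ∈ Obs.on R q Γ := by
  obtain ⟨Γ, b, rfl⟩ := LocalTensor.exists_of R _ t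
  exact ⟨Γ, LocalTensor.of_mem (fun x hx a => Obs.site_mem_on (Z := (Γ : Set X)) hx a) b⟩

/-- Finitely many observables involve finitely many sites, and by `on_inter` only those in `Z` are
needed. The algebra of a finite set of sites is a matrix algebra. -/
theorem isLocallyMatrix_on (Z : Set X) : IsLocallyMatrix (Obs.on R q Z) := by
  classical
  intro s hs
  choose g hg using exists_finset_mem_on (R := R) (q := q)
  have hle : Obs.on R q (Z ∩ (s.biUnion g : Finset X)) ≤ Obs.on R q Z :=
    Obs.on_mono Set.inter_subset_left
  obtain ⟨n, hn, φ, h1, h2⟩ := (isMatrixAlg_on (R := R) (q := q)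
    (Z := Z ∩ (s.biUnion g : Finset X)) ((Finset.finite_toSet _).inter_of_right _)).isLocallyMatrix s
    (fun t ht => by
      rw [SetLike.mem_coe, ← on_inter]
      exact ⟨hs ht, Obs.on_mono (fun x hx => Finset.mem_coe.2
        (Finset.mem_biUnion.2 ⟨t, ht, hx⟩)) (hg t)⟩)
  exact ⟨n, hn, φ, h1.trans hle, h2⟩

theorem isInternalTensor_on {Z W : Set X} (h : Disjoint Z W) :
    IsInternalTensor (Obs.on R q Z) (Obs.on R q W) (Obs.on R q (Z ∪ W)) := by
  rw [on_union]
  exact (isLocallyMatrix_on Z).isInternalTensor (commuting_on h)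

/-- In an internal tensor product `on Z ⊗ B`, the factor `B` is determined by the product. -/
theorem eq_inf_of_sup {Z : Set X} {B N : Subalgebra R (Obs R q)} (hB : B ≤ Obs.on R q Zᶜ)
    (h : N = Obs.on R q Z ⊔ B) : B = N ⊓ Obs.on R q Zᶜ := by
  refine le_antisymm (le_inf (h ▸ le_sup_right) hB) fun t ht => ?_
  have hc := commuting_on (R := R) (q := q) (disjoint_compl_right (a := Z))
  exact (isLocallyMatrix_on Z).mem_of_commute (hc.mono le_rfl hB) (h ▸ ht.1)
    fun m hm => hc m hm t ht.2

end Obs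

end Obs

/-! ### Splitting the image of an algebra along a cut -/

section Cut

variable {R : Type*} [CommRing R] {X : Type*} [MetricSpace X] [DecidableEq X] {q : SpinSystem X}

theorem map_on_le {α : Obs R q ≃ₐ[R] Obs R q} {l : ℝ} (hα : HasSpread α l) {Z W : Set X}
    (h : ∀ x ∈ Z, Metric.closedBall x l ⊆ W) :
    (Obs.on R q Z).map α.toAlgHom ≤ Obs.on R q W := by
  rw [Subalgebra.map_le]
  exact Obs.on_le_iff.2 fun x hx a => Obs.on_mono (h x hx) (hα x a)

/-- The inverse of `α` obeys the same spread bound, so `α⁻¹` carries `A(W)` into `A(Z)`. -/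
theorem le_map_on {α : Obs R q ≃ₐ[R] Obs R q} {l : ℝ} (hα : HasSpread α l) {Z W : Set X}
    (h : ∀ x ∈ W, Metric.closedBall x l ⊆ Z) :
    Obs.on R q W ≤ (Obs.on R q Z).map α.toAlgHom := fun t ht =>
  ⟨α⁻¹ t, map_on_le hα.inv h ⟨t, ht, rfl⟩, α.apply_symm_apply t⟩

/-- The part of `α(A(Z))` supported on `D`. -/
def bd (α : Obs R q ≃ₐ[R] Obs R q) (Z D : Set X) : Subalgebra R (Obs R q) :=
  (Obs.on R q Z).map α.toAlgHom ⊓ Obs.on R q D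

/-- `X` is partitioned into the sets `Z₀`, `D` and `Z₁`; the automorphism `α` maps `A(Z)` into
`A(Z₀ ∪ D)` and `A(Zᶜ)` into `A(Z₁ ∪ D)`, and the images contain `A(Z₀)` and `A(Z₁)`. -/
structure IsCut (α : Obs R q ≃ₐ[R] Obs R q) (Z Z₀ D Z₁ : Set X) : Prop where
  disj₀ : Disjoint Z₀ D
  disj₁ : Disjoint Z₁ D
  disj : Disjoint Z₀ Z₁
  union : Z₀ ∪ Z₁ ∪ D = Set.univ
  le₀ : Obs.on R q Z₀ ≤ (Obs.on R q Z).map α.toAlgHom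
  le₁ : Obs.on R q Z₁ ≤ (Obs.on R q Zᶜ).map α.toAlgHom
  map_le₀ : (Obs.on R q Z).map α.toAlgHom ≤ Obs.on R q (Z₀ ∪ D)
  map_le₁ : (Obs.on R q Zᶜ).map α.toAlgHom ≤ Obs.on R q (Z₁ ∪ D)

namespace IsCut

variable {α : Obs R q ≃ₐ[R] Obs R q} {Z Z₀ D Z₁ : Set X}

theorem swap (h : IsCut α Z Z₀ D Z₁) : IsCut α Zᶜ Z₁ D Z₀ :=
  ⟨h.disj₁, h.disj₀, h.disj.symm, by rw [Set.union_comm Z₁, h.union], h.le₁,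
    by rw [compl_compl]; exact h.le₀, h.map_le₁, by rw [compl_compl]; exact h.map_le₀⟩

theorem commuting (h : IsCut α Z Z₀ D Z₁) : Commuting (Obs.on R q Z₀) (bd α Z D) :=
  (Obs.commuting_on h.disj₀).mono le_rfl inf_le_right

/-- The image is sandwiched between `A(Z₀)` and `A(Z₀) ⊗ A(D)`, so it is `A(Z₀)` times its part in
`A(D)`. -/
theorem map_eq (h : IsCut α Z Z₀ D Z₁) :
    (Obs.on R q Z).map α.toAlgHom = Obs.on R q Z₀ ⊔ bd α Z D :=
  (Obs.isLocallyMatrix_on Z₀).eq_sup_inf (Obs.commuting_on h.disj₀) h.le₀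
    (h.map_le₀.trans (Obs.on_union _ _).le)

theorem isInternalTensor (h : IsCut α Z Z₀ D Z₁) :
    IsInternalTensor (Obs.on R q Z₀) (bd α Z D) ((Obs.on R q Z).map α.toAlgHom) := by
  rw [h.map_eq]
  exact (Obs.isLocallyMatrix_on Z₀).isInternalTensor h.commuting

/-- Surjectivity of `α` shows that `A(Z₀ ∪ Z₁)` and the two boundary algebras generate everything.
An element of `A(D)` commutes with `A(Z₀ ∪ Z₁)`, hence already lies in the algebra generated by the
two boundary algebras. -/
theorem sup_eq (h : IsCut α Z Z₀ D Z₁) : bd α Z D ⊔ bd α Zᶜ D = Obs.on R q D := by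
  refine le_antisymm (sup_le inf_le_right inf_le_right) fun t ht => ?_
  have hd : Disjoint (Z₀ ∪ Z₁) D := Set.disjoint_union_left.2 ⟨h.disj₀, h.disj₁⟩
  have hc := Obs.commuting_on (R := R) (q := q) hd
  refine (Obs.isLocallyMatrix_on (Z₀ ∪ Z₁)).mem_of_commute
    (hc.mono le_rfl (sup_le inf_le_right inf_le_right)) ?_ fun m hm => hc m hm t ht
  have : (⊤ : Subalgebra R (Obs R q)) ≤ Obs.on R q (Z₀ ∪ Z₁) ⊔ (bd α Z D ⊔ bd α Zᶜ D) := by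
    have h1 : (⊤ : Subalgebra R (Obs R q)) = (Obs.on R q (Z ∪ Zᶜ)).map α.toAlgHom := by
      rw [Set.union_compl_self, Obs.on_univ, Algebra.map_top]
      exact ((AlgHom.range_eq_top α.toAlgHom).2 α.surjective).symm
    rw [h1, Obs.on_union, Algebra.map_sup, h.map_eq, h.swap.map_eq, Obs.on_union]
    exact (sup_sup_sup_comm _ _ _ _).le
  exact this Algebra.mem_top

/-- Neither boundary algebra is known to be locally matrix, so `of_factor` is applied to the first
one as a tensor factor of the locally matrix algebra `α(A(Z))`, which commutes with `α(A(Zᶜ))`. -/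
theorem isInternalTensor_bd (h : IsCut α Z Z₀ D Z₁) :
    IsInternalTensor (bd α Z D) (bd α Zᶜ D) (Obs.on R q D) := by
  rw [← h.sup_eq]
  exact h.isInternalTensor.of_factor Obs.functional_one ((Obs.isLocallyMatrix_on Z).map _)
    (((Obs.commuting_on disjoint_compl_right).map α.toAlgHom).mono le_rfl inf_le_left)

end IsCut

end Cut

/-! ### Boundary algebras of finite cuts are Azumaya -/

section CutAzumaya

universe u

variable {R : Type u} [CommRing R] {X : Type} [MetricSpace X] [DecidableEq X] {q : SpinSystem X}
  {α : Obs R q ≃ₐ[R] Obs R q} {Z Z₀ D Z₁ : Set X}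

theorem IsCut.isAzumayaAlgebra (h : IsCut α Z Z₀ D Z₁) (hD : D.Finite) :
    IsAzumayaAlgebra R (bd α Z D) :=
  h.isInternalTensor_bd.isAzumayaAlgebra_left (Obs.isMatrixAlg_on hD)

end CutAzumaya

/-! ### Renormalized classes of half-infinite algebras and the index -/

section HalfClass

universe u

variable {R : Type u} [CommRing R] {q : SpinSystem ℤ}

theorem cls_on_union {Z W : Set ℤ} (hZ : Z.Finite) (hW : W.Finite) (h : Disjoint Z W) :
    cls (Obs.on R q (Z ∪ W)) = cls (Obs.on R q Z) * cls (Obs.on R q W) :=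
  (Obs.isInternalTensor_on h).cls (Obs.isMatrixAlg_on hZ).isAzumayaAlgebra
    (Obs.isMatrixAlg_on hW).isAzumayaAlgebra

variable (R q) in
/-- A primitive of the classes of the algebras of finite intervals. -/
def weight (a : ℤ) : K0Az R :=
  cls (Obs.on R q (Set.Ioc 0 a)) / cls (Obs.on R q (Set.Ioc a 0))

/-- At most one of the two intervals in the definition of `weight` is nonempty, so `weight` is a
signed integral from `0`; the cases depend on where `0` lies relative to `a` and `b`. -/
theorem weight_eq_mul {a b : ℤ} (h : a ≤ b) :
    weight R q b = weight R q a * cls (Obs.on R q (Set.Ioc a b)) := by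
  have key : ∀ {x y z : ℤ}, x ≤ y → y ≤ z → cls (Obs.on R q (Set.Ioc x z)) =
      cls (Obs.on R q (Set.Ioc x y)) * cls (Obs.on R q (Set.Ioc y z)) := fun {x y z} hxy hyz => by
    rw [← Set.Ioc_union_Ioc_eq_Ioc hxy hyz]
    exact cls_on_union (Set.finite_Ioc _ _) (Set.finite_Ioc _ _)
      (Set.Ioc_disjoint_Ioc_of_le le_rfl)
  have emp : ∀ {x y : ℤ}, y ≤ x → cls (Obs.on R q (Set.Ioc x y)) = 1 := fun {x y} hxy => by
    rw [Set.Ioc_eq_empty hxy.not_gt, Obs.on_empty, cls_bot Obs.functional_one]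
  unfold weight
  rcases le_total 0 a with ha | ha
  · rw [emp ha, emp (ha.trans h), div_one, div_one, key ha h]
  · rcases le_total 0 b with hb | hb
    · rw [emp ha, emp hb, key ha hb, div_one, one_div, inv_mul_cancel_left]
    · rw [emp ha, emp hb, key h hb, one_div, one_div, mul_inv_rev, inv_mul_cancel_right]

/-- The subalgebra `N` is `A(≤ a) ⊗ B` for an Azumaya algebra `B` supported on the sites greater
than `a`, and `κ` is the renormalized class of `N`. -/
def HalfClass (N : Subalgebra R (Obs R q)) (κ : K0Az R) : Prop :=
  ∃ (a : ℤ) (B : Subalgebra R (Obs R q)), IsAzumayaAlgebra R B ∧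
    B ≤ Obs.on R q (Set.Iic a)ᶜ ∧ N = Obs.on R q (Set.Iic a) ⊔ B ∧ κ = weight R q a * cls B

namespace HalfClass

variable {N S : Subalgebra R (Obs R q)} {κ κ' : K0Az R}

/-- For cut points `a' ≤ a`, uniqueness of the complementary factor forces `B' = A((a', a]) ⊗ B`.
The extra factor is exactly the difference between the two weights. -/
theorem unique (h : HalfClass N κ) (h' : HalfClass N κ') : κ = κ' := by
  obtain ⟨a, B, hB, hBa, hN, rfl⟩ := h
  obtain ⟨a', B', hB', hBa', hN', rfl⟩ := h'
  wlog haa : a' ≤ a generalizing a a' B B'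
  · exact (this a' B' hB' hBa' hN' a B hB hBa hN (le_of_not_ge haa)).symm
  have hd : Disjoint (Set.Ioc a' a) (Set.Iic a)ᶜ :=
    Set.disjoint_compl_right_iff_subset.2 Set.Ioc_subset_Iic_self
  have hi := (Obs.isLocallyMatrix_on (Set.Ioc a' a)).isInternalTensor
    ((Obs.commuting_on hd).mono le_rfl hBa)
  have e : B' = Obs.on R q (Set.Ioc a' a) ⊔ B := by
    rw [Obs.eq_inf_of_sup hBa' hN']
    have h1 : Set.Ioc a' a ⊆ (Set.Iic a')ᶜ := fun x hx => by
      simp only [Set.mem_compl_iff, Set.mem_Iic, Set.mem_Ioc] at hx ⊢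
      omega
    have h2 : (Set.Iic a)ᶜ ⊆ (Set.Iic a')ᶜ :=
      Set.compl_subset_compl.2 (Set.Iic_subset_Iic.2 haa)
    refine (Obs.eq_inf_of_sup (sup_le (Obs.on_mono h1) (hBa.trans (Obs.on_mono h2))) ?_).symm
    rw [hN, ← sup_assoc, ← Obs.on_union, Set.Iic_union_Ioc_eq_Iic haa]
  rw [e, hi.cls (Obs.isMatrixAlg_on (Set.finite_Ioc _ _)).isAzumayaAlgebra hB,
    weight_eq_mul haa, mul_assoc]

theorem base (a : ℤ) : HalfClass (Obs.on R q (Set.Iic a)) (weight R q a) :=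
  ⟨a, ⊥, (isMatrixAlg_bot Obs.functional_one).isAzumayaAlgebra, bot_le, sup_bot_eq _ |>.symm, by
    rw [cls_bot Obs.functional_one, mul_one]⟩

/-- Commuting with `N`, and so with `A(≤ a)`, puts `S` to the right of `a`. The new boundary factor
is `B ⊗ S`, where `of_factor` supplies the independence of `B` and `S`. -/
theorem sup (h : HalfClass N κ) (hN : IsLocallyMatrix N) (hS : IsAzumayaAlgebra R S)
    (hc : Commuting N S) : HalfClass (N ⊔ S) (κ * cls S) := by
  obtain ⟨a, B, hB, hBa, rfl, rfl⟩ := h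
  have h1 := (Obs.isLocallyMatrix_on (Set.Iic a)).isInternalTensor
    ((Obs.commuting_on disjoint_compl_right).mono le_rfl hBa)
  have h2 := h1.of_factor Obs.functional_one hN hc
  refine ⟨a, B ⊔ S, h2.isAzumayaAlgebra hB hS, sup_le hBa ?_, sup_assoc _ _ _, ?_⟩
  · exact Obs.le_on_compl (hc.mono le_sup_left le_rfl)
  · rw [h2.cls hB hS, mul_assoc]

end HalfClass

theorem mem_closedBall_int {x y : ℤ} {l : ℕ} :
    y ∈ Metric.closedBall x (l : ℝ) ↔ x - l ≤ y ∧ y ≤ x + l := by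
  rw [Metric.mem_closedBall, Int.dist_eq]
  have : |(y : ℝ) - x| ≤ l ↔ |y - x| ≤ (l : ℤ) := by exact_mod_cast Iff.rfl
  rw [this, abs_le]
  constructor <;> rintro ⟨h1, h2⟩ <;> constructor <;> linarith

/-- The half-open window is exact: the right half-line starts at `γ + 1`, so its image starts no
earlier than `γ + 1 - l`, the first site of the window. -/
theorem HasSpread.isCut {α : Obs R q ≃ₐ[R] Obs R q} {l : ℕ} (h : HasSpread α l) (γ : ℤ) :
    IsCut α (Set.Iic γ) (Set.Iic (γ - l)) (Set.Ioc (γ - l) (γ + l)) (Set.Ioi (γ + l)) where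
  disj₀ := Set.disjoint_left.2 fun x h1 h2 => not_lt.2 h1 h2.1
  disj₁ := Set.disjoint_left.2 fun x h1 h2 => not_lt.2 h2.2 h1
  disj := Set.disjoint_left.2 fun x h1 h2 => by
    simp only [Set.mem_Iic, Set.mem_Ioi] at h1 h2
    omega
  union := Set.eq_univ_of_forall fun x => by
    simp only [Set.mem_union, Set.mem_Iic, Set.mem_Ioi, Set.mem_Ioc]
    omega
  le₀ := le_map_on h fun x hx y hy => by
    rw [mem_closedBall_int] at hy
    simp only [Set.mem_Iic] at hx ⊢
    omega
  le₁ := le_map_on h fun x hx y hy => by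
    rw [mem_closedBall_int] at hy
    simp only [Set.mem_Iic, Set.mem_Ioi, Set.mem_compl_iff] at hx ⊢
    omega
  map_le₀ := map_on_le h fun x hx y hy => by
    rw [mem_closedBall_int] at hy
    simp only [Set.mem_Iic, Set.mem_union, Set.mem_Ioc] at hx ⊢
    omega
  map_le₁ := map_on_le h fun x hx y hy => by
    rw [mem_closedBall_int] at hy
    simp only [Set.mem_Iic, Set.mem_Ioi, Set.mem_union, Set.mem_Ioc, Set.mem_compl_iff] at hx ⊢
    omega

theorem HasSpread.halfClass {α : Obs R q ≃ₐ[R] Obs R q} {l : ℕ} (h : HasSpread α l) (γ : ℤ) :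
    HalfClass ((Obs.on R q (Set.Iic γ)).map α.toAlgHom)
      (weight R q (γ - l) * cls (boundaryAlgebra α l γ)) :=
  ⟨γ - l, boundaryAlgebra α l γ, (h.isCut γ).isAzumayaAlgebra (Set.finite_Ioc _ _),
    Obs.le_on_compl (h.isCut γ).commuting, (h.isCut γ).map_eq, rfl⟩

theorem IsLocalityPreserving.exists_nat {X : Type*} [MetricSpace X] [DecidableEq X]
    {q : SpinSystem X} {α : Obs R q ≃ₐ[R] Obs R q}
    (h : IsLocalityPreserving α) : ∃ l : ℕ, 1 ≤ l ∧ HasSpread α l := by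
  obtain ⟨l, hl, h⟩ := h
  obtain ⟨n, hn⟩ := exists_nat_ge l
  refine ⟨n, Nat.one_le_iff_ne_zero.2 ?_, h.mono hn⟩
  rintro rfl
  exact absurd (hl.trans_le hn) (by simp)

theorem IsLocalityPreserving.exists_halfClass {α : Obs R q ≃ₐ[R] Obs R q}
    (h : IsLocalityPreserving α) (γ : ℤ) :
    ∃ κ, HalfClass ((Obs.on R q (Set.Iic γ)).map α.toAlgHom) κ := by
  obtain ⟨l, -, h⟩ := h.exists_nat
  exact ⟨_, h.halfClass γ⟩

/-- The class of `α(A(≤ 0)) / A(≤ 0)`. -/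
def index (α : QCAGroup R q) : K0Az R :=
  Classical.choose (IsLocalityPreserving.exists_halfClass α.2 0) / weight R q 0

/-- Moving the cut adjoins `α(A((γ, γ']))`, which is isomorphic to `A((γ, γ'])`. -/
theorem HalfClass.map_extend {α : Obs R q ≃ₐ[R] Obs R q} {γ γ' : ℤ} (h : γ ≤ γ') {κ : K0Az R}
    (hκ : HalfClass ((Obs.on R q (Set.Iic γ)).map α.toAlgHom) κ) :
    HalfClass ((Obs.on R q (Set.Iic γ')).map α.toAlgHom)
      (κ * cls (Obs.on R q (Set.Ioc γ γ'))) := by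
  have hA := (Obs.isMatrixAlg_on (R := R) (q := q) (Set.finite_Ioc γ γ')).isAzumayaAlgebra
  have := hκ.sup ((Obs.isLocallyMatrix_on _).map _) (hA.map (f := α.toAlgHom) α.injective)
    ((Obs.commuting_on (Set.Iic_disjoint_Ioc le_rfl)).map _)
  rwa [← Algebra.map_sup, ← Obs.on_union, Set.Iic_union_Ioc_eq_Iic h,
    cls_map hA (f := α.toAlgHom) α.injective] at this

/-- Independence of the cut: extending from `γ` to `γ'` multiplies the class of the image and
`weight` by the same element. For `γ ≤ 0` some class at `γ` is extended to `0` and compared there.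
-/
theorem halfClass_index (α : QCAGroup R q) (γ : ℤ) :
    HalfClass ((Obs.on R q (Set.Iic γ)).map α.1.toAlgHom) (weight R q γ * index α) := by
  have h0 : HalfClass ((Obs.on R q (Set.Iic 0)).map α.1.toAlgHom) (weight R q 0 * index α) := by
    rw [index, mul_div_cancel]
    exact Classical.choose_spec (IsLocalityPreserving.exists_halfClass α.2 0)
  rcases le_total 0 γ with h | h
  · rw [weight_eq_mul h, mul_right_comm]
    exact h0.map_extend h
  · obtain ⟨κ, hκ⟩ := IsLocalityPreserving.exists_halfClass α.2 γ
    have := (hκ.map_extend h).unique h0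
    rw [weight_eq_mul h, mul_right_comm] at this
    rwa [← mul_right_cancel this]

theorem index_eq {α : QCAGroup R q} {γ : ℤ} {κ : K0Az R}
    (h : HalfClass ((Obs.on R q (Set.Iic γ)).map α.1.toAlgHom) (weight R q γ * κ)) :
    index α = κ :=
  mul_left_cancel ((halfClass_index α γ).unique h)

theorem HasSpread.index {α : QCAGroup R q} {l : ℕ} (h : HasSpread α.1 l) (γ : ℤ) :
    index α = cls (boundaryAlgebra α.1 l γ) / cls (Obs.on R q (Set.Ioc (γ - l) γ)) := by
  refine index_eq (γ := γ) ?_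
  rw [weight_eq_mul (show γ - l ≤ γ by omega), mul_assoc, mul_div_cancel]
  exact h.halfClass γ

/-- Write `β(A(≤ 0)) = A(≤ a) ⊗ B`. Applying `α` gives `α(A(≤ a)) ⊗ α(B)`, of class `weight a *
index α * [B]`, and `weight a * [B]` is `weight 0 * index β`. -/
theorem index_mul (α β : QCAGroup R q) :
    index (α * β) = index α * index β := by
  obtain ⟨a, B, hB, hBa, hN, hκ⟩ := halfClass_index β 0
  refine index_eq (γ := 0) ?_
  have h := (halfClass_index α a).sup ((Obs.isLocallyMatrix_on _).map _) (hB.map (f := α.1.toAlgHom) α.1.injective)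
    (((Obs.commuting_on disjoint_compl_right).mono le_rfl hBa).map α.1.toAlgHom)
  rw [← Algebra.map_sup, ← hN, Subalgebra.map_map,
    cls_map hB (f := α.1.toAlgHom) α.1.injective, mul_right_comm, ← hκ, mul_assoc,
    mul_comm (index β)] at h
  exact h

end HalfClass

/-! ### Boundary algebras under stabilization -/

section Stabilization

variable {R : Type*} [CommRing R] {X : Type*} [MetricSpace X] [DecidableEq X] {q r : SpinSystem X}

/-- The spin system `r / q`. -/
def SpinSystem.quot (h : q ≤ r) : SpinSystem X where
  dim x := r.dim x / q.dim x
  dim_pos x := Nat.div_pos (Nat.le_of_dvd (r.dim_pos x) (h x)) (q.dim_pos x)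
  locallyFinite B hB := (r.locallyFinite B hB).subset fun _ hx =>
    ⟨lt_of_lt_of_le hx.1 (Nat.div_le_self _ _), hx.2⟩

/-- `b ↦ 1 ⊗ b`, as a map on the observables of the spin system `r / q`. -/
def embQ (h : q ≤ r) : Obs R (SpinSystem.quot h) →ₐ[R] Obs R r := embR h

theorem embL_injective (h : q ≤ r) : Function.Injective (embL (R := R) h) := by
  have h1 := (kronObs R h).injective.comp (includeLeft_injective_of_functional
    (C := Obs R q) (D := Obs R (SpinSystem.quot h)) Obs.functional_one)
  intro a b hab
  refine h1 ?_
  have : ∀ a : Obs R q, kronObs R h (a ⊗ₜ 1) = embL h a := fun a => by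
    rw [kronObs_tmul, map_one, mul_one]
  exact (this a).trans (hab.trans (this b).symm)

theorem embQ_injective (h : q ≤ r) : Function.Injective (embQ (R := R) h) := by
  have h1 := (kronObs R h).injective.comp
    ((Algebra.TensorProduct.comm R (Obs R (SpinSystem.quot h)) (Obs R q)).injective.comp
      (includeLeft_injective_of_functional
        (C := Obs R (SpinSystem.quot h)) (D := Obs R q) Obs.functional_one))
  intro a b hab
  refine h1 ?_
  have : ∀ a : Obs R (SpinSystem.quot h), kronObs R h (1 ⊗ₜ a) = embQ h a := fun a => by
    refine (kronObs_tmul h _ _).trans ?_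
    rw [map_one, one_mul]
    rfl
  exact (this a).trans (hab.trans (this b).symm)

theorem commute_embL_embR (h : q ≤ r) (a : Obs R q) (b : Obs.Quot R q r) :
    Commute (embL h a) (embR h b) := by
  have h1 : kronObs R h (a ⊗ₜ b) = embL h a * embR h b := kronObs_tmul h a b
  have h2 : kronObs R h ((1 ⊗ₜ b) * (a ⊗ₜ 1)) = embR h b * embL h a := by
    rw [map_mul, kronObs_tmul, kronObs_tmul, map_one, map_one, one_mul, mul_one]
  rw [Algebra.TensorProduct.tmul_mul_tmul, one_mul, mul_one] at h2
  exact h1.symm.trans h2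

theorem commute_embL_embQ (h : q ≤ r) (a : Obs R q) (b : Obs R (SpinSystem.quot h)) :
    Commute (embL h a) (embQ h b) := commute_embL_embR h a b

theorem commuting_embL_embQ (h : q ≤ r) (S : Subalgebra R (Obs R q))
    (T : Subalgebra R (Obs R (SpinSystem.quot h))) :
    Commuting (S.map (embL h)) (T.map (embQ h)) := by
  rintro _ ⟨a, -, rfl⟩ _ ⟨b, -, rfl⟩
  exact commute_embL_embQ h a b

theorem embQ_site (h : q ≤ r) (x : X) (b : Mat R ((SpinSystem.quot h).dim x)) :
    embQ h (Obs.site (SpinSystem.quot h) x b) =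
      Obs.site r x (kronR R (SpinSystem.mul_div h x) b) := embR_site h x b

theorem Obs.on_stab (h : q ≤ r) (Z : Set X) : Obs.on R r Z =
    (Obs.on R q Z).map (embL h) ⊔ (Obs.on R (SpinSystem.quot h) Z).map (embQ h) := by
  refine le_antisymm (Obs.on_le_iff.2 fun x hx c => ?_) (sup_le ?_ ?_)
  · obtain ⟨u, rfl⟩ := (kron R (SpinSystem.mul_div h x)).surjective c
    induction u using TensorProduct.induction_on with
    | zero => simp only [map_zero]; exact zero_mem _
    | add u v hu hv => simp only [map_add]; exact add_mem hu hv
    | tmul a b =>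
      rw [kron_tmul_eq, map_mul, ← embL_site h]
      refine mul_mem ((le_sup_left : (Obs.on R q Z).map (embL h) ≤ _) ⟨_, Obs.site_mem_on hx a, rfl⟩)
        ((le_sup_right : (Obs.on R (SpinSystem.quot h) Z).map (embQ h) ≤ _)
          ⟨_, Obs.site_mem_on hx b, embQ_site h x b⟩)
  · rw [Subalgebra.map_le]
    exact Obs.on_le_iff.2 fun x hx a => by
      rw [Subalgebra.mem_comap, embL_site]
      exact Obs.site_mem_on hx _
  · rw [Subalgebra.map_le]
    exact Obs.on_le_iff.2 fun x hx a => by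
      rw [Subalgebra.mem_comap, embQ_site]
      exact Obs.site_mem_on hx _

theorem map_stabAut_on (h : q ≤ r) (α : Obs R q ≃ₐ[R] Obs R q) (Z : Set X) :
    (Obs.on R r Z).map (stabAut R h α).toAlgHom =
      ((Obs.on R q Z).map α.toAlgHom).map (embL h) ⊔
        (Obs.on R (SpinSystem.quot h) Z).map (embQ h) := by
  have h1 : (stabAut R h α).toAlgHom.comp (embL h) = (embL h).comp α.toAlgHom := by
    refine AlgHom.ext fun a => ?_
    rw [AlgHom.comp_apply, AlgHom.comp_apply, AlgEquiv.coe_toAlgHom, AlgEquiv.coe_toAlgHom,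
      stabAut_left]
  have h2 : (stabAut R h α).toAlgHom.comp (embQ h) = embQ h := by
    refine AlgHom.ext fun a => ?_
    rw [AlgHom.comp_apply, AlgEquiv.coe_toAlgHom]
    exact stabAut_right h α a
  rw [Obs.on_stab h, Algebra.map_sup, Subalgebra.map_map, Subalgebra.map_map, h1, h2,
    Subalgebra.map_map]

variable {α : Obs R q ≃ₐ[R] Obs R q} {Z Z₀ D Z₁ : Set X}

/-- Since `α ⊗ id` does not move the `r / q` factor, that factor splits by sites: its part on `Z₀`
completes `A(Z₀, r)`, and its part on `Z ∩ D` joins the boundary algebra. -/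
theorem IsCut.map_stabAut (hα : IsCut α Z Z₀ D Z₁) (h : q ≤ r) (hZ : Z = Z₀ ∪ (Z ∩ D)) :
    (Obs.on R r Z).map (stabAut R h α).toAlgHom = Obs.on R r Z₀ ⊔
      ((bd α Z D).map (embL h) ⊔ (Obs.on R (SpinSystem.quot h) (Z ∩ D)).map (embQ h)) := by
  have hZ' : Obs.on R (SpinSystem.quot h) Z = Obs.on R (SpinSystem.quot h) Z₀ ⊔
      Obs.on R (SpinSystem.quot h) (Z ∩ D) := by rw [← Obs.on_union, ← hZ]
  rw [map_stabAut_on, hα.map_eq, Algebra.map_sup, hZ', Algebra.map_sup, Obs.on_stab h Z₀]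
  exact sup_sup_sup_comm _ _ _ _

theorem bd_stab_le (h : q ≤ r) :
    (bd α Z D).map (embL h) ⊔ (Obs.on R (SpinSystem.quot h) (Z ∩ D)).map (embQ h) ≤
      Obs.on R r D := by
  rw [Obs.on_stab h D]
  exact sup_le_sup (Subalgebra.map_mono inf_le_right)
    (Subalgebra.map_mono (Obs.on_mono Set.inter_subset_right))

theorem IsCut.bd_stabAut (hα : IsCut α Z Z₀ D Z₁) (h : q ≤ r) (hZ : Z = Z₀ ∪ (Z ∩ D)) :
    bd (stabAut R h α) Z D =
      (bd α Z D).map (embL h) ⊔ (Obs.on R (SpinSystem.quot h) (Z ∩ D)).map (embQ h) := by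
  have hD : Obs.on R r D ≤ Obs.on R r Z₀ᶜ :=
    Obs.on_mono (Set.subset_compl_iff_disjoint_left.2 hα.disj₀)
  refine le_antisymm ?_ (le_inf (hα.map_stabAut h hZ ▸ le_sup_right) (bd_stab_le h))
  rw [Obs.eq_inf_of_sup ((bd_stab_le h).trans hD) (hα.map_stabAut h hZ)]
  exact le_inf inf_le_left (inf_le_right.trans hD)

/-- The subalgebra `S` is arbitrary; the locally matrix factor is the one from `r / q`, hence the
passage through `symm`. -/
theorem isInternalTensor_stab (h : q ≤ r) (S : Subalgebra R (Obs R q)) (Z : Set X) :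
    IsInternalTensor (S.map (embL h)) ((Obs.on R (SpinSystem.quot h) Z).map (embQ h))
      (S.map (embL h) ⊔ (Obs.on R (SpinSystem.quot h) Z).map (embQ h)) := by
  have := (((Obs.isLocallyMatrix_on Z).map (embQ h)).isInternalTensor
    (commuting_embL_embQ h S _).symm).symm
  rwa [sup_comm] at this

end Stabilization

/-! ### The index homomorphism on the total QCA group -/

section Index

universe u

variable {R : Type u} [CommRing R] {q r : SpinSystem ℤ}

theorem Iic_eq_union (γ : ℤ) (l : ℕ) :
    Set.Iic γ = Set.Iic (γ - l) ∪ (Set.Iic γ ∩ Set.Ioc (γ - l) (γ + l)) := by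
  ext x
  simp only [Set.mem_Iic, Set.mem_union, Set.mem_inter_iff, Set.mem_Ioc]
  omega

theorem Iic_inter_Ioc (γ : ℤ) (l : ℕ) :
    Set.Iic γ ∩ Set.Ioc (γ - l) (γ + l) = Set.Ioc (γ - l) γ := by
  ext x
  simp only [Set.mem_Iic, Set.mem_inter_iff, Set.mem_Ioc]
  omega

/-- The boundary algebra and the reference algebra both acquire the factor `A((-l, 0], r / q)`,
which cancels in the quotient. -/
theorem index_stab (h : q ≤ r) (α : QCAGroup R q) : index (stab R h α) = index α := by
  obtain ⟨l, -, hl⟩ := IsLocalityPreserving.exists_nat α.2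
  have hl' : HasSpread (stab R h α).1 l := HasSpread.stabAut h l.cast_nonneg hl
  have hc := HasSpread.isCut hl 0
  have hf := Set.finite_Ioc (0 - (l : ℤ)) 0
  have hA : ∀ {s : SpinSystem ℤ}, IsAzumayaAlgebra R (Obs.on R s (Set.Ioc (0 - (l : ℤ)) 0)) :=
    (Obs.isMatrixAlg_on hf).isAzumayaAlgebra
  have hA' := (hA (s := SpinSystem.quot h)).map (f := embQ h) (embQ_injective h)
  have hB : IsAzumayaAlgebra R (boundaryAlgebra α.1 l 0) :=
    hc.isAzumayaAlgebra (Set.finite_Ioc _ _)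
  have e1 : boundaryAlgebra (stab R h α).1 l 0 =
      (boundaryAlgebra α.1 l 0).map (embL h) ⊔
        (Obs.on R (SpinSystem.quot h) (Set.Ioc (0 - (l : ℤ)) 0)).map (embQ h) := by
    rw [← Iic_inter_Ioc]
    exact hc.bd_stabAut h (Iic_eq_union 0 l)
  rw [HasSpread.index hl' 0, HasSpread.index hl 0, e1, Obs.on_stab h,
    (isInternalTensor_stab h _ _).cls (hB.map (embL_injective h)) hA',
    (isInternalTensor_stab h _ _).cls (hA.map (embL_injective h)) hA',
    cls_map hB (embL_injective h), cls_map hA (embL_injective h), mul_div_mul_right_eq_div]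

variable (R q) in
/-- The index as a homomorphism on the group of QCA on a fixed spin system. -/
def indexHom : QCAGroup R q →* K0Az R := MonoidHom.mk' index index_mul

/-- The homomorphism `[q, α] ↦ α(A(≤ γ)) / A(≤ γ)`. -/
def boundaryHom : TotalQCA R ℤ →* K0Az R :=
  MonoidHom.mk' (DirectLimit.lift (fun _ _ h => stab R h) (fun q α => indexHom R q α)
    fun _ _ h α => (index_stab h α).symm) fun x y => DirectLimit.lift_mul _ _ x y

theorem boundaryHom_of (α : QCAGroup R q) : boundaryHom (TotalQCA.of R q α) = index α := rfl

end Index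

/-! ### Construction and recognition of single-layer circuits -/

section SingleLayer

variable {R : Type*} [CommRing R] {X : Type*} [MetricSpace X] [DecidableEq X] {q : SpinSystem X}

theorem Obs.algHom_on_ext {Z : Set X} {C : Type*} [Ring C] [Algebra R C]
    {f g : Obs.on R q Z →ₐ[R] C}
    (h : ∀ x (hx : x ∈ Z) a, f ⟨Obs.site q x a, Obs.site_mem_on hx a⟩ =
      g ⟨Obs.site q x a, Obs.site_mem_on hx a⟩) : f = g := by
  have : Obs.on R q Z ≤ (AlgHom.equalizer f g).map (Obs.on R q Z).val :=
    Obs.on_le_iff.2 fun x hx a => ⟨⟨_, Obs.site_mem_on hx a⟩, h x hx a, rfl⟩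
  refine AlgHom.ext fun t => ?_
  obtain ⟨t', ht', e⟩ := this t.2
  have : t' = t := Subtype.ext e
  exact this ▸ ht'

/-- An automorphism which maps the algebra of each block of a partition into itself maps it onto
itself. -/
theorem on_le_map_of_partition {α : Obs R q ≃ₐ[R] Obs R q} {P : Set (Set X)}
    (hP : Setoid.IsPartition P) (h : ∀ Y ∈ P, (Obs.on R q Y).map α.toAlgHom ≤ Obs.on R q Y)
    {Y : Set X} (hY : Y ∈ P) : Obs.on R q Y ≤ (Obs.on R q Y).map α.toAlgHom := by
  intro t ht
  refine ⟨α.symm t, ?_, α.apply_symm_apply t⟩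
  rw [SetLike.mem_coe, ← compl_compl Y]
  refine Obs.mem_on_compl fun y hy b => ?_
  obtain ⟨Y', ⟨hY', hyY'⟩, -⟩ := hP.2 y
  have hne : Y ≠ Y' := fun e => hy (e ▸ hyY')
  have hc : Commute t (α (Obs.site q y b)) := Obs.commuting_on
    (hP.pairwiseDisjoint hY hY' hne) t ht _ (h Y' hY' ⟨_, Obs.site_mem_on hyY' b, rfl⟩)
  have := hc.map α.symm
  rwa [AlgEquiv.symm_apply_apply] at this

/-- The block automorphisms are the restrictions of `α`, so only invariance of the block algebras
has to be recorded. -/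
theorem isSingleLayer_iff {α : Obs R q ≃ₐ[R] Obs R q} : IsSingleLayer α ↔
    ∃ P : Set (Set X), Setoid.IsPartition P ∧
      (∃ L : ℝ, ∀ Y ∈ P, ∀ x ∈ Y, ∀ y ∈ Y, dist x y ≤ L) ∧
      ∀ Y ∈ P, (Obs.on R q Y).map α.toAlgHom = Obs.on R q Y := by
  refine ⟨?_, ?_⟩
  · rintro ⟨P, hP, hL, β, hβ⟩
    refine ⟨P, hP, hL, fun Y hY => le_antisymm ?_ fun t ht => ?_⟩
    · rintro _ ⟨t, ht, rfl⟩
      exact (hβ ⟨Y, hY⟩ ⟨t, ht⟩).symm ▸ (β ⟨Y, hY⟩ ⟨t, ht⟩).2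
    · refine ⟨(β ⟨Y, hY⟩).symm ⟨t, ht⟩, ((β ⟨Y, hY⟩).symm ⟨t, ht⟩).2, ?_⟩
      refine (hβ ⟨Y, hY⟩ ((β ⟨Y, hY⟩).symm ⟨t, ht⟩)).trans ?_
      rw [AlgEquiv.apply_symm_apply]
  · rintro ⟨P, hP, hL, h⟩
    exact ⟨P, hP, hL, fun Y => ((Obs.on R q (Y : Set X)).equivMapOfInjective α.toAlgHom
      α.injective).trans (Subalgebra.equivOfEq _ _ (h Y Y.2)), fun _ _ => rfl⟩

theorem IsSingleLayer.inv {α : Obs R q ≃ₐ[R] Obs R q} (h : IsSingleLayer α) :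
    IsSingleLayer α⁻¹ := by
  obtain ⟨P, hP, hL, h⟩ := isSingleLayer_iff.1 h
  refine isSingleLayer_iff.2 ⟨P, hP, hL, fun Y hY => ?_⟩
  conv_lhs => rw [← h Y hY, Subalgebra.map_map]
  have : (α⁻¹).toAlgHom.comp α.toAlgHom = AlgHom.id R _ :=
    AlgHom.ext fun a => α.symm_apply_apply a
  rw [this, Subalgebra.map_id]

theorem IsSingleLayer.isLocalityPreserving {α : Obs R q ≃ₐ[R] Obs R q} (h : IsSingleLayer α) :
    IsLocalityPreserving α := by
  obtain ⟨P, hP, ⟨L, hL⟩, h⟩ := isSingleLayer_iff.1 h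
  refine ⟨max L 1, lt_max_of_lt_right one_pos, fun x a => ?_⟩
  obtain ⟨Y, ⟨hY, hx⟩, -⟩ := hP.2 x
  refine Obs.on_mono (fun y hy => ?_) ((h Y hY).le ⟨_, Obs.site_mem_on hx a, rfl⟩)
  exact Metric.mem_closedBall.2 ((hL Y hY y hy x hx).trans (le_max_left _ _))

variable {ι : Type*} {c : X → ι}

theorem isPartition_fibers {X ι : Type*} (c : X → ι) :
    Setoid.IsPartition (Set.range fun x => c ⁻¹' {c x}) := by
  refine ⟨?_, fun x => ⟨c ⁻¹' {c x}, ⟨⟨x, rfl⟩, rfl⟩, ?_⟩⟩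
  · rintro ⟨x, hx⟩
    exact Set.notMem_empty x (hx ▸ (rfl : c x = c x))
  · rintro _ ⟨⟨y, rfl⟩, hy⟩
    have : c x = c y := hy
    simp only [this]

theorem isSingleLayer_of_fibers {α : Obs R q ≃ₐ[R] Obs R q} {L : ℝ}
    (hL : ∀ x y, c x = c y → dist x y ≤ L)
    (h : ∀ k, (Obs.on R q (c ⁻¹' {k})).map α.toAlgHom ≤ Obs.on R q (c ⁻¹' {k})) :
    IsSingleLayer α := by
  have h' : ∀ Y ∈ Set.range fun x => c ⁻¹' {c x},
      (Obs.on R q Y).map α.toAlgHom ≤ Obs.on R q Y := by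
    rintro _ ⟨x, rfl⟩
    exact h _
  refine isSingleLayer_iff.2 ⟨_, isPartition_fibers c, ⟨L, ?_⟩, fun Y hY =>
    le_antisymm (h' Y hY) (on_le_map_of_partition (isPartition_fibers c) h' hY)⟩
  rintro _ ⟨z, rfl⟩ x hx y hy
  have hx' : c x = c z := hx
  have hy' : c y = c z := hy
  exact hL x y (hx'.trans hy'.symm)

theorem Obs.site_mem_fiber {x : X} {k : ι} (h : c x = k) (a : Mat R (q.dim x)) :
    Obs.site q x a ∈ Obs.on R q (c ⁻¹' {k}) := Obs.site_mem_on (Z := c ⁻¹' {k}) h a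

theorem blockHom_commute (τ : ∀ k, Obs.on R q (c ⁻¹' {k}) →ₐ[R] Obs.on R q (c ⁻¹' {k}))
    {x y : X} (hxy : x ≠ y) (a : Mat R (q.dim x)) (b : Mat R (q.dim y)) :
    Commute ((τ (c x) ⟨Obs.site q x a, Obs.site_mem_fiber rfl a⟩ :
        Obs.on R q (c ⁻¹' {c x})) : Obs R q)
      (τ (c y) ⟨Obs.site q y b, Obs.site_mem_fiber rfl b⟩ : Obs.on R q (c ⁻¹' {c y})) := by
  by_cases h : c x = c y
  -- Within one block both images come from the same `τ`. A free label `k` lets the equality of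
  -- labels be substituted.
  · have key : ∀ k (hk : c x = k), Commute
        ((τ (c x) ⟨Obs.site q x a, Obs.site_mem_fiber rfl a⟩ :
          Obs.on R q (c ⁻¹' {c x})) : Obs R q)
        (τ k ⟨Obs.site q y b, Obs.site_mem_fiber (h.symm.trans hk) b⟩ :
          Obs.on R q (c ⁻¹' {k})) := by
      rintro _ rfl
      refine Commute.map (Commute.map ?_ (τ (c x))) (Obs.on R q (c ⁻¹' {c x})).val
      exact Subtype.ext (Obs.site_commute hxy a b)
    exact key _ h
  · exact Obs.commuting_on (Set.disjoint_left.2 fun z (h1 : c z = c x) (h2 : c z = c y) =>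
      h (h1.symm.trans h2)) _ (τ (c x) _).2 _ (τ (c y) _).2

/-- The endomorphism which restricts to `τ k` on the algebra of the block `c ⁻¹' {k}`. -/
def blockHom (τ : ∀ k, Obs.on R q (c ⁻¹' {k}) →ₐ[R] Obs.on R q (c ⁻¹' {k})) :
    Obs R q →ₐ[R] Obs R q :=
  LocalTensor.lift (A := fun x => Mat R (q.dim x))
    (fun x => (Obs.on R q (c ⁻¹' {c x})).val.comp ((τ (c x)).comp
      ((Obs.site q x).codRestrict (Obs.on R q (c ⁻¹' {c x})) (Obs.site_mem_fiber rfl))))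
    fun _ _ hxy a b => blockHom_commute τ hxy a b

theorem blockHom_apply (τ : ∀ k, Obs.on R q (c ⁻¹' {k}) →ₐ[R] Obs.on R q (c ⁻¹' {k})) (k : ι)
    (t : Obs.on R q (c ⁻¹' {k})) : blockHom τ t = τ k t := by
  have h : (blockHom τ).comp (Obs.on R q (c ⁻¹' {k})).val =
      (Obs.on R q (c ⁻¹' {k})).val.comp (τ k) := by
    refine Obs.algHom_on_ext fun x hx a => ?_
    obtain rfl : c x = k := hx
    have := LocalTensor.lift_site (A := fun x => Mat R (q.dim x))
      (fun x => (Obs.on R q (c ⁻¹' {c x})).val.comp ((τ (c x)).comp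
        ((Obs.site q x).codRestrict (Obs.on R q (c ⁻¹' {c x})) (Obs.site_mem_fiber rfl))))
      (fun x y hxy a b => blockHom_commute τ hxy a b) x a
    exact this
  exact DFunLike.congr_fun h t

/-- The automorphism which restricts to `τ k` on the algebra of the block `c ⁻¹' {k}`. -/
def blockAut (τ : ∀ k, Obs.on R q (c ⁻¹' {k}) ≃ₐ[R] Obs.on R q (c ⁻¹' {k})) :
    Obs R q ≃ₐ[R] Obs R q :=
  have key (σ ρ : ∀ k, Obs.on R q (c ⁻¹' {k}) ≃ₐ[R] Obs.on R q (c ⁻¹' {k}))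
      (h : ∀ k t, σ k (ρ k t) = t) :
      (blockHom fun k => (σ k).toAlgHom).comp (blockHom fun k => (ρ k).toAlgHom) =
        AlgHom.id R (Obs R q) := by
    refine LocalTensor.algHom_ext (A := fun x => Mat R (q.dim x)) fun x a => ?_
    rw [AlgHom.comp_apply]
    have h1 := blockHom_apply (fun k => (ρ k).toAlgHom) (c x)
      ⟨Obs.site q x a, Obs.site_mem_fiber rfl a⟩
    refine (congrArg (blockHom fun k => (σ k).toAlgHom) h1).trans ?_
    refine (blockHom_apply _ _ _).trans ?_
    exact congrArg Subtype.val (h (c x) _)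
  AlgEquiv.ofAlgHom (blockHom fun k => (τ k).toAlgHom) (blockHom fun k => (τ k).symm.toAlgHom)
    (key _ _ fun k t => (τ k).apply_symm_apply t) (key _ _ fun k t => (τ k).symm_apply_apply t)

theorem blockAut_apply (τ : ∀ k, Obs.on R q (c ⁻¹' {k}) ≃ₐ[R] Obs.on R q (c ⁻¹' {k})) (k : ι)
    (t : Obs.on R q (c ⁻¹' {k})) : blockAut τ t = τ k t :=
  blockHom_apply (fun k => (τ k).toAlgHom) k t

theorem isSingleLayer_blockAut {L : ℝ} (hL : ∀ x y, c x = c y → dist x y ≤ L)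
    (τ : ∀ k, Obs.on R q (c ⁻¹' {k}) ≃ₐ[R] Obs.on R q (c ⁻¹' {k})) :
    IsSingleLayer (blockAut τ) := by
  refine isSingleLayer_of_fibers hL fun k => ?_
  rintro _ ⟨t, ht, rfl⟩
  exact (blockAut_apply τ k ⟨t, ht⟩).symm ▸ (τ k ⟨t, ht⟩).2

/-- Isomorphisms of the factors of two decompositions of `N` define an automorphism of `N`. -/
theorem IsInternalTensor.exists_equiv {C : Type*} [Ring C] [Algebra R C]
    {M K M' K' N : Subalgebra R C} (h : IsInternalTensor M K N) (h' : IsInternalTensor M' K' N)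
    (e : M ≃ₐ[R] M') (e' : K ≃ₐ[R] K') : ∃ τ : N ≃ₐ[R] N,
      (∀ t : N, (t : C) ∈ M → (τ t : C) ∈ M') ∧ ∀ t : N, (t : C) ∈ K → (τ t : C) ∈ K' := by
  refine ⟨(h.equiv.symm.trans (Algebra.TensorProduct.congr e e')).trans h'.equiv,
    fun t ht => ?_, fun t ht => ?_⟩
  · have : h.equiv.symm t = (⟨t, ht⟩ : M) ⊗ₜ 1 := by
      rw [AlgEquiv.symm_apply_eq]
      apply Subtype.ext
      rw [h.equiv_tmul]
      simp
    simp only [AlgEquiv.trans_apply, this, Algebra.TensorProduct.congr_apply,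
      Algebra.TensorProduct.map_tmul, h'.equiv_tmul, map_one, OneMemClass.coe_one, mul_one]
    exact (e ⟨t, ht⟩).2
  · have : h.equiv.symm t = 1 ⊗ₜ (⟨t, ht⟩ : K) := by
      rw [AlgEquiv.symm_apply_eq]
      apply Subtype.ext
      rw [h.equiv_tmul]
      simp
    simp only [AlgEquiv.trans_apply, this, Algebra.TensorProduct.congr_apply,
      Algebra.TensorProduct.map_tmul, h'.equiv_tmul, map_one, OneMemClass.coe_one, one_mul]
    exact (e' ⟨t, ht⟩).2

end SingleLayer

/-! ### The kernel of the index consists of the circuits -/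

section Kernel

universe u

variable {R : Type u} [CommRing R] {q r : SpinSystem ℤ}

/-- The union `W` of the blocks inside `(-∞, 0]` has `α(A(W)) = A(W)` and misses only finitely many
sites of the half-line. On those sites `α` replaces a matrix algebra by an isomorphic one, so the
class is unchanged. -/
theorem index_eq_one {α : QCAGroup R q} (h : IsSingleLayer α.1) : index α = 1 := by
  obtain ⟨P, hP, ⟨L, hL⟩, h⟩ := isSingleLayer_iff.1 h
  obtain ⟨n, hn⟩ := exists_nat_ge L
  let W : Set ℤ := {x | ∃ Y ∈ P, x ∈ Y ∧ Y ⊆ Set.Iic 0}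
  -- Blocks have diameter at most `n`, so a block meeting `(-∞, -n]` stays inside `(-∞, 0]`.
  let a : ℤ := -n
  have ha : a ≤ 0 := by simp [a]
  have hW0 : W ⊆ Set.Iic 0 := fun x ⟨Y, _, hx, hY⟩ => hY hx
  have haW : Set.Iic a ⊆ W := fun x hx => by
    obtain ⟨Y, ⟨hY, hxY⟩, -⟩ := hP.2 x
    refine ⟨Y, hY, hxY, fun y hy => ?_⟩
    have h1 : y ∈ Metric.closedBall x (n : ℝ) :=
      Metric.mem_closedBall.2 ((hL Y hY y hy x hxY).trans hn)
    rw [mem_closedBall_int] at h1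
    simp only [Set.mem_Iic, a] at hx ⊢
    omega
  have hYW : ∀ Y ∈ P, Y ⊆ Set.Iic 0 → Y ⊆ W := fun Y hY hY0 y hy => ⟨Y, hY, hy, hY0⟩
  have hmap : (Obs.on R q W).map α.1.toAlgHom = Obs.on R q W := by
    refine le_antisymm ?_ (Obs.on_le_iff.2 ?_)
    · rw [Subalgebra.map_le]
      rintro x hx
      refine (Obs.on_le_iff (S := (Obs.on R q W).comap α.1.toAlgHom)).2 ?_ hx
      rintro x ⟨Y, hY, hx, hY0⟩ b
      exact Obs.on_mono (hYW Y hY hY0)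
        ((h Y hY).le ⟨_, Obs.site_mem_on hx b, rfl⟩)
    · rintro x ⟨Y, hY, hx, hY0⟩ b
      exact Subalgebra.map_mono (Obs.on_mono (hYW Y hY hY0))
        ((h Y hY).ge (Obs.site_mem_on hx b))
  have hf1 : (W ∩ Set.Ioc a 0).Finite := (Set.finite_Ioc a 0).inter_of_right W
  have hf2 : (Wᶜ ∩ Set.Ioc a 0).Finite := (Set.finite_Ioc a 0).inter_of_right Wᶜ
  have hu1 : Set.Iic a ∪ (W ∩ Set.Ioc a 0) = W := by
    ext x
    have h1 := @haW x
    have h2 := @hW0 x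
    simp only [Set.mem_union, Set.mem_inter_iff, Set.mem_Ioc, Set.mem_Iic] at h1 h2 ⊢
    have := le_or_gt x a
    tauto
  have hu2 : W ∪ (Wᶜ ∩ Set.Ioc a 0) = Set.Iic 0 := by
    ext x
    have h1 := @haW x
    have h2 := @hW0 x
    simp only [Set.mem_union, Set.mem_inter_iff, Set.mem_Ioc, Set.mem_Iic, Set.mem_compl_iff]
      at h1 h2 ⊢
    have := le_or_gt x a
    tauto
  have hu3 : (W ∩ Set.Ioc a 0) ∪ (Wᶜ ∩ Set.Ioc a 0) = Set.Ioc a 0 := by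
    rw [← Set.union_inter_distrib_right, Set.union_compl_self, Set.univ_inter]
  have hd1 : Disjoint (Set.Iic a) (W ∩ Set.Ioc a 0) :=
    (Set.Iic_disjoint_Ioc le_rfl).mono_right Set.inter_subset_right
  have hd2 : Disjoint W (Wᶜ ∩ Set.Ioc a 0) :=
    disjoint_compl_right.mono_right Set.inter_subset_left
  have hA1 := (Obs.isMatrixAlg_on (R := R) (q := q) hf1).isAzumayaAlgebra
  have hA2 := (Obs.isMatrixAlg_on (R := R) (q := q) hf2).isAzumayaAlgebra
  have h1 := (HalfClass.base (R := R) (q := q) a).sup (Obs.isLocallyMatrix_on _) hA1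
    (Obs.commuting_on hd1)
  rw [← Obs.on_union, hu1, ← hmap] at h1
  have h2 := h1.sup ((Obs.isLocallyMatrix_on _).map _)
    (hA2.map (f := α.1.toAlgHom) α.1.injective) ((Obs.commuting_on hd2).map _)
  rw [← Algebra.map_sup, ← Obs.on_union, hu2, cls_map hA2 (f := α.1.toAlgHom) α.1.injective,
    mul_assoc, ← cls_on_union hf1 hf2 (hd2.mono_left Set.inter_subset_left), hu3,
    ← weight_eq_mul ha] at h2
  exact index_eq (γ := 0) (by rwa [mul_one])

/-- A matrix algebra at a site whose dimension is divisible by `n` contains `Mat(R^n)` as a tensor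
factor. -/
theorem Obs.exists_equiv_tensor {X : Type} [MetricSpace X] [DecidableEq X] {q : SpinSystem X}
    {x : X} {Z : Set X} (hx : x ∈ Z) {n : ℕ} (hn : n ∣ q.dim x) :
    ∃ (T : Type u) (_ : Ring T) (_ : Algebra R T), Nonempty (Obs.on R q Z ≃ₐ[R] Mat R n ⊗[R] T) := by
  obtain ⟨k, hk⟩ := hn
  have h1 := Obs.isInternalTensor_on (R := R) (q := q) (Z := {x}) (W := Z \ {x})
    Set.disjoint_sdiff_right
  rw [Set.union_sdiff_cancel (Set.singleton_subset_iff.2 hx)] at h1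
  have e : Obs.on R q {x} ≃ₐ[R] Mat R n ⊗[R] Mat R k :=
    ((Subalgebra.equivOfEq _ _ (Obs.on_singleton x)).trans
      (AlgEquiv.ofInjective (Obs.site q x) (Obs.site_injective x)).symm).trans
        (kron R hk.symm).symm
  exact ⟨Mat R k ⊗[R] Obs.on R q (Z \ {x}), inferInstance, inferInstance,
    ⟨(h1.equiv.symm.trans (Algebra.TensorProduct.congr e AlgEquiv.refl)).trans
      (Algebra.TensorProduct.assoc R R R _ _ _)⟩⟩

/-- After stabilization, a stable isomorphism between boundary algebras becomes an isomorphism. -/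
theorem IsCut.exists_equiv_stab {X : Type} [MetricSpace X] [DecidableEq X] {q r : SpinSystem X}
    {α : Obs R q ≃ₐ[R] Obs R q} {Z Z₀ D Z₁ : Set X} (hα : IsCut α Z Z₀ D Z₁) (h : q ≤ r)
    (hZ : Z = Z₀ ∪ (Z ∩ D)) {x : X} (hx : x ∈ Z ∩ D) {n : ℕ} (hn : n ∣ (SpinSystem.quot h).dim x)
    (e : bd α Z D ⊗[R] Mat R n ≃ₐ[R] Obs.on R q (Z ∩ D) ⊗[R] Mat R n) :
    Nonempty (Obs.on R r (Z ∩ D) ≃ₐ[R] bd (stabAut R h α) Z D) := by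
  obtain ⟨T, _, _, ⟨f⟩⟩ := Obs.exists_equiv_tensor (R := R) hx hn
  -- Stabilization tensors any `S` with `A(Z ∩ D, r / q) ≃ Mat(R^n) ⊗ T`. The same rearrangement
  -- serves for the boundary algebra and for `A(Z ∩ D, q)`, so `e` can be applied in the middle.
  have g (S : Subalgebra R (Obs R q)) :
      (S.map (embL h) ⊔ (Obs.on R (SpinSystem.quot h) (Z ∩ D)).map (embQ h) :
        Subalgebra R (Obs R r)) ≃ₐ[R] (S ⊗[R] Mat R n) ⊗[R] T :=
    ((isInternalTensor_stab h S (Z ∩ D)).equiv.symm.trans (Algebra.TensorProduct.congr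
      (S.equivMapOfInjective _ (embL_injective h)).symm
      ((Subalgebra.equivMapOfInjective _ _ (embQ_injective h)).symm.trans f))).trans
        (Algebra.TensorProduct.assoc R R R _ _ _).symm
  rw [hα.bd_stabAut h hZ, Obs.on_stab h]
  exact ⟨((g _).trans (Algebra.TensorProduct.congr e.symm AlgEquiv.refl)).trans (g _).symm⟩

theorem TotalQCA.of_stab {X : Type*} [MetricSpace X] [DecidableEq X] {q r : SpinSystem X}
    (h : q ≤ r) (α : QCAGroup R q) : TotalQCA.of R r (stab R h α) = TotalQCA.of R q α :=
  (DirectLimit.eq_of_le (f := fun _ _ h => stab R h) (⟨q, α⟩ : Σ q, QCAGroup R q) r h).symm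

theorem TotalQCA.exists_of {X : Type*} [MetricSpace X] [DecidableEq X] (c : TotalQCA R X) :
    ∃ (q : SpinSystem X) (α : QCAGroup R q), c = TotalQCA.of R q α :=
  DirectLimit.exists_eq_mk _ c

theorem compl_Iic_eq_union (γ : ℤ) (l : ℕ) :
    (Set.Iic γ)ᶜ = Set.Ioi (γ + l) ∪ ((Set.Iic γ)ᶜ ∩ Set.Ioc (γ - l) (γ + l)) := by
  ext x
  simp only [Set.mem_Iic, Set.mem_union, Set.mem_inter_iff, Set.mem_Ioc, Set.mem_compl_iff,
    Set.mem_Ioi]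
  omega

theorem compl_Iic_inter_Ioc (γ : ℤ) (l : ℕ) :
    (Set.Iic γ)ᶜ ∩ Set.Ioc (γ - l) (γ + l) = Set.Ioc γ (γ + l) := by
  ext x
  simp only [Set.mem_Iic, Set.mem_inter_iff, Set.mem_Ioc, Set.mem_compl_iff]
  omega

/-- If the boundary algebras have trivial classes, a stabilization of `α` has boundary algebras
which are isomorphic to the algebras of half-intervals. -/
theorem exists_stab_equiv {α : QCAGroup R q} {l : ℕ} (hl : 1 ≤ l) (hα : HasSpread α.1 l)
    (h1 : index α = 1) : ∃ (r : SpinSystem ℤ) (h : q ≤ r), ∀ γ : ℤ,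
      Nonempty (Obs.on R r (Set.Ioc (γ - l) γ) ≃ₐ[R]
        bd (stabAut R h α.1) (Set.Iic γ) (Set.Ioc (γ - l) (γ + l))) ∧
      Nonempty (Obs.on R r (Set.Ioc γ (γ + l)) ≃ₐ[R]
        bd (stabAut R h α.1) (Set.Iic γ)ᶜ (Set.Ioc (γ - l) (γ + l))) := by
  have hA : ∀ a b : ℤ, IsAzumayaAlgebra R (Obs.on R q (Set.Ioc a b)) := fun a b =>
    (Obs.isMatrixAlg_on (Set.finite_Ioc a b)).isAzumayaAlgebra
  have hB : ∀ γ, IsAzumayaAlgebra R (bd α.1 (Set.Iic γ) (Set.Ioc (γ - l) (γ + l))) := fun γ =>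
    (HasSpread.isCut hα γ).isAzumayaAlgebra (Set.finite_Ioc _ _)
  have hB' : ∀ γ, IsAzumayaAlgebra R (bd α.1 (Set.Iic γ)ᶜ (Set.Ioc (γ - l) (γ + l))) := fun γ =>
    (HasSpread.isCut hα γ).swap.isAzumayaAlgebra (Set.finite_Ioc _ _)
  have hc : ∀ γ, cls (bd α.1 (Set.Iic γ) (Set.Ioc (γ - l) (γ + l))) =
      cls (Obs.on R q (Set.Ioc (γ - l) γ)) := fun γ => by
    have := HasSpread.index hα γ
    rw [h1, eq_comm, div_eq_one] at this
    exact this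
  -- The two boundary algebras multiply to the algebra of the whole window, so cancelling the left
  -- half in `K₀` determines the right half.
  have hc' : ∀ γ, cls (bd α.1 (Set.Iic γ)ᶜ (Set.Ioc (γ - l) (γ + l))) =
      cls (Obs.on R q (Set.Ioc γ (γ + l))) := fun γ => by
    have h2 := (HasSpread.isCut hα γ).isInternalTensor_bd.cls (hB γ) (hB' γ)
    rw [← Set.Ioc_union_Ioc_eq_Ioc (show γ - l ≤ γ by omega) (show γ ≤ γ + l by omega),
      cls_on_union (Set.finite_Ioc _ _) (Set.finite_Ioc _ _)
        (Set.Ioc_disjoint_Ioc_of_le le_rfl),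
      Set.Ioc_union_Ioc_eq_Ioc (by omega) (by omega), hc γ] at h2
    exact (mul_left_cancel h2).symm
  have hn : ∀ γ, ∃ n : ℕ, 0 < n ∧ Nonempty (bd α.1 (Set.Iic γ) (Set.Ioc (γ - l) (γ + l)) ⊗[R]
      Mat R n ≃ₐ[R] Obs.on R q (Set.Ioc (γ - l) γ) ⊗[R] Mat R n) := fun γ =>
    K0Az.exists_matrix_of_mk_eq ((cls_eq (hB γ)).symm.trans ((hc γ).trans (cls_eq (hA _ _))))
  have hn' : ∀ γ, ∃ n : ℕ, 0 < n ∧ Nonempty (bd α.1 (Set.Iic γ)ᶜ (Set.Ioc (γ - l) (γ + l)) ⊗[R]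
      Mat R n ≃ₐ[R] Obs.on R q (Set.Ioc γ (γ + l)) ⊗[R] Mat R n) := fun γ =>
    K0Az.exists_matrix_of_mk_eq ((cls_eq (hB' γ)).symm.trans ((hc' γ).trans (cls_eq (hA _ _))))
  choose n hn0 e using hn
  choose n' hn0' e' using hn'
  -- Site `x` supplies the auxiliary matrices for the left side of the cut at `x` and for the right
  -- side of the cut at `x - 1`. Thus one spin system serves all cuts. As `l ≥ 1`, the sites `γ` and
  -- `γ + 1` do lie in the two half-windows.
  let r : SpinSystem ℤ :=
    ⟨fun x => q.dim x * (n x * n' (x - 1)),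
      fun x => Nat.mul_pos (q.dim_pos x) (Nat.mul_pos (hn0 x) (hn0' _)), fun B hB =>
        (Metric.finite_isBounded_inter_isClosed DiscreteTopology.isDiscrete hB isClosed_univ).subset
          fun x hx => ⟨hx.2, trivial⟩⟩
  have h : q ≤ r := fun x => dvd_mul_right _ _
  have hdim : ∀ x, (SpinSystem.quot h).dim x = n x * n' (x - 1) := fun x =>
    Nat.mul_div_cancel_left _ (q.dim_pos x)
  refine ⟨r, h, fun γ => ⟨?_, ?_⟩⟩
  · obtain ⟨e⟩ := e γ
    rw [← Iic_inter_Ioc] at e ⊢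
    refine (HasSpread.isCut hα γ).exists_equiv_stab h (Iic_eq_union γ l) (x := γ) ?_ ?_ e
    · rw [Iic_inter_Ioc, Set.mem_Ioc]
      omega
    · rw [hdim]
      exact dvd_mul_right _ _
  · obtain ⟨e⟩ := e' γ
    rw [← compl_Iic_inter_Ioc] at e ⊢
    refine (HasSpread.isCut hα γ).swap.exists_equiv_stab h (compl_Iic_eq_union γ l) (x := γ + 1)
      ?_ ?_ e
    · rw [compl_Iic_inter_Ioc, Set.mem_Ioc]
      omega
    · rw [hdim, add_sub_cancel_right]
      exact dvd_mul_left _ _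

/-- The fibers of `x ↦ ⌊(x - o - 1) / p⌋` are intervals of length `p`. -/
theorem preimage_ediv {o p : ℤ} (hp : 0 < p) (k : ℤ) :
    (fun x : ℤ => (x - o - 1) / p) ⁻¹' {k} = Set.Ioc (o + p * k) (o + p * k + p) := by
  ext x
  simp only [Set.mem_preimage, Set.mem_singleton_iff, Set.mem_Ioc]
  rw [le_antisymm_iff, Int.le_ediv_iff_mul_le hp, ← Int.lt_add_one_iff, Int.ediv_lt_iff_lt_mul hp,
    add_mul, one_mul, mul_comm k]
  omega

theorem dist_le_of_ediv_eq {o p : ℤ} (hp : 0 < p) (x y : ℤ)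
    (h : (x - o - 1) / p = (y - o - 1) / p) : dist x y ≤ p := by
  have hx : x ∈ (fun x : ℤ => (x - o - 1) / p) ⁻¹' {(y - o - 1) / p} := h
  have hy : y ∈ (fun x : ℤ => (x - o - 1) / p) ⁻¹' {(y - o - 1) / p} := rfl
  rw [preimage_ediv hp, Set.mem_Ioc] at hx hy
  rw [Int.dist_eq]
  have : |x - y| ≤ p := abs_le.2 ⟨by linarith, by linarith⟩
  exact_mod_cast this

/-- If the boundary algebras are isomorphic to the algebras of half-intervals, then `α` is a
composition of two single-layer circuits. -/
theorem exists_single_layers {α : QCAGroup R q} {l : ℕ} (hl : 1 ≤ l) (hα : HasSpread α.1 l)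
    (he : ∀ γ : ℤ,
      Nonempty (Obs.on R q (Set.Ioc (γ - l) γ) ≃ₐ[R]
        bd α.1 (Set.Iic γ) (Set.Ioc (γ - l) (γ + l))) ∧
      Nonempty (Obs.on R q (Set.Ioc γ (γ + l)) ≃ₐ[R]
        bd α.1 (Set.Iic γ)ᶜ (Set.Ioc (γ - l) (γ + l)))) :
    ∃ β δ : QCAGroup R q, IsSingleLayer β.1 ∧ IsSingleLayer δ.1 ∧ α = β * δ := by
  -- Cuts are placed at the multiples of `2l`, so that the windows of radius `l` around them tile
  -- `ℤ`.
  let p : ℤ := 2 * l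
  have hp : 0 < p := by omega
  have hI : ∀ k : ℤ, (fun x : ℤ => (x - (-l) - 1) / p) ⁻¹' {k} =
      Set.Ioc (p * k - l) (p * k + l) := fun k => by
    rw [preimage_ediv hp]
    congr 1 <;> simp only [p] <;> ring
  -- Both the two half-intervals and the two boundary algebras factor the algebra of the window at
  -- `pk`; `τ k` matches these factorizations.
  have hτ : ∀ k : ℤ, ∃ τ : Obs.on R q ((fun x : ℤ => (x - (-l) - 1) / p) ⁻¹' {k}) ≃ₐ[R]
      Obs.on R q ((fun x : ℤ => (x - (-l) - 1) / p) ⁻¹' {k}),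
      (∀ t : Obs.on R q ((fun x : ℤ => (x - (-l) - 1) / p) ⁻¹' {k}),
        (t : Obs R q) ∈ Obs.on R q (Set.Ioc (p * k - l) (p * k)) →
        (τ t : Obs R q) ∈ bd α.1 (Set.Iic (p * k)) (Set.Ioc (p * k - l) (p * k + l))) ∧
      ∀ t : Obs.on R q ((fun x : ℤ => (x - (-l) - 1) / p) ⁻¹' {k}),
        (t : Obs R q) ∈ Obs.on R q (Set.Ioc (p * k) (p * k + l)) →
        (τ t : Obs R q) ∈ bd α.1 (Set.Iic (p * k))ᶜ (Set.Ioc (p * k - l) (p * k + l)) := by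
    intro k
    rw [hI]
    obtain ⟨⟨e⟩, ⟨e'⟩⟩ := he (p * k)
    have h1 := Obs.isInternalTensor_on (R := R) (q := q)
      (Z := Set.Ioc (p * k - l) (p * k)) (W := Set.Ioc (p * k) (p * k + l))
      (Set.Ioc_disjoint_Ioc_of_le le_rfl)
    rw [Set.Ioc_union_Ioc_eq_Ioc (by omega) (by omega)] at h1
    exact h1.exists_equiv (HasSpread.isCut hα (p * k)).isInternalTensor_bd e e'
  choose τ hτ1 hτ2 using hτ
  have hβ : IsSingleLayer (blockAut τ) := isSingleLayer_blockAut (dist_le_of_ediv_eq hp) τ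
  have hinter : ∀ (Z W : Set ℤ) (t : Obs R q), t ∈ (Obs.on R q Z).map α.1.toAlgHom →
      t ∈ (Obs.on R q W).map α.1.toAlgHom → t ∈ (Obs.on R q (Z ∩ W)).map α.1.toAlgHom := by
    rintro Z W _ ⟨a, ha, rfl⟩ ⟨b, hb, hab⟩
    obtain rfl := α.1.injective hab
    exact ⟨_, (Obs.on_inter Z W).le ⟨ha, hb⟩, rfl⟩
  have hJ : ∀ k : ℤ, (fun x : ℤ => (x - 0 - 1) / p) ⁻¹' {k} =
      (Set.Iic (p * k))ᶜ ∩ Set.Iic (p * (k + 1)) := fun k => by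
    rw [preimage_ediv hp]
    ext x
    simp only [Set.mem_Ioc, Set.mem_inter_iff, Set.mem_compl_iff, Set.mem_Iic, mul_add]
    omega
  -- The second layer lives on the blocks `(pk, p(k + 1)]` between cuts. It suffices that the first
  -- layer maps the algebra of such a block into its image under `α`.
  have hδ : IsSingleLayer (α.1⁻¹ * blockAut τ) := by
    refine isSingleLayer_of_fibers (dist_le_of_ediv_eq (o := 0) hp) fun k => ?_
    suffices (Obs.on R q ((fun x : ℤ => (x - 0 - 1) / p) ⁻¹' {k})).map (blockAut τ).toAlgHom ≤
        (Obs.on R q ((fun x : ℤ => (x - 0 - 1) / p) ⁻¹' {k})).map α.1.toAlgHom by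
      rintro _ ⟨t, ht, rfl⟩
      obtain ⟨s, hs, h⟩ := this ⟨t, ht, rfl⟩
      have h' : s = (α.1⁻¹ * blockAut τ) t := by
        change s = α.1.symm (blockAut τ t)
        rw [AlgEquiv.eq_symm_apply]
        exact h
      exact h' ▸ hs
    rw [hJ]
    have hk : p * (k + 1) - l = p * k + l := by simp only [p]; ring
    have hu : (Set.Iic (p * k))ᶜ ∩ Set.Iic (p * (k + 1)) =
        Set.Ioc (p * k) (p * k + l) ∪ Set.Ioc (p * (k + 1) - l) (p * (k + 1)) := by
      ext x
      simp only [Set.mem_Ioc, Set.mem_inter_iff, Set.mem_compl_iff, Set.mem_Iic, Set.mem_union]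
      omega
    rw [Subalgebra.map_le]
    conv_lhs => rw [hu, Obs.on_union]
    refine sup_le (fun t ht => ?_) (fun t ht => ?_)
    · have hm : t ∈ Obs.on R q ((fun x : ℤ => (x - (-l) - 1) / p) ⁻¹' {k}) := by
        rw [hI]
        exact Obs.on_mono (Set.Ioc_subset_Ioc_left (by omega)) ht
      have h1 := hτ2 k ⟨t, hm⟩ ht
      rw [← blockAut_apply] at h1
      -- The right boundary algebra at `pk` lies in `α(A(> pk))` by definition. Being supported on
      -- sites at most `pk + l = p(k + 1) - l`, it also lies in `α(A(≤ p(k + 1)))`.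
      refine hinter _ _ _ h1.1 ((HasSpread.isCut hα (p * (k + 1))).le₀ ?_)
      rw [hk]
      exact Obs.on_mono Set.Ioc_subset_Iic_self h1.2
    · have hm : t ∈ Obs.on R q ((fun x : ℤ => (x - (-l) - 1) / p) ⁻¹' {k + 1}) := by
        rw [hI]
        exact Obs.on_mono (Set.Ioc_subset_Ioc_right (by omega)) ht
      have h1 := hτ1 (k + 1) ⟨t, hm⟩ ht
      rw [← blockAut_apply] at h1
      -- Mirror image: the left boundary algebra at `p(k + 1)` is supported beyond `pk + l`, hence
      -- lies in `α(A(> pk))`.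
      refine hinter _ _ _ ((HasSpread.isCut hα (p * k)).le₁ ?_) h1.1
      rw [← hk]
      exact Obs.on_mono Set.Ioc_subset_Ioi_self h1.2
  let β : QCAGroup R q := ⟨blockAut τ, hβ.isLocalityPreserving⟩
  refine ⟨β, (α⁻¹ * β)⁻¹, hβ, hδ.inv, ?_⟩
  group

theorem exists_circuit_of_boundaryHom_eq_one {c : TotalQCA R ℤ} (hc : boundaryHom c = 1) :
    ∃ (q : SpinSystem ℤ) (α β : QCAGroup R q),
      IsSingleLayer α.1 ∧ IsSingleLayer β.1 ∧ c = TotalQCA.of R q (α * β) := by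
  obtain ⟨q, α, rfl⟩ := TotalQCA.exists_of c
  rw [boundaryHom_of] at hc
  obtain ⟨l, hl, hα⟩ := IsLocalityPreserving.exists_nat α.2
  obtain ⟨r, h, he⟩ := exists_stab_equiv hl hα hc
  obtain ⟨β, δ, hβ, hδ, e⟩ := exists_single_layers (α := stab R h α) hl
    (HasSpread.stabAut h l.cast_nonneg hα) he
  exact ⟨r, β, δ, hβ, hδ, by rw [← e, TotalQCA.of_stab]⟩

/-- The kernel is a subgroup, so triviality on single layers is enough. -/
theorem boundaryHom_eq_one_of_mem_circuits {c : TotalQCA R ℤ} (hc : c ∈ circuits R ℤ) :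
    boundaryHom c = 1 := by
  have : circuits R ℤ ≤ (boundaryHom (R := R)).ker := by
    refine iSup_le fun q => Subgroup.map_le_iff_le_comap.2 ((Subgroup.closure_le _).2 ?_)
    intro α hα
    exact index_eq_one hα
  exact this hc

theorem mem_circuits_of_isSingleLayer {α : QCAGroup R q} (h : IsSingleLayer α.1) :
    TotalQCA.of R q α ∈ circuits R ℤ :=
  (le_iSup (fun q => (circuitsOn R q).map (TotalQCA.of R q)) q)
    ⟨α, Subgroup.subset_closure h, rfl⟩

theorem ker_boundaryHom : (boundaryHom (R := R)).ker = circuits R ℤ := by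
  refine le_antisymm (fun c hc => ?_) fun c hc => boundaryHom_eq_one_of_mem_circuits hc
  obtain ⟨q, α, β, hα, hβ, rfl⟩ := exists_circuit_of_boundaryHom_eq_one hc
  rw [map_mul]
  exact mul_mem (mem_circuits_of_isSingleLayer hα) (mem_circuits_of_isSingleLayer hβ)

end Kernel

/-! ### Partial translations and surjectivity -/

section Shift

universe u

variable {R : Type u} [CommRing R]

/-- The spin system with the same dimension `n` at every site of `ℤ`. -/
def SpinSystem.const (n : ℕ) (hn : 0 < n) : SpinSystem ℤ where
  dim _ := n
  dim_pos _ := hn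
  locallyFinite _ hB := (Metric.finite_isBounded_inter_isClosed DiscreteTopology.isDiscrete hB
    isClosed_univ).subset fun _ hx => ⟨hx.2, trivial⟩

variable {A A' : Type u} [Ring A] [Algebra R A] [Ring A'] [Algebra R A'] {n : ℕ} (hn : 0 < n)
  (e : A ⊗[R] A' ≃ₐ[R] Mat R n)

/-- The tensor factor `A` of the matrix algebra at the site `x`. -/
def siteL (x : ℤ) : A →ₐ[R] Obs R (SpinSystem.const n hn) :=
  (Obs.site (SpinSystem.const n hn) x).comp (e.toAlgHom.comp Algebra.TensorProduct.includeLeft)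

/-- The tensor factor `A'` of the matrix algebra at the site `x`. -/
def siteR (x : ℤ) : A' →ₐ[R] Obs R (SpinSystem.const n hn) :=
  (Obs.site (SpinSystem.const n hn) x).comp (e.toAlgHom.comp Algebra.TensorProduct.includeRight)

theorem siteL_mem {Z : Set ℤ} {x : ℤ} (hx : x ∈ Z) (a : A) :
    siteL hn e x a ∈ Obs.on R (SpinSystem.const n hn) Z := Obs.site_mem_on hx _

theorem siteR_mem {Z : Set ℤ} {x : ℤ} (hx : x ∈ Z) (a : A') :
    siteR hn e x a ∈ Obs.on R (SpinSystem.const n hn) Z := Obs.site_mem_on hx _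

theorem siteL_commute {x y : ℤ} (h : x ≠ y) (a b : A) :
    Commute (siteL hn e x a) (siteL hn e y b) := Obs.site_commute h _ _

theorem siteR_commute {x y : ℤ} (h : x ≠ y) (a b : A') :
    Commute (siteR hn e x a) (siteR hn e y b) := Obs.site_commute h _ _

theorem siteL_siteR_commute (x y : ℤ) (a : A) (b : A') :
    Commute (siteL hn e x a) (siteR hn e y b) := by
  by_cases h : x = y
  · subst h
    refine Commute.map (f := Obs.site (SpinSystem.const n hn) x) (Commute.map (f := e) ?_)
    simp [Commute, SemiconjBy]
  · exact Obs.site_commute h _ _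

theorem site_tmul (x : ℤ) (a : A) (b : A') :
    Obs.site (SpinSystem.const n hn) x (e (a ⊗ₜ b)) = siteL hn e x a * siteR hn e x b := by
  have h : a ⊗ₜ[R] b = (a ⊗ₜ 1) * (1 ⊗ₜ b) := by simp
  rw [h, map_mul]
  exact map_mul (Obs.site (SpinSystem.const n hn) x) _ _

/-- A subalgebra which contains both tensor factors at `x` contains all observables at `x`. -/
theorem site_mem_of_factors {S : Subalgebra R (Obs R (SpinSystem.const n hn))} {x : ℤ}
    (hL : ∀ a, siteL hn e x a ∈ S) (hR : ∀ b, siteR hn e x b ∈ S) (c : Mat R n) :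
    Obs.site (SpinSystem.const n hn) x c ∈ S := by
  obtain ⟨z, rfl⟩ := e.surjective c
  induction z using TensorProduct.induction_on with
  | zero =>
    rw [map_zero]
    exact (map_zero (Obs.site (R := R) (SpinSystem.const n hn) x)).symm ▸ zero_mem S
  | add z z' h h' =>
    rw [map_add]
    exact (map_add (Obs.site (R := R) (SpinSystem.const n hn) x) (e z) (e z')).symm ▸ add_mem h h'
  | tmul a b =>
    rw [site_tmul]
    exact mul_mem (hL a) (hR b)

theorem algHom_ext_factors {C : Type*} [Ring C] [Algebra R C]
    {f g : Obs R (SpinSystem.const n hn) →ₐ[R] C}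
    (hL : ∀ x a, f (siteL hn e x a) = g (siteL hn e x a))
    (hR : ∀ x b, f (siteR hn e x b) = g (siteR hn e x b)) : f = g :=
  AlgHom.ext fun t => LocalTensor.mem_of_site_mem (S := AlgHom.equalizer f g)
    (fun x c => site_mem_of_factors hn e (hL x) (hR x) c) t

/-- The map at the site `x` which defines the translation of the factor `A` by `k`. -/
def shiftSite (k x : ℤ) : Mat R n →ₐ[R] Obs R (SpinSystem.const n hn) :=
  (Algebra.TensorProduct.lift (siteL hn e (x + k)) (siteR hn e x)
    fun a b => siteL_siteR_commute hn e _ _ a b).comp e.symm.toAlgHom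

theorem shiftSite_tmul (k x : ℤ) (a : A) (b : A') :
    shiftSite hn e k x (e (a ⊗ₜ b)) = siteL hn e (x + k) a * siteR hn e x b := by
  have h : shiftSite hn e k x (e (a ⊗ₜ b)) = Algebra.TensorProduct.lift (siteL hn e (x + k))
    (siteR hn e x) (fun a b => siteL_siteR_commute hn e _ _ a b) (e.symm (e (a ⊗ₜ b))) := rfl
  rw [h, AlgEquiv.symm_apply_apply, Algebra.TensorProduct.lift_tmul]

theorem shiftSite_commute (k : ℤ) {x y : ℤ} (h : x ≠ y) (c d : Mat R n) :
    Commute (shiftSite hn e k x c) (shiftSite hn e k y d) := by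
  obtain ⟨z, rfl⟩ := e.surjective c
  obtain ⟨w, rfl⟩ := e.surjective d
  induction z using TensorProduct.induction_on with
  | zero => simp
  | add z z' hz hz' => rw [map_add, map_add]; exact hz.add_left hz'
  | tmul a a' =>
    induction w using TensorProduct.induction_on with
    | zero => simp
    | add w w' hw hw' => rw [map_add, map_add]; exact hw.add_right hw'
    | tmul b b' =>
      rw [shiftSite_tmul, shiftSite_tmul]
      have h' : x + k ≠ y + k := fun h' => h (add_right_cancel h')
      exact ((siteL_commute hn e h' a b).mul_right (siteL_siteR_commute hn e _ _ a b')).mul_left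
        ((siteL_siteR_commute hn e _ _ b a').symm.mul_right (siteR_commute hn e h a' b'))

/-- Translation of the tensor factor `A` by `k`. -/
def shiftHom (k : ℤ) : Obs R (SpinSystem.const n hn) →ₐ[R] Obs R (SpinSystem.const n hn) :=
  LocalTensor.lift (A := fun x => Mat R ((SpinSystem.const n hn).dim x)) (shiftSite hn e k)
    fun _ _ h c d => shiftSite_commute hn e k h c d

theorem shiftHom_site (k x : ℤ) (c : Mat R n) :
    shiftHom hn e k (Obs.site (SpinSystem.const n hn) x c) = shiftSite hn e k x c :=
  LocalTensor.lift_site (A := fun x => Mat R ((SpinSystem.const n hn).dim x)) _ _ x c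

theorem shiftHom_siteL (k x : ℤ) (a : A) :
    shiftHom hn e k (siteL hn e x a) = siteL hn e (x + k) a := by
  refine (shiftHom_site hn e k x (e (a ⊗ₜ 1))).trans ?_
  rw [shiftSite_tmul, map_one, mul_one]

theorem shiftHom_siteR (k x : ℤ) (b : A') :
    shiftHom hn e k (siteR hn e x b) = siteR hn e x b := by
  refine (shiftHom_site hn e k x (e (1 ⊗ₜ b))).trans ?_
  rw [shiftSite_tmul, map_one, one_mul]

theorem shiftHom_comp {k m : ℤ} (h : k + m = 0) :
    (shiftHom hn e m).comp (shiftHom hn e k) = AlgHom.id R _ :=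
  algHom_ext_factors hn e
    (fun x a => by
      rw [AlgHom.comp_apply, shiftHom_siteL, shiftHom_siteL, add_assoc, h, add_zero,
        AlgHom.id_apply])
    (fun x a => by rw [AlgHom.comp_apply, shiftHom_siteR, shiftHom_siteR, AlgHom.id_apply])

/-- Translation of the tensor factor `A` by one site. -/
def shiftAut : Obs R (SpinSystem.const n hn) ≃ₐ[R] Obs R (SpinSystem.const n hn) :=
  AlgEquiv.ofAlgHom (shiftHom hn e 1) (shiftHom hn e (-1)) (shiftHom_comp hn e (by norm_num))
    (shiftHom_comp hn e (by norm_num))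

theorem shiftAut_siteL (x : ℤ) (a : A) :
    shiftAut hn e (siteL hn e x a) = siteL hn e (x + 1) a := by
  rw [shiftAut, AlgEquiv.ofAlgHom_apply, shiftHom_siteL]

theorem shiftAut_siteR (x : ℤ) (b : A') :
    shiftAut hn e (siteR hn e x b) = siteR hn e x b := by
  rw [shiftAut, AlgEquiv.ofAlgHom_apply, shiftHom_siteR]

theorem hasSpread_shiftAut : HasSpread (shiftAut hn e) 1 := fun x c => by
  have hb : ∀ y, x ≤ y → y ≤ x + 1 → y ∈ Metric.closedBall x (1 : ℝ) := fun y h1 h2 => by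
    have := (mem_closedBall_int (x := x) (y := y) (l := 1)).2 (by push_cast; omega)
    rwa [Nat.cast_one] at this
  refine site_mem_of_factors hn e
    (S := (Obs.on R (SpinSystem.const n hn) (Metric.closedBall x 1)).comap
      (shiftAut hn e).toAlgHom) (fun a => ?_) (fun b => ?_) c
  · rw [Subalgebra.mem_comap, AlgEquiv.coe_toAlgHom, shiftAut_siteL]
    exact siteL_mem hn e (hb _ (by omega) le_rfl) a
  · rw [Subalgebra.mem_comap, AlgEquiv.coe_toAlgHom, shiftAut_siteR]
    exact siteR_mem hn e (hb _ le_rfl (by omega)) b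

/-- Only the copy of `A` at site `0` crosses the cut, landing at site `1`; the copies further left
refill the factors `A` at the sites up to `0`. -/
theorem map_shiftAut_Iic :
    (Obs.on R (SpinSystem.const n hn) (Set.Iic 0)).map (shiftAut hn e).toAlgHom =
      Obs.on R (SpinSystem.const n hn) (Set.Iic 0) ⊔ (siteL hn e 1).range := by
  have h1 : Obs.on R (SpinSystem.const n hn) (Set.Iic 0) ≤
      Obs.on R (SpinSystem.const n hn) (Set.Iic 0) ⊔ (siteL hn e 1).range := le_sup_left
  have h2 : (siteL hn e 1).range ≤
      Obs.on R (SpinSystem.const n hn) (Set.Iic 0) ⊔ (siteL hn e 1).range := le_sup_right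
  refine le_antisymm ?_ (sup_le (Obs.on_le_iff.2 fun x hx c => ?_) ?_)
  · rw [Subalgebra.map_le]
    refine Obs.on_le_iff.2 fun x hx c => site_mem_of_factors hn e (fun a => ?_) (fun b => ?_) c
    · rw [Subalgebra.mem_comap, AlgEquiv.coe_toAlgHom, shiftAut_siteL]
      rcases (Set.mem_Iic.1 hx).lt_or_eq with h | rfl
      · exact h1 (siteL_mem hn e (Set.mem_Iic.2 (by omega)) a)
      · exact h2 ⟨a, rfl⟩
    · rw [Subalgebra.mem_comap, AlgEquiv.coe_toAlgHom, shiftAut_siteR]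
      exact h1 (siteR_mem hn e hx b)
  · refine site_mem_of_factors hn e (fun a => ?_) (fun b => ?_) c
    · refine ⟨siteL hn e (x - 1) a, siteL_mem hn e ?_ a, ?_⟩
      · simp only [Set.mem_Iic] at hx ⊢
        omega
      · refine (shiftAut_siteL hn e _ a).trans ?_
        rw [sub_add_cancel]
    · exact ⟨siteR hn e x b, siteR_mem hn e hx b, shiftAut_siteR hn e x b⟩
  · rintro _ ⟨a, rfl⟩
    exact ⟨siteL hn e 0 a, siteL_mem hn e (Set.mem_Iic.2 le_rfl) a, shiftAut_siteL hn e 0 a⟩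

/-- A unital functional on the complementary factor `A'` makes `a ↦ a ⊗ 1` injective. -/
theorem siteL_injective (hA' : IsAzumayaAlgebra R A') (x : ℤ) :
    Function.Injective (siteL hn e x) := by
  obtain ⟨f, hf⟩ := hA'.exists_functional
  exact (Obs.site_injective (q := SpinSystem.const n hn) x).comp
    (e.injective.comp (includeLeft_injective_of_functional hf))

/-- Choose `A'` with `A ⊗ A' ≃ Mat(R^n)` and translate the factor `A`. The half-line algebra gains
one copy of `A`, so the index is its class; quotients of such classes exhaust `K₀`. -/
theorem exists_boundaryHom_eq (hA : IsAzumayaAlgebra R A) :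
    ∃ c : TotalQCA R ℤ, boundaryHom c = K0Az.mk A hA := by
  obtain ⟨A', _, _, n, hn, ⟨e⟩⟩ := id hA
  have hA' : IsAzumayaAlgebra R A' := ⟨A, inferInstance, inferInstance, n, hn,
    ⟨(Algebra.TensorProduct.comm R A' A).trans e⟩⟩
  let α : QCAGroup R (SpinSystem.const n hn) :=
    ⟨shiftAut hn e, 1, one_pos, hasSpread_shiftAut hn e⟩
  have i : A ≃ₐ[R] (siteL hn e 1).range :=
    AlgEquiv.ofInjective (siteL hn e 1) (siteL_injective hn e hA' 1)
  have hS : IsAzumayaAlgebra R (siteL hn e 1).range := hA.congr i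
  have hc : Commuting (Obs.on R (SpinSystem.const n hn) (Set.Iic 0)) (siteL hn e 1).range := by
    refine (Obs.commuting_on (W := {1}) (by simp)).mono le_rfl ?_
    rintro _ ⟨a, rfl⟩
    exact siteL_mem hn e (Set.mem_singleton 1) a
  have h := (HalfClass.base 0).sup (Obs.isLocallyMatrix_on _) hS hc
  rw [← map_shiftAut_Iic] at h
  refine ⟨TotalQCA.of R _ α, ?_⟩
  rw [boundaryHom_of, index_eq (α := α) h, cls_eq hS]
  exact K0Az.mk_congr _ _ i.symm

theorem boundaryHom_surjective : Function.Surjective (boundaryHom (R := R)) := by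
  intro x
  obtain ⟨A, B, rfl⟩ := K0Az.exists_div x
  obtain ⟨c, hc⟩ := exists_boundaryHom_eq A.isAzumaya
  obtain ⟨d, hd⟩ := exists_boundaryHom_eq B.isAzumaya
  exact ⟨c / d, by rw [map_div, hc, hd]⟩

end Shift

end

end QCA

theorem mainTheorem3 {R : Type*} [CommRing R] :
    ∃ b : QCA.TotalQCA R ℤ →* QCA.K0Az R,
      (∀ (q : QCA.SpinSystem ℤ) (α : QCA.QCAGroup R q) (l : ℕ), QCA.HasSpread α.1 l → ∀ γ : ℤ,
        QCA.IsInternalTensor (QCA.Obs.on R q (Set.Iic (γ - l))) (QCA.boundaryAlgebra α.1 l γ)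
            ((QCA.Obs.on R q (Set.Iic γ)).map α.1.toAlgHom) ∧
          ∃ (hB : QCA.IsAzumayaAlgebra R (QCA.boundaryAlgebra α.1 l γ))
            (hA : QCA.IsAzumayaAlgebra R (QCA.Obs.on R q (Set.Ioc (γ - l) γ))),
            b (QCA.TotalQCA.of R q α) = QCA.K0Az.mk _ hB / QCA.K0Az.mk _ hA) ∧
      Function.Surjective b ∧
      b.ker = QCA.circuits R ℤ ∧
      ∀ c ∈ QCA.circuits R ℤ, ∃ (q : QCA.SpinSystem ℤ) (α β : QCA.QCAGroup R q),
        QCA.IsSingleLayer α.1 ∧ QCA.IsSingleLayer β.1 ∧ c = QCA.TotalQCA.of R q (α * β) := by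
  refine ⟨QCA.boundaryHom, fun q α l hα γ => ?_, QCA.boundaryHom_surjective, QCA.ker_boundaryHom,
    fun c hc => QCA.exists_circuit_of_boundaryHom_eq_one
      (QCA.boundaryHom_eq_one_of_mem_circuits hc)⟩
  have hcut := QCA.HasSpread.isCut hα γ
  have hB : QCA.IsAzumayaAlgebra R (QCA.boundaryAlgebra α.1 l γ) :=
    hcut.isAzumayaAlgebra (Set.finite_Ioc _ _)
  have hA : QCA.IsAzumayaAlgebra R (QCA.Obs.on R q (Set.Ioc (γ - l) γ)) :=
    (QCA.Obs.isMatrixAlg_on (Set.finite_Ioc _ _)).isAzumayaAlgebra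
  refine ⟨hcut.isInternalTensor, hB, hA, ?_⟩
  rw [QCA.boundaryHom_of, QCA.HasSpread.index hα γ, QCA.cls_eq hB, QCA.cls_eq hA]
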